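/- **Setting.** Let $X$ be a locally compact Polish space with Borel $\sigma$-algebra, $\sigma$ a Radon (locally finite Borel) measure on $X$, $\mathcal H=L^2(X,\sigma)$ the complex $L^2$-space with scalar product $(\cdot,\cdot)$ linear in the first variable, and $X=X_1\sqcup X_2$ a partition into measurable sets. Let $\mathcal B_0(X)$ be the Borel sets with compact closure and, for measurable $\Delta$, let $P_\Delta$ be multiplication by the indicator function of $\Delta$; put $P_i=P_{X_i}$. Let $\mathbb K$ be a bounded operator in $\mathcal H$ which is $J$-self-adjoint for $J=P_1-P_2$ (that is, $(J\mathbb Kf,g)=(Jf,\mathbb Kg)$ for all $f,g$), such that $P_\Delta\mathbb KP_\Delta$ is trace class whenever $\Delta\in\mathcal B_0(X)$ and $\Delta\subset X_1$ or $\Delta\subset X_2$, and such that $K:=\mathbb KP_1+(\mathbf 1-\mathbb K)P_2$ satisfies $\mathbf 0\le K\le\mathbf 1$. Put $K_1=\sqrt K$, $K_2=\sqrt{\mathbf 1-K}$. Let $\mathcal G=\mathcal H\oplus\mathcal H$. Let $\mathcal{AF}(\mathcal G)=\bigoplus_{n\ge0}\mathcal G^{\wedge n}n!$ be the antisymmetric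 Fock space, and $\mathcal{AF}_{\rm fin}(\mathcal G)$ its subspace of finite sequences, with the topology of the locally convex direct sum of the Hilbert spaces $\mathcal G^{\wedge n}$. Let $\mathcal L$ be the algebra of continuous linear operators in $\mathcal{AF}_{\rm fin}(\mathcal G)$. In $\mathcal L$ we use $a^+(\varphi)g=\varphi\wedge g$ and $a^-(\varphi)=a^+(\varphi)^*$ for $\varphi\in\mathcal G$; $a^+(\varphi^{(2)})g=\mathcal A(\varphi^{(2)}\otimes g)$, with $\mathcal A$ the antisymmetrization projection, and $a^-(\varphi^{(2)})=a^+(\varphi^{(2)})^*$ for $\varphi^{(2)}\in\mathcal G\otimes\mathcal G$; and the differential second quantization $d\Gamma(B)$ of a bounded operator $B$ in $\mathcal G$. Here adjoints are taken in $\mathcal{AF}(\mathcal G)$. Write $a_1^\pm(\varphi)=a^\pm(\varphi,0)$ and $a_2^\pm(\varphi)=a^\pm(0,\varphi)$ for $\varphi\in\mathcal H$. For $\Delta\in\mathcal B_0(X)$ let $J_\Delta=P_{\Delta\cap X_1}-P_{\Delta\cap X_2}$, and let $\kappa_\Delta\in\mathcal G\otimes\mathcal G$ be the image of the integral kernel $(K_2J_\Delta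 K_1)(\cdot,\cdot)\in\mathcal H\otimes\mathcal H$ of the Hilbert–Schmidt operator $K_2J_\Delta K_1$ under the isometry $\varphi\otimes\psi\mapsto(0,\varphi)\otimes(\psi,0)$. With $\overline B=\mathcal CB\mathcal C$, where $\mathcal C$ is complex conjugation, the particle density is $$\rho(\Delta)=a^+(\kappa_\Delta)+a^-(\kappa_\Delta)+d\Gamma\big(\overline{-K_1J_\Delta K_1}\oplus K_2J_\Delta K_2\big)+\sum_{i=1,2}\operatorname{Tr}\big(P_{\Delta\cap X_i}\mathbb KP_{\Delta\cap X_i}\big)\in\mathcal L.$$ Its Wick polynomials are defined by ${:}\rho(\Delta){:}=\rho(\Delta)$ and $${:}\rho(\Delta_1)\cdots\rho(\Delta_{n+1}){:}=\rho(\Delta_{n+1})\,{:}\rho(\Delta_1)\cdots\rho(\Delta_n){:}-\sum_{i=1}^n{:}\rho(\Delta_1)\cdots\rho(\Delta_i\cap\Delta_{n+1})\cdots\rho(\Delta_n){:}.$$ Let $(e_i)_{i\in I}$ be an orthonormal basis of $\mathcal H$ consisting of real-valued functions. For $R\in\mathcal L$ and $\Delta\in\mathcal B_0(X)$ with $\Delta\subset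 X_1$ put $$W(\Delta,R)=\sum_{i,j}\Big[(K_2P_\Delta K_1e_j,e_i)a_2^+(e_i)Ra_1^+(e_j)+(K_1P_\Delta K_2e_j,e_i)a_1^-(e_i)Ra_2^-(e_j)+(K_2P_\Delta K_2e_j,e_i)a_2^+(e_i)Ra_2^-(e_j)+(K_1P_\Delta K_1e_j,e_i)a_1^-(e_i)Ra_1^+(e_j)\Big],$$ and for $\Delta\in\mathcal B_0(X)$ with $\Delta\subset X_2$ put $$W(\Delta,R)=\sum_{i,j}\Big[(K_2P_\Delta K_1e_i,e_j)a_1^+(e_i)Ra_2^+(e_j)+(K_1P_\Delta K_2e_i,e_j)a_2^-(e_i)Ra_1^-(e_j)+(K_1P_\Delta K_1e_i,e_j)a_1^+(e_i)Ra_1^-(e_j)+(K_2P_\Delta K_2e_i,e_j)a_2^-(e_i)Ra_2^+(e_j)\Big];$$ for general $\Delta\in\mathcal B_0(X)$ put $W(\Delta,R)=W(\Delta\cap X_1,R)+W(\Delta\cap X_2,R)$. The double series are understood as strong limits: applied to any $f\in\mathcal{AF}_{\rm fin}(\mathcal G)$, the sums over $i\in F$, $j\in F'$ with finite $F,F'\subset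 I$ converge in $\mathcal{AF}_{\rm fin}(\mathcal G)$ as $F$ and $F'$ increase to $I$. **Statement.** For every $R\in\mathcal L$ the double series defining $W(\Delta,R)$ converge strongly to operators in $\mathcal L$, so that $W(\Delta,R)\in\mathcal L$ for all $\Delta\in\mathcal B_0(X)$. For all $\Delta_1,\Delta_2\in\mathcal B_0(X)$ and $R\in\mathcal L$, $$\rho(\Delta_1)W(\Delta_2,R)=W(\Delta_2,\rho(\Delta_1)R)+W(\Delta_1\cap\Delta_2,R).$$ For all $n\ge2$ and $\Delta_1,\dots,\Delta_n\in\mathcal B_0(X)$, $${:}\rho(\Delta_1)\cdots\rho(\Delta_n){:}=W\big(\Delta_n,{:}\rho(\Delta_1)\cdots\rho(\Delta_{n-1}){:}\big).$$ -/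

import Mathlib

open MeasureTheory Filter Topology UniformSpace
open scoped TensorProduct ComplexInnerProductSpace ENNReal

noncomputable section

universe u

/-! ## Hilbert tensor powers and antisymmetric tensor powers -/

section Tensor

/-- A bundled complex Hilbert space (only used for the recursion in `tensorPowAux`). -/
structure BundledHilbert : Type (u + 1) where
  carrier : Type u
  [normed : NormedAddCommGroup carrier]
  [inner : InnerProductSpace ℂ carrier]
  [complete : CompleteSpace carrier]

variable (G : Type u) [NormedAddCommGroup G] [InnerProductSpace ℂ G]

/-- The Hilbert tensor product of two inner product spaces: the completion of the algebraic tensor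
product for the inner product with `⟪a ⊗ b, c ⊗ d⟫ = ⟪a, c⟫ * ⟪b, d⟫`. -/
abbrev HilbertTensor (E F : Type u) [NormedAddCommGroup E] [InnerProductSpace ℂ E]
    [NormedAddCommGroup F] [InnerProductSpace ℂ F] : Type u :=
  Completion (E ⊗[ℂ] F)

/-- The Hilbert tensor powers of `G`: the zeroth one is the one-dimensional space `ℂ`
(in the universe of `G`), and the `(n + 1)`-st one is the Hilbert tensor product of `G` and the
`n`-th one. -/
def tensorPowAux : ℕ → BundledHilbert.{u}
  | 0 => ⟨EuclideanSpace ℂ PUnit.{u + 1}⟩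
  | n + 1 =>
    letI := (tensorPowAux n).normed
    letI := (tensorPowAux n).inner
    ⟨HilbertTensor G (tensorPowAux n).carrier⟩

/-- The `n`-th Hilbert tensor power of `G`. -/
def TensorPow (n : ℕ) : Type u := (tensorPowAux G n).carrier

instance (n : ℕ) : NormedAddCommGroup (TensorPow G n) := (tensorPowAux G n).normed
instance (n : ℕ) : InnerProductSpace ℂ (TensorPow G n) := (tensorPowAux G n).inner
instance (n : ℕ) : CompleteSpace (TensorPow G n) := (tensorPowAux G n).complete

variable {G}

/-- `φ ↦ (g ↦ φ ⊗ g)`, from `G` to the operators from the `n`-th to the `(n + 1)`-st tensor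
power. -/
def tmulL (n : ℕ) : G →L[ℂ] TensorPow G n →L[ℂ] TensorPow G (n + 1) :=
  (ContinuousLinearMap.compL ℂ (TensorPow G n) (G ⊗[ℂ] TensorPow G n)
    (HilbertTensor G (TensorPow G n)) Completion.toComplL).comp
    (TensorProduct.mkL ℂ G (TensorPow G n))

/-- The operator `B ⊗ 1` on the `(n + 1)`-st tensor power, for an operator `B` in `G`. -/
def tensorHead (n : ℕ) (B : G →L[ℂ] G) : TensorPow G (n + 1) →L[ℂ] TensorPow G (n + 1) :=
  (B.rTensor (TensorPow G n)).completion

/-- The operator `1 ⊗ D` on the `(n + 1)`-st tensor power, for an operator `D` in the `n`-th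
one. -/
def tensorTail (n : ℕ) (D : TensorPow G n →L[ℂ] TensorPow G n) :
    TensorPow G (n + 1) →L[ℂ] TensorPow G (n + 1) :=
  (D.lTensor G).completion

/-- The product vector `v 0 ⊗ v 1 ⊗ ⋯ ⊗ v (n - 1)`. -/
def tensorProd : (n : ℕ) → (Fin n → G) → TensorPow G n
  | 0, _ => (EuclideanSpace.single PUnit.unit 1 : EuclideanSpace ℂ PUnit.{u + 1})
  | n + 1, v => tmulL n (v 0) (tensorProd n (Fin.tail v))

/-- The wedge product `v 0 ∧ ⋯ ∧ v (n - 1)`, that is, the antisymmetrization of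
`v 0 ⊗ ⋯ ⊗ v (n - 1)`. -/
def wedge (n : ℕ) (v : Fin n → G) : TensorPow G n :=
  ((n.factorial : ℂ)⁻¹) •
    ∑ π : Equiv.Perm (Fin n), ((Equiv.Perm.sign π : ℤ) : ℂ) • tensorProd n (v ∘ π)

variable (G) in
/-- The `n`-th antisymmetric tensor power, as a closed subspace of the tensor power. -/
def antisymSubmodule (n : ℕ) : Submodule ℂ (TensorPow G n) :=
  (Submodule.span ℂ (Set.range (wedge (G := G) n))).topologicalClosure

variable (G) in
/-- The `n`-th antisymmetric tensor power of `G`. -/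
abbrev AntisymPow (n : ℕ) : Type u := ↥(antisymSubmodule G n)

instance (n : ℕ) : CompleteSpace (AntisymPow G n) :=
  inferInstanceAs
    (CompleteSpace (Submodule.span ℂ (Set.range (wedge (G := G) n))).topologicalClosure)

/-- The antisymmetrization operator: the orthogonal projection of the `n`-th tensor power onto the
antisymmetric one. -/
def antisymmetrize (n : ℕ) : TensorPow G n →L[ℂ] AntisymPow G n :=
  (antisymSubmodule G n).orthogonalProjectionOnto

/-! ### The operators between particle-number subspaces -/

/-- `g ↦ φ ∧ g`, from `n` to `n + 1` particles. -/
def createN (φ : G) (n : ℕ) : AntisymPow G n →L[ℂ] AntisymPow G (n + 1) :=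
  antisymmetrize (n + 1) ∘L tmulL n φ ∘L (antisymSubmodule G n).subtypeL

/-- For fixed `g`, the operator `φ₂ ↦ φ₂ ⊗ g` from `G ⊗ G` to the `(n + 2)`-nd tensor power. -/
def pairTensor (n : ℕ) (g : TensorPow G n) : HilbertTensor G G →L[ℂ] TensorPow G (n + 2) :=
  (((tmulL n).flip g).lTensor G).completion

theorem pairTensor_coe (n : ℕ) (g : TensorPow G n) (x : G ⊗[ℂ] G) :
    pairTensor n g (x : HilbertTensor G G) =
      ((((tmulL n).flip g).lTensor G x : G ⊗[ℂ] TensorPow G (n + 1)) :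
        HilbertTensor G (TensorPow G (n + 1))) :=
  ContinuousLinearMap.completion_apply_coe _ _

theorem pairTensor_add (n : ℕ) (g h : TensorPow G n) (φ : HilbertTensor G G) :
    pairTensor n (g + h) φ = pairTensor n g φ + pairTensor n h φ := by
  induction φ using Completion.induction_on with
  | hp => exact isClosed_eq (by fun_prop) (by fun_prop)
  | ih x =>
    rw [pairTensor_coe, pairTensor_coe, pairTensor_coe, map_add, ContinuousLinearMap.lTensor_add]
    exact Completion.coe_add _ _

theorem pairTensor_smul (n : ℕ) (c : ℂ) (g : TensorPow G n) (φ : HilbertTensor G G) :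
    pairTensor n (c • g) φ = c • pairTensor n g φ := by
  have h0 : (tmulL n).flip (c • g) = c • (tmulL n).flip g :=
    ((tmulL (G := G) n).flip).map_smul c g
  have h (x : G ⊗[ℂ] G) :
      ((tmulL n).flip (c • g)).lTensor G x = c • ((tmulL n).flip g).lTensor G x := by
    rw [h0, ContinuousLinearMap.lTensor_smul]
    rfl
  induction φ using Completion.induction_on with
  | hp =>
    exact isClosed_eq (pairTensor n (c • g)).continuous ((pairTensor n g).continuous.const_smul c)
  | ih x =>
    rw [pairTensor_coe, pairTensor_coe, h]
    exact (Completion.toComplL (𝕜 := ℂ) (E := G ⊗[ℂ] TensorPow G (n + 1))).map_smul c _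

theorem norm_tmulL (n : ℕ) (φ : G) (g : TensorPow G n) : ‖tmulL n φ g‖ = ‖φ‖ * ‖g‖ :=
  (Completion.norm_coe (φ ⊗ₜ[ℂ] g)).trans (TensorProduct.norm_tmul φ g)

theorem norm_pairTensor_le (n : ℕ) (g : TensorPow G n) (φ : HilbertTensor G G) :
    ‖pairTensor n g φ‖ ≤ ‖φ‖ * ‖g‖ := by
  induction φ using Completion.induction_on with
  | hp => exact isClosed_le (by fun_prop) (by fun_prop)
  | ih x =>
    have h : ‖(tmulL n).flip g‖ ≤ ‖g‖ := by
      refine ContinuousLinearMap.opNorm_le_bound _ (norm_nonneg _) fun ψ => ?_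
      rw [mul_comm]
      exact (norm_tmulL n ψ g).le
    rw [pairTensor_coe, Completion.norm_coe]
    refine (Completion.norm_coe _).trans_le ?_
    refine (ContinuousLinearMap.le_opNorm _ _).trans ?_
    rw [mul_comm]
    gcongr
    exact (ContinuousLinearMap.norm_lTensor_le G ((tmulL n).flip g)).trans h

/-- `g ↦ φ₂ ⊗ g`, from the `n`-th to the `(n + 2)`-nd tensor power, for `φ₂` in `G ⊗ G`. -/
def tmulPairL (n : ℕ) (φ₂ : HilbertTensor G G) : TensorPow G n →L[ℂ] TensorPow G (n + 2) :=
  LinearMap.mkContinuous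
    { toFun := fun g => pairTensor n g φ₂
      map_add' := fun g h => pairTensor_add n g h φ₂
      map_smul' := fun c g => pairTensor_smul n c g φ₂ } ‖φ₂‖ fun g => norm_pairTensor_le n g φ₂

/-- `g ↦ antisymmetrization of φ₂ ⊗ g`, from `n` to `n + 2` particles. -/
def createPairN (φ₂ : HilbertTensor G G) (n : ℕ) : AntisymPow G n →L[ℂ] AntisymPow G (n + 2) :=
  antisymmetrize (n + 2) ∘L tmulPairL n φ₂ ∘L (antisymSubmodule G n).subtypeL

/-- The operator `B ⊗ 1 ⊗ ⋯ ⊗ 1 + 1 ⊗ B ⊗ 1 ⊗ ⋯ ⊗ 1 + ⋯ + 1 ⊗ ⋯ ⊗ 1 ⊗ B` on the `n`-th tensor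
power. -/
def derivationTensor (B : G →L[ℂ] G) : (n : ℕ) → TensorPow G n →L[ℂ] TensorPow G n
  | 0 => 0
  | n + 1 => tensorHead n B + tensorTail n (derivationTensor B n)

/-- The `n`-particle part of the differential second quantization of `B`. The operator
`derivationTensor B n` leaves the antisymmetric subspace invariant; `antisymmetrize n` only adjusts
the codomain. -/
def secondQuantN (B : G →L[ℂ] G) (n : ℕ) : AntisymPow G n →L[ℂ] AntisymPow G n :=
  antisymmetrize n ∘L derivationTensor B n ∘L (antisymSubmodule G n).subtypeL

/-! ## The space of finite vectors of the antisymmetric Fock space -/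

variable (G) in
/-- The space of finite sequences `g = (g⁽ⁿ⁾)`, with `g⁽ⁿ⁾` in the `n`-th antisymmetric tensor
power of `G`. -/
def FockFin : Type u := DirectSum ℕ fun n => AntisymPow G n

instance : AddCommGroup (FockFin G) :=
  inferInstanceAs (AddCommGroup (DirectSum ℕ fun n => AntisymPow G n))

instance : Module ℂ (FockFin G) :=
  inferInstanceAs (Module ℂ (DirectSum ℕ fun n => AntisymPow G n))

/-- The inclusion of the `n`-particle space. -/
def FockFin.of (n : ℕ) : AntisymPow G n →ₗ[ℂ] FockFin G :=
  DirectSum.lof ℂ ℕ (fun n => AntisymPow G n) n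

variable (G) in
/-- The seminorms on `FockFin G` whose restriction to every `n`-particle space is continuous. -/
abbrev FockFin.SumSeminorm : Type u :=
  {p : Seminorm ℂ (FockFin G) // ∀ n, Continuous fun g : AntisymPow G n => p (FockFin.of n g)}

variable (G) in
/-- The defining family of seminorms of the locally convex direct sum topology. -/
def FockFin.seminorms : SeminormFamily ℂ (FockFin G) (FockFin.SumSeminorm G) := fun p => p.1

instance : Nonempty (FockFin.SumSeminorm G) :=
  ⟨⟨0, fun _ => continuous_const⟩⟩

/-- The topology of the locally convex direct sum of the Hilbert spaces `AntisymPow G n`: it is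
generated by all seminorms whose restriction to each summand is continuous. -/
instance : TopologicalSpace (FockFin G) := (FockFin.seminorms G).moduleFilterBasis.topology

theorem FockFin.withSeminorms : WithSeminorms (FockFin.seminorms G) := ⟨rfl⟩

instance : IsTopologicalAddGroup (FockFin G) := FockFin.withSeminorms.topologicalAddGroup

instance : ContinuousSMul ℂ (FockFin G) := FockFin.withSeminorms.continuousSMul

variable (G) in
/-- The algebra of continuous linear operators in `FockFin G`. -/
abbrev FockOp : Type u := FockFin G →L[ℂ] FockFin G

theorem FockFin.continuous_of (n : ℕ) : Continuous (FockFin.of (G := G) n) := by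
  refine (FockFin.withSeminorms.continuous_iff_continuous_comp _).2 ?_
  rintro ⟨p, hp⟩
  exact hp n

theorem FockFin.continuous_linearMap (f : FockFin G →ₗ[ℂ] FockFin G)
    (hf : ∀ n, Continuous fun g : AntisymPow G n => f (FockFin.of n g)) : Continuous f := by
  refine FockFin.withSeminorms.continuous_of_isBounded FockFin.withSeminorms f ?_
  rintro ⟨p, hp⟩
  have hc : Continuous p := FockFin.withSeminorms.continuous_seminorm ⟨p, hp⟩
  refine ⟨{⟨p.comp f, fun n => hc.comp (hf n)⟩}, 1, ?_⟩
  rw [one_smul, Finset.sup_singleton]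
  exact le_rfl

/-- The linear operator in `FockFin G` with prescribed restrictions to the `n`-particle spaces. -/
def FockFin.liftₗ (T : ∀ n, AntisymPow G n →ₗ[ℂ] FockFin G) : FockFin G →ₗ[ℂ] FockFin G :=
  DirectSum.toModule ℂ ℕ (FockFin G) T

theorem FockFin.liftₗ_of (T : ∀ n, AntisymPow G n →ₗ[ℂ] FockFin G) (n : ℕ) (g : AntisymPow G n) :
    FockFin.liftₗ T (FockFin.of n g) = T n g :=
  DirectSum.toModule_lof ℂ n g

/-- The continuous linear operator in `FockFin G` with prescribed continuous restrictions to the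
`n`-particle spaces. -/
def FockFin.lift (T : ∀ n, AntisymPow G n →ₗ[ℂ] FockFin G) (hT : ∀ n, Continuous (T n)) :
    FockOp G where
  toLinearMap := FockFin.liftₗ T
  cont := FockFin.continuous_linearMap _ fun n => by
    simp only [FockFin.liftₗ_of]
    exact hT n

theorem FockFin.lift_of (T : ∀ n, AntisymPow G n →ₗ[ℂ] FockFin G) (hT : ∀ n, Continuous (T n))
    (n : ℕ) (g : AntisymPow G n) : FockFin.lift T hT (FockFin.of n g) = T n g :=
  FockFin.liftₗ_of T n g

/-- The operator which on `n` particles is `T n` and raises the number of particles by `k`. -/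
def FockFin.raise (k : ℕ) (T : ∀ n, AntisymPow G n →L[ℂ] AntisymPow G (n + k)) : FockOp G :=
  FockFin.lift (fun n => FockFin.of (n + k) ∘ₗ (T n).toLinearMap)
    fun n => (FockFin.continuous_of (n + k)).comp (T n).continuous

/-- The operator which on `n + 1` particles is `T n`, to `n` particles, and vanishes on zero
particles. -/
def FockFin.lowerOne (T : ∀ n, AntisymPow G (n + 1) →L[ℂ] AntisymPow G n) : FockOp G :=
  FockFin.lift
    (fun
      | 0 => 0
      | n + 1 => FockFin.of n ∘ₗ (T n).toLinearMap)
    (fun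
      | 0 => continuous_const
      | n + 1 => (FockFin.continuous_of n).comp (T n).continuous)

/-- The operator which on `n + 2` particles is `T n`, to `n` particles, and vanishes on fewer than
two particles. -/
def FockFin.lowerTwo (T : ∀ n, AntisymPow G (n + 2) →L[ℂ] AntisymPow G n) : FockOp G :=
  FockFin.lift
    (fun
      | 0 => 0
      | 1 => 0
      | n + 2 => FockFin.of n ∘ₗ (T n).toLinearMap)
    (fun
      | 0 => continuous_const
      | 1 => continuous_const
      | n + 2 => (FockFin.continuous_of n).comp (T n).continuous)

/-- The creation operator `a⁺(φ)`: `g ↦ φ ∧ g`. -/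
def create (φ : G) : FockOp G := FockFin.raise 1 (createN φ)

/-- The annihilation operator `a⁻(φ)`, the adjoint of `a⁺(φ)` for the inner product
`∑ n, n! * ⟪f⁽ⁿ⁾, g⁽ⁿ⁾⟫` of the antisymmetric Fock space. The weight `n!` is the reason for the
factor `n + 1 = (n + 1)! / n!` in front of the adjoint in the unweighted inner products. -/
def annihilate (φ : G) : FockOp G :=
  FockFin.lowerOne fun n => ((n + 1 : ℕ) : ℂ) • (createN φ n).adjoint

/-- The operator `a⁺(φ₂)` for `φ₂` in `G ⊗ G`: `g ↦` antisymmetrization of `φ₂ ⊗ g`. -/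
def createPair (φ₂ : HilbertTensor G G) : FockOp G := FockFin.raise 2 (createPairN φ₂)

/-- The operator `a⁻(φ₂)`, the adjoint of `a⁺(φ₂)` for the inner product
`∑ n, n! * ⟪f⁽ⁿ⁾, g⁽ⁿ⁾⟫` of the antisymmetric Fock space; here the factor is
`(n + 2) * (n + 1) = (n + 2)! / n!`. -/
def annihilatePair (φ₂ : HilbertTensor G G) : FockOp G :=
  FockFin.lowerTwo fun n => (((n + 2) * (n + 1) : ℕ) : ℂ) • (createPairN φ₂ n).adjoint

/-- The differential second quantization `dΓ(B)` of `B`. -/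
def secondQuant (B : G →L[ℂ] G) : FockOp G := FockFin.raise 0 (secondQuantN B)

end Tensor

/-! ## The one-particle space `L²(X, σ)` -/

section OneParticle

variable {X : Type u} [MeasurableSpace X]

/-- The complex Hilbert space `L²(X, σ)`. -/
abbrev L2 (σ : Measure X) : Type u := Lp ℂ 2 σ

variable (σ : Measure X)

open Classical in
/-- The orthogonal projection of `L²(X, σ)` onto `L²(Δ, σ)`, that is, multiplication by the
indicator function of the (measurable) set `Δ`. -/
def restrictProj (Δ : Set X) : L2 σ →L[ℂ] L2 σ :=
  if hΔ : MeasurableSet Δ then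
    LinearMap.mkContinuous
      { toFun := fun f => ((Lp.memLp f).indicator hΔ).toLp (Δ.indicator f)
        map_add' := fun f g => by
          rw [← MemLp.toLp_add]
          refine MemLp.toLp_congr _ _ ?_
          filter_upwards [Lp.coeFn_add f g] with x hx
          by_cases h : x ∈ Δ
          · simpa only [Set.indicator_of_mem h, Pi.add_apply] using hx
          · simp [h]
        map_smul' := fun c f => by
          rw [RingHom.id_apply, ← MemLp.toLp_const_smul]
          refine MemLp.toLp_congr _ _ ?_
          filter_upwards [Lp.coeFn_smul c f] with x hx
          by_cases h : x ∈ Δ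
          · simpa only [Set.indicator_of_mem h, Pi.smul_apply] using hx
          · simp [h] }
      1 fun f => by
        rw [one_mul]
        change ‖((Lp.memLp f).indicator hΔ).toLp (Δ.indicator f)‖ ≤ ‖f‖
        refine Lp.norm_le_norm_of_ae_le ?_
        filter_upwards [((Lp.memLp f).indicator hΔ).coeFn_toLp] with x hx
        rw [hx]
        exact norm_indicator_le_norm_self _ _
  else 0

variable {σ}

/-- The operator `𝒞 B 𝒞`, where `𝒞` is the complex conjugation `φ ↦ star φ` of `L²(X, σ)`. -/
def conjOp (B : L2 σ →L[ℂ] L2 σ) : L2 σ →L[ℂ] L2 σ :=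
  have hadd : ∀ f g : L2 σ, star (f + g) = star f + star g := fun f g => by
    refine Lp.ext ?_
    filter_upwards [Lp.coeFn_star (f + g), Lp.coeFn_add f g, Lp.coeFn_add (star f) (star g),
      Lp.coeFn_star f, Lp.coeFn_star g] with x h1 h2 h3 h4 h5
    rw [h1, h3, Pi.star_apply, h2, Pi.add_apply, Pi.add_apply, h4, h5, star_add]
    rfl
  have hsmul : ∀ (c : ℂ) (f : L2 σ), star (c • f) = star c • star f := fun c f => by
    refine Lp.ext ?_
    filter_upwards [Lp.coeFn_star (c • f), Lp.coeFn_smul c f, Lp.coeFn_smul (star c) (star f),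
      Lp.coeFn_star f] with x h1 h2 h3 h4
    rw [h1, h3, Pi.star_apply, h2, Pi.smul_apply, Pi.smul_apply, h4, smul_eq_mul, star_mul']
    rfl
  have hnorm : ∀ f : L2 σ, ‖star f‖ = ‖f‖ := fun f => by
    refine le_antisymm ?_ ?_ <;> refine Lp.norm_le_norm_of_ae_le ?_ <;>
      filter_upwards [Lp.coeFn_star f] with x h1 <;> simp [h1]
  LinearMap.mkContinuous
    { toFun := fun f => star (B (star f))
      map_add' := fun f g => by rw [hadd, map_add, hadd]
      map_smul' := fun c f => by rw [hsmul, map_smul, hsmul, star_star, RingHom.id_apply] }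
    ‖B‖ fun f => by
      change ‖star (B (star f))‖ ≤ _
      rw [hnorm, ← hnorm f]
      exact B.le_opNorm _

end OneParticle

/-! ## Square roots and trace-class operators -/

section Trace

variable {H : Type u} [NormedAddCommGroup H] [InnerProductSpace ℂ H] [CompleteSpace H]

/-- The positive square root of a positive operator. -/
def opSqrt (S : H →L[ℂ] H) : H →L[ℂ] H := CFC.sqrt S

/-- `S` is of trace class: `∑ i, ⟪e i, |S| e i⟫` converges for every Hilbert basis `e` of the
space, where `|S| = √(S* S)`. -/
def IsTraceClass (S : H →L[ℂ] H) : Prop :=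
  ∀ (w : Set H) (e : HilbertBasis w ℂ H), Summable fun i => ⟪e i, CFC.abs S (e i)⟫

/-- The trace `∑ i, ⟪e i, S e i⟫`, computed in some Hilbert basis (its value does not depend on the
basis if `S` is of trace class). -/
def hilbertTrace (S : H →L[ℂ] H) : ℂ :=
  let e := (exists_hilbertBasis ℂ H).choose_spec.choose
  ∑' i, ⟪e i, S (e i)⟫

end Trace

/-! ## The particle density -/

section Density

variable {X : Type u} [MeasurableSpace X] (σ : Measure X)

/-- Measurable sets with compact closure. -/
def IsBoundedBorel [TopologicalSpace X] (Δ : Set X) : Prop :=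
  MeasurableSet Δ ∧ IsCompact (closure Δ)

/-- `𝕂` is `J`-self-adjoint for `J = P₁ - P₂`. -/
def IsJSelfAdjoint (X₁ X₂ : Set X) (𝕂 : L2 σ →L[ℂ] L2 σ) : Prop :=
  let J := restrictProj σ X₁ - restrictProj σ X₂
  ∀ f g : L2 σ, ⟪J (𝕂 f), g⟫ = ⟪J f, 𝕂 g⟫

/-- `𝕂` is locally of trace class on `Y`. -/
def IsLocallyTraceClassOn [TopologicalSpace X] (Y : Set X) (𝕂 : L2 σ →L[ℂ] L2 σ) : Prop :=
  ∀ Δ, IsBoundedBorel Δ → Δ ⊆ Y → IsTraceClass (restrictProj σ Δ ∘L 𝕂 ∘L restrictProj σ Δ)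

/-- The transformation `𝕂 ↦ 𝕂 P₁ + (1 - 𝕂) P₂`. -/
def hatOp (X₁ X₂ : Set X) (𝕂 : L2 σ →L[ℂ] L2 σ) : L2 σ →L[ℂ] L2 σ :=
  𝕂 ∘L restrictProj σ X₁ + (1 - 𝕂) ∘L restrictProj σ X₂

/-- The space `L²(X, σ) ⊕ L²(X, σ)`. -/
abbrev L2Double : Type u := WithLp 2 (L2 σ × L2 σ)

/-- `φ ↦ (φ, 0)`. -/
def inFst : L2 σ →L[ℂ] L2Double σ :=
  (WithLp.prodContinuousLinearEquiv 2 ℂ (L2 σ) (L2 σ)).symm.toContinuousLinearMap ∘L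
    ContinuousLinearMap.inl ℂ (L2 σ) (L2 σ)

/-- `φ ↦ (0, φ)`. -/
def inSnd : L2 σ →L[ℂ] L2Double σ :=
  (WithLp.prodContinuousLinearEquiv 2 ℂ (L2 σ) (L2 σ)).symm.toContinuousLinearMap ∘L
    ContinuousLinearMap.inr ℂ (L2 σ) (L2 σ)

variable {σ}

/-- The operator `B₁ ⊕ B₂`, that is, `(φ, ψ) ↦ (B₁ φ, B₂ ψ)`. -/
def directSumOp (B₁ B₂ : L2 σ →L[ℂ] L2 σ) : L2Double σ →L[ℂ] L2Double σ :=
  inFst σ ∘L B₁ ∘L WithLp.fstL 2 ℂ (L2 σ) (L2 σ) + inSnd σ ∘L B₂ ∘L WithLp.sndL 2 ℂ (L2 σ) (L2 σ)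

/-- The isometry `φ ⊗ ψ ↦ (0, φ) ⊗ (ψ, 0)`. -/
def pairTwoOne : HilbertTensor (L2 σ) (L2 σ) →L[ℂ] HilbertTensor (L2Double σ) (L2Double σ) :=
  (TensorProduct.mapL (inSnd σ) (inFst σ)).completion

open Classical in
/-- The integral kernel of a Hilbert--Schmidt operator `S` in `L²(X, σ)`, as an element of
`L²(X, σ) ⊗ L²(X, σ)`. With `S φ (x) = ∫ S(x, y) φ(y) σ(dy)`, the inner product of
`φ(x) ψ(y)` and `S(x, y)` is `⟪φ, S (star ψ)⟫`, and this determines the kernel. -/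
def integralKernel (S : L2 σ →L[ℂ] L2 σ) : HilbertTensor (L2 σ) (L2 σ) :=
  if h : ∃ κ : HilbertTensor (L2 σ) (L2 σ), ∀ φ ψ : L2 σ,
      ⟪((φ ⊗ₜ[ℂ] ψ : L2 σ ⊗[ℂ] L2 σ) : HilbertTensor (L2 σ) (L2 σ)), κ⟫ = ⟪φ, S (star ψ)⟫
  then h.choose else 0

/-- `K₁ = √K` with `K = 𝕂 P₁ + (1 - 𝕂) P₂`. -/
def sqrtK₁ (X₁ X₂ : Set X) (𝕂 : L2 σ →L[ℂ] L2 σ) : L2 σ →L[ℂ] L2 σ :=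
  opSqrt (hatOp σ X₁ X₂ 𝕂)

/-- `K₂ = √(1 - K)` with `K = 𝕂 P₁ + (1 - 𝕂) P₂`. -/
def sqrtK₂ (X₁ X₂ : Set X) (𝕂 : L2 σ →L[ℂ] L2 σ) : L2 σ →L[ℂ] L2 σ :=
  opSqrt (1 - hatOp σ X₁ X₂ 𝕂)

/-- The particle density `ρ(Δ)`. -/
def particleDensity (X₁ X₂ : Set X) (𝕂 : L2 σ →L[ℂ] L2 σ) (Δ : Set X) : FockOp (L2Double σ) :=
  let K₁ := sqrtK₁ X₁ X₂ 𝕂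
  let K₂ := sqrtK₂ X₁ X₂ 𝕂
  let P := restrictProj σ
  let J := P (Δ ∩ X₁) - P (Δ ∩ X₂)
  let κ := pairTwoOne (integralKernel (K₂ ∘L J ∘L K₁))
  createPair κ + annihilatePair κ
    + secondQuant (directSumOp (conjOp (-(K₁ ∘L J ∘L K₁))) (K₂ ∘L J ∘L K₂))
    + (hilbertTrace (P (Δ ∩ X₁) ∘L 𝕂 ∘L P (Δ ∩ X₁))
        + hilbertTrace (P (Δ ∩ X₂) ∘L 𝕂 ∘L P (Δ ∩ X₂))) • (1 : FockOp (L2Double σ))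

end Density

/-! ## Wick polynomials -/

/-- The Wick polynomial `:ρ(Δ 0) ⋯ ρ(Δ n):` (with `n + 1` factors) of a family `ρ` of operators
indexed by sets, defined by the recurrence
`:ρ(Δ): = ρ(Δ)`,
`:ρ(Δ 0) ⋯ ρ(Δ (n+1)): = ρ(Δ (n+1)) :ρ(Δ 0) ⋯ ρ(Δ n):
  - ∑ i ≤ n, :ρ(Δ 0) ⋯ ρ(Δ i ∩ Δ (n+1)) ⋯ ρ(Δ n):`. -/
def wickPoly {X : Type*} {A : Type*} [Ring A] (ρ : Set X → A) :
    (n : ℕ) → (Fin (n + 1) → Set X) → A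
  | 0, Δ => ρ (Δ 0)
  | n + 1, Δ =>
    ρ (Δ (Fin.last (n + 1))) * wickPoly ρ n (Fin.init Δ)
      - ∑ i : Fin (n + 1),
          wickPoly ρ n
            (Function.update (Fin.init Δ) i (Δ i.castSucc ∩ Δ (Fin.last (n + 1))))

/-! ## The operators `W(Δ, R)` -/

section W

variable {X : Type u} [MeasurableSpace X] {σ : Measure X} {ι : Type*}

/-- The double series `∑ i, ∑ j, T i j` of continuous operators in `FockFin G` converges strongly to
`S`: for each vector `f`, the sums of `T i j f` over `i ∈ s`, `j ∈ t`, with `s` and `t` finite,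
converge to `S f` in `FockFin G` as `s` and `t` increase independently. -/
def HasStrongSum₂ {G : Type u} [NormedAddCommGroup G] [InnerProductSpace ℂ G]
    (T : ι → ι → FockOp G) (S : FockOp G) : Prop :=
  ∀ f : FockFin G, Tendsto (fun st : Finset ι × Finset ι => ∑ i ∈ st.1, ∑ j ∈ st.2, T i j f)
    atTop (𝓝 (S f))

open Classical in
/-- The sum of a strongly convergent double series in the algebra of continuous operators in
`FockFin G` (and `0` if the series does not converge strongly to such an operator). -/
def strongSum₂ {G : Type u} [NormedAddCommGroup G] [InnerProductSpace ℂ G]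
    (T : ι → ι → FockOp G) : FockOp G :=
  if h : ∃ S, HasStrongSum₂ T S then h.choose else 0

/-- `a₁⁺(φ) = a⁺(φ, 0)`. -/
def create₁ (φ : L2 σ) : FockOp (L2Double σ) := create (inFst σ φ)

/-- `a₂⁺(φ) = a⁺(0, φ)`. -/
def create₂ (φ : L2 σ) : FockOp (L2Double σ) := create (inSnd σ φ)

/-- `a₁⁻(φ) = a⁻(φ, 0)`. -/
def annihilate₁ (φ : L2 σ) : FockOp (L2Double σ) := annihilate (inFst σ φ)

/-- `a₂⁻(φ) = a⁻(0, φ)`. -/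
def annihilate₂ (φ : L2 σ) : FockOp (L2Double σ) := annihilate (inSnd σ φ)

variable (X₁ X₂ : Set X) (𝕂 : L2 σ →L[ℂ] L2 σ) (e : ι → L2 σ)

/-- The terms of the double series defining `W(Δ, R)` for `Δ ⊆ X₁`. -/
def wTerm₁ (Δ : Set X) (R : FockOp (L2Double σ)) (i j : ι) : FockOp (L2Double σ) :=
  let K₁ := sqrtK₁ X₁ X₂ 𝕂
  let K₂ := sqrtK₂ X₁ X₂ 𝕂
  let P := restrictProj σ Δ
  ⟪e i, K₂ (P (K₁ (e j)))⟫ • (create₂ (e i) * R * create₁ (e j))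
    + ⟪e i, K₁ (P (K₂ (e j)))⟫ • (annihilate₁ (e i) * R * annihilate₂ (e j))
    + ⟪e i, K₂ (P (K₂ (e j)))⟫ • (create₂ (e i) * R * annihilate₂ (e j))
    + ⟪e i, K₁ (P (K₁ (e j)))⟫ • (annihilate₁ (e i) * R * create₁ (e j))

/-- The terms of the double series defining `W(Δ, R)` for `Δ ⊆ X₂`. -/
def wTerm₂ (Δ : Set X) (R : FockOp (L2Double σ)) (i j : ι) : FockOp (L2Double σ) :=
  let K₁ := sqrtK₁ X₁ X₂ 𝕂
  let K₂ := sqrtK₂ X₁ X₂ 𝕂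
  let P := restrictProj σ Δ
  ⟪e j, K₂ (P (K₁ (e i)))⟫ • (create₁ (e i) * R * create₂ (e j))
    + ⟪e j, K₁ (P (K₂ (e i)))⟫ • (annihilate₂ (e i) * R * annihilate₁ (e j))
    + ⟪e j, K₁ (P (K₁ (e i)))⟫ • (create₁ (e i) * R * annihilate₁ (e j))
    + ⟪e j, K₂ (P (K₂ (e i)))⟫ • (annihilate₂ (e i) * R * create₂ (e j))

/-- The operator `W(Δ, R)`, the rigorous version of `∫_Δ A⁺(x) R A⁻(x) σ(dx)`. -/
def wickInsert (Δ : Set X) (R : FockOp (L2Double σ)) : FockOp (L2Double σ) :=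
  strongSum₂ (wTerm₁ X₁ X₂ 𝕂 e (Δ ∩ X₁) R) + strongSum₂ (wTerm₂ X₁ X₂ 𝕂 e (Δ ∩ X₂) R)

end W

/-!
# Wick polynomials of the particle density as iterated insertions

Let `D(u) = a₂⁺(K₂ u) + a₁⁻(conj (K₁ u))` and `D*(u) = a₂⁻(K₂ u) + a₁⁺(conj (K₁ u))`
(`fieldOp`, `fieldAdj`), and let `e` be the given basis of real functions. By Parseval's identity
the coefficients of the double series for `W(Δ, R)` are sums over `k`, and the double series is
what becomes of
`∑ k, D(P e_k) R D*(P e_k)` (for `Δ ⊆ X₁`) or `∑ k, D*(P e_k) R D(P e_k)` (for `Δ ⊆ X₂`)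
when the arguments of the creation and annihilation operators are truncated by the projections onto
finitely many basis vectors. Here `P = P Δ` may be replaced by projections `P Δl` on the left and
`P Δr` on the right with `Δl ∩ Δr = Δ`.

*Convergence* (`exists_hasSum_fieldSeries`). For a bounded operator `A`, the row `(a⁺(A e_k))_k` is
bounded in square mean on every particle-number space, and `k ↦ a⁻(A e_k) f` is square summable, by
duality. For a square summable family `h`, the same holds for `a⁻(h_k)` and `a⁺(h_k) f`. Since
`K₁ P Δ` (for `Δ ⊆ X₁`) and `K₂ P Δ` (for `Δ ⊆ X₂`) are Hilbert--Schmidt by the local trace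
condition, each series is a bounded row applied to a square summable family, and these bounds are
uniform in the truncations. The locally convex direct sum topology is handled through the seminorms
`∑ n, c n * ‖f⁽ⁿ⁾‖`.

*The product formula* (`particleDensity_mul_wickInsert`). As `K₁² + K₂² = 1`, the canonical
anticommutation relations give `[ρ(Δ), D(u)] = D(J u)` and `[ρ(Δ), D*(u)] = -D*(J u)`, where
`J = P (Δ ∩ X₁) - P (Δ ∩ X₂)`. Commuting `ρ(Δ₁)` past the left factor of each term of the series for
`W(Δ₂, R)` gives the claim; commuting it past the right factor gives the analogous formula
`insertTerm_mul_particleDensity` for the product in the other order.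

*Wick polynomials* (`wickPoly_eq_wickInsert`). The operators `W(Δ, 1)` and `ρ(Δ)` have the same
commutators with creation operators and agree on the vacuum, so they are equal (`wickInsert_one`).
With the two product formulas, this shows that densities commute and proves the case `n = 2`. In the
induction step, the recurrence expresses `:ρ(Δ 0) ⋯ ρ(Δ n) ρ(B) ρ(C):` by Wick polynomials in which
the last factor stems from `ρ(B)`, and the induction hypothesis and the product formula turn it into
`W(B, :ρ(Δ 0) ⋯ ρ(Δ n) ρ(C):)`. Since densities commute, Wick polynomials are symmetric in the last
two sets (`wickPoly_snoc_snoc_comm`), so `B` and `C` may be exchanged.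
-/

section FockAlgebra

variable {G : Type u} [NormedAddCommGroup G] [InnerProductSpace ℂ G]

/-! ### Wedge products and their Gram determinants -/

theorem inner_tmulL (n : ℕ) (φ ψ : G) (g h : TensorPow G n) :
    ⟪tmulL n φ g, tmulL n ψ h⟫ = ⟪φ, ψ⟫ * ⟪g, h⟫ :=
  (Completion.inner_coe (φ ⊗ₜ[ℂ] g) (ψ ⊗ₜ[ℂ] h)).trans (TensorProduct.inner_tmul _ _ _ _ _)

theorem tensorProd_cons (n : ℕ) (φ : G) (v : Fin n → G) :
    tensorProd (n + 1) (Fin.cons φ v : Fin (n + 1) → G) = tmulL n φ (tensorProd n v) := rfl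

theorem inner_tensorProd (n : ℕ) (v w : Fin n → G) :
    ⟪tensorProd n v, tensorProd n w⟫ = ∏ i, ⟪v i, w i⟫ := by
  induction n with
  | zero =>
    change ⟪(EuclideanSpace.single PUnit.unit 1 : EuclideanSpace ℂ PUnit.{u + 1}),
      (EuclideanSpace.single PUnit.unit 1 : EuclideanSpace ℂ PUnit.{u + 1})⟫ = _
    simp
  | succ n ih =>
    rw [Fin.prod_univ_succ]
    exact (inner_tmulL n _ _ _ _).trans (by rw [ih]; rfl)

theorem wedge_comp_perm (n : ℕ) (v : Fin n → G) (τ : Equiv.Perm (Fin n)) :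
    wedge n (v ∘ τ) = ((Equiv.Perm.sign τ : ℤ) : ℂ) • wedge n v := by
  unfold wedge
  rw [smul_comm]
  congr 1
  rw [Finset.smul_sum, ← Equiv.sum_comp (Equiv.mulLeft τ)
    (fun π => ((Equiv.Perm.sign τ : ℤ) : ℂ) • ((Equiv.Perm.sign π : ℤ) : ℂ) • tensorProd n (v ∘ π))]
  refine Finset.sum_congr rfl fun π _ => ?_
  rw [smul_smul]
  congr 1
  simp only [Equiv.coe_mulLeft, Equiv.Perm.sign_mul, Units.val_mul, Int.cast_mul]
  rw [← mul_assoc, ← Int.cast_mul, ← Units.val_mul, Int.units_mul_self]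
  simp

theorem inner_wedge_tensorProd (n : ℕ) (w v : Fin n → G) :
    ⟪wedge n w, tensorProd n v⟫ =
      ((n.factorial : ℂ)⁻¹) * (Matrix.of fun i j => ⟪w i, v j⟫).det := by
  unfold wedge
  rw [inner_smul_left, sum_inner, Matrix.det_apply]
  congr 1
  · simp
  · refine Finset.sum_congr rfl fun π _ => ?_
    rw [inner_smul_left, inner_tensorProd]
    simp [Units.smul_def]

/-- Antisymmetrizing the second factor as well does not change the Gram determinant. -/
theorem inner_wedge_wedge (n : ℕ) (w v : Fin n → G) :
    ⟪wedge n w, wedge n v⟫ =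
      ((n.factorial : ℂ)⁻¹) * (Matrix.of fun i j => ⟪w i, v j⟫).det := by
  conv_lhs => rw [wedge.eq_1 n v]
  rw [inner_smul_right, inner_sum]
  have h (π : Equiv.Perm (Fin n)) : ⟪wedge n w, ((Equiv.Perm.sign π : ℤ) : ℂ) •
      tensorProd n (v ∘ π)⟫ = ((n.factorial : ℂ)⁻¹) * (Matrix.of fun i j => ⟪w i, v j⟫).det := by
    have h2 := Matrix.det_permute' π (Matrix.of fun i j => ⟪w i, v j⟫)
    rw [inner_smul_right, inner_wedge_tensorProd]
    have h3 : (Matrix.of fun i j => ⟪w i, (v ∘ π) j⟫) =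
      (Matrix.of fun i j => ⟪w i, v j⟫).submatrix id π := rfl
    rw [h3, h2, mul_left_comm, ← mul_assoc (((Equiv.Perm.sign π : ℤ) : ℂ)), ← Int.cast_mul,
      ← Units.val_mul, Int.units_mul_self]
    simp
  simp only [h, Finset.sum_const, Finset.card_univ, Fintype.card_perm, Fintype.card_fin,
    nsmul_eq_mul]
  rw [← mul_assoc, inv_mul_cancel₀ (by exact_mod_cast n.factorial_ne_zero), one_mul]

/-- The wedge product as an element of the antisymmetric tensor power. -/
def wedgeA (n : ℕ) (v : Fin n → G) : AntisymPow G n :=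
  ⟨wedge n v, Submodule.le_topologicalClosure _ (Submodule.subset_span ⟨v, rfl⟩)⟩

theorem antisymmetrize_coe (n : ℕ) (x : AntisymPow G n) :
    antisymmetrize n (x : TensorPow G n) = x :=
  Submodule.orthogonalProjectionOnto_mem_subspace_eq_self x

theorem inner_antisymmetrize (n : ℕ) (y : AntisymPow G n) (x : TensorPow G n) :
    ⟪y, antisymmetrize n x⟫ = ⟪(y : TensorPow G n), x⟫ := by
  rw [← Submodule.inner_orthogonalProjectionOnto_eq_of_mem_left]
  rfl

/-- A closed linear condition on the antisymmetric tensor power need only be checked on wedge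
products, as these span a dense subspace. -/
theorem AntisymPow.induction_closed {n : ℕ} {p : AntisymPow G n → Prop}
    (hp : IsClosed {x | p x}) (zero : p 0) (add : ∀ x y, p x → p y → p (x + y))
    (smul : ∀ (c : ℂ) x, p x → p (c • x)) (mem : ∀ v, p (wedgeA n v)) (x : AntisymPow G n) :
    p x := by
  have h : ∀ y ∈ closure (Submodule.span ℂ (Set.range (wedge (G := G) n)) : Set (TensorPow G n)),
      p (antisymmetrize n y) := by
    intro y hy
    refine closure_minimal (t := {y | p (antisymmetrize n y)}) ?_
      (hp.preimage (antisymmetrize n).continuous) hy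
    intro y hy
    refine Submodule.span_induction (p := fun y _ => p (antisymmetrize n y)) ?_ ?_ ?_ ?_ hy
    · rintro _ ⟨v, rfl⟩
      rw [show wedge n v = ((wedgeA n v : AntisymPow G n) : TensorPow G n) from rfl,
        antisymmetrize_coe]
      exact mem v
    · rw [map_zero]; exact zero
    · intro a b _ _ ha hb
      rw [map_add]; exact add _ _ ha hb
    · intro c a _ ha
      rw [map_smul]; exact smul _ _ ha
  rw [← antisymmetrize_coe n x]
  exact h _ x.2

theorem AntisymPow.clm_ext {n : ℕ} {F : Type*} [TopologicalSpace F] [T2Space F] [AddCommGroup F]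
    [Module ℂ F] {S T : AntisymPow G n →L[ℂ] F} (h : ∀ v, S (wedgeA n v) = T (wedgeA n v)) :
    S = T := by
  ext x
  refine AntisymPow.induction_closed (p := fun x => S x = T x)
    (isClosed_eq S.continuous T.continuous) ?_ ?_ ?_ h x
  · simp
  · intro x y hx hy; simp [hx, hy]
  · intro c x hx; simp [hx]

theorem AntisymPow.ext_inner {n : ℕ} {x y : AntisymPow G n}
    (h : ∀ v, ⟪wedgeA n v, x⟫ = ⟪wedgeA n v, y⟫) : x = y := by
  refine _root_.ext_inner_left ℂ fun z => ?_
  have : innerSL ℂ x = innerSL ℂ y := AntisymPow.clm_ext fun v => by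
    rw [innerSL_apply_apply, innerSL_apply_apply, ← inner_conj_symm, h, inner_conj_symm]
  have h2 := congrArg (fun T : AntisymPow G n →L[ℂ] ℂ => T z) this
  simp only [innerSL_apply_apply] at h2
  rw [← inner_conj_symm, h2, inner_conj_symm]

theorem antisymmetrize_tensorProd (n : ℕ) (v : Fin n → G) :
    antisymmetrize n (tensorProd n v) = wedgeA n v := by
  refine AntisymPow.ext_inner fun w => ?_
  rw [inner_antisymmetrize]
  exact (inner_wedge_tensorProd n w v).trans (inner_wedge_wedge n w v).symm

theorem wedgeA_comp_perm (n : ℕ) (v : Fin n → G) (τ : Equiv.Perm (Fin n)) :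
    wedgeA n (v ∘ τ) = ((Equiv.Perm.sign τ : ℤ) : ℂ) • wedgeA n v :=
  Subtype.ext (wedge_comp_perm n v τ)

theorem wedgeA_cons_comp_perm (n : ℕ) (φ : G) (v : Fin n → G) (τ : Equiv.Perm (Fin n)) :
    wedgeA (n + 1) (Fin.cons φ (v ∘ τ) : Fin (n + 1) → G) =
      ((Equiv.Perm.sign τ : ℤ) : ℂ) • wedgeA (n + 1) (Fin.cons φ v : Fin (n + 1) → G) := by
  have h : (Fin.cons φ (v ∘ τ) : Fin (n + 1) → G) =
      (Fin.cons φ v : Fin (n + 1) → G) ∘ Equiv.Perm.decomposeFin.symm (0, τ) := by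
    funext i
    refine Fin.cases ?_ (fun i => ?_) i
    · simp
    · simp
  rw [h, wedgeA_comp_perm, Equiv.Perm.decomposeFin.symm_sign]
  simp

/-- The antisymmetrization of an alternating function of permutations returns its value at the
identity. -/
theorem smul_sum_sign_smul_sign {n : ℕ} {V : Type*} [AddCommGroup V] [Module ℂ V] (x : V) :
    ((n.factorial : ℂ)⁻¹) • ∑ π : Equiv.Perm (Fin n), ((Equiv.Perm.sign π : ℤ) : ℂ) •
      ((Equiv.Perm.sign π : ℤ) : ℂ) • x = x := by
  have h (π : Equiv.Perm (Fin n)) : ((Equiv.Perm.sign π : ℤ) : ℂ) •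
      ((Equiv.Perm.sign π : ℤ) : ℂ) • x = x := by
    rw [smul_smul, ← Int.cast_mul, ← Units.val_mul, Int.units_mul_self]
    simp
  simp only [h, Finset.sum_const, Finset.card_univ, Fintype.card_perm, Fintype.card_fin]
  rw [← Nat.cast_smul_eq_nsmul ℂ, smul_smul,
    inv_mul_cancel₀ (by exact_mod_cast n.factorial_ne_zero), one_smul]

theorem createN_wedgeA (φ : G) (n : ℕ) (v : Fin n → G) :
    createN φ n (wedgeA n v) = wedgeA (n + 1) (Fin.cons φ v : Fin (n + 1) → G) := by
  change antisymmetrize (n + 1) (tmulL n φ (wedge n v)) = _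
  unfold wedge
  rw [map_smul, map_smul, map_sum, map_sum]
  simp only [map_smul, ← tensorProd_cons, antisymmetrize_tensorProd, wedgeA_cons_comp_perm]
  exact smul_sum_sign_smul_sign _

/-- The annihilation operator on `n` particles; the truncated subtraction only matters for
`n = 0`, where it vanishes. -/
def annihilateN (φ : G) : ∀ n : ℕ, AntisymPow G n →L[ℂ] AntisymPow G (n - 1)
  | 0 => 0
  | n + 1 => ((n + 1 : ℕ) : ℂ) • (createN φ n).adjoint

/-- The expansion of the Gram determinant of `w ↦ ⟪φ ∧ w, v⟫` along its first row. -/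
theorem annihilateN_wedgeA (φ : G) (n : ℕ) (v : Fin (n + 1) → G) :
    annihilateN φ (n + 1) (wedgeA (n + 1) v) =
      ∑ i : Fin (n + 1), ((-1 : ℂ) ^ (i : ℕ) * ⟪φ, v i⟫) • wedgeA n (v ∘ i.succAbove) := by
  refine AntisymPow.ext_inner (n := n) fun w => ?_
  change ⟪wedgeA n w, ((n + 1 : ℕ) : ℂ) • (createN φ n).adjoint (wedgeA (n + 1) v)⟫ = _
  rw [inner_smul_right, ContinuousLinearMap.adjoint_inner_right, createN_wedgeA]
  have h1 := inner_wedge_wedge (n + 1) (Fin.cons φ w : Fin (n + 1) → G) v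
  rw [inner_sum]
  refine (congrArg _ h1).trans ?_
  rw [Matrix.det_succ_row_zero, ← mul_assoc, Finset.mul_sum]
  refine Finset.sum_congr rfl fun i _ => ?_
  rw [inner_smul_right]
  have h2 : ⟪wedgeA n w, wedgeA n (v ∘ i.succAbove)⟫ = _ := inner_wedge_wedge n w (v ∘ i.succAbove)
  have h3 : ((n + 1 : ℕ) : ℂ) * ((n + 1).factorial : ℂ)⁻¹ = ((n.factorial : ℂ)⁻¹) := by
    rw [Nat.factorial_succ, Nat.cast_mul, mul_inv, ← mul_assoc,
      mul_inv_cancel₀ (by exact_mod_cast Nat.succ_ne_zero n), one_mul]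
  refine Eq.trans ?_ (congrArg _ h2).symm
  rw [h3]
  exact mul_left_comm _ _ _

theorem derivationTensor_tensorProd (B : G →L[ℂ] G) (n : ℕ) (v : Fin n → G) :
    derivationTensor B n (tensorProd n v) =
      ∑ i, tensorProd n (Function.update v i (B (v i))) := by
  induction n with
  | zero => simp [derivationTensor]
  | succ n ih =>
    have h1 : tensorHead n B (tmulL n (v 0) (tensorProd n (Fin.tail v))) =
        tmulL n (B (v 0)) (tensorProd n (Fin.tail v)) :=
      (ContinuousLinearMap.completion_apply_coe _ _).trans rfl
    have h2 (D : TensorPow G n →L[ℂ] TensorPow G n) :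
        tensorTail n D (tmulL n (v 0) (tensorProd n (Fin.tail v))) =
        tmulL n (v 0) (D (tensorProd n (Fin.tail v))) :=
      (ContinuousLinearMap.completion_apply_coe _ _).trans rfl
    change tensorHead n B (tmulL n (v 0) (tensorProd n (Fin.tail v))) +
      tensorTail n (derivationTensor B n) (tmulL n (v 0) (tensorProd n (Fin.tail v))) = _
    rw [h1, h2, ih, Fin.sum_univ_succ, map_sum]
    congr 1
    refine Finset.sum_congr rfl fun i _ => ?_
    change _ = tmulL n _ (tensorProd n (Fin.tail (Function.update v i.succ (B (v i.succ)))))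
    rw [Function.update_of_ne (Fin.succ_ne_zero i).symm, Fin.tail_update_succ]
    rfl

theorem secondQuantN_wedgeA (B : G →L[ℂ] G) (n : ℕ) (v : Fin n → G) :
    secondQuantN B n (wedgeA n v) = ∑ i, wedgeA n (Function.update v i (B (v i))) := by
  change antisymmetrize n (derivationTensor B n (wedge n v)) = _
  unfold wedge
  rw [map_smul, map_smul, map_sum, map_sum]
  have h (π : Equiv.Perm (Fin n)) :
      antisymmetrize n (derivationTensor B n (tensorProd n (v ∘ π))) =
        ((Equiv.Perm.sign π : ℤ) : ℂ) • ∑ i, wedgeA n (Function.update v i (B (v i))) := by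
    rw [derivationTensor_tensorProd, map_sum, Finset.smul_sum, ← Equiv.sum_comp π
      (fun i => ((Equiv.Perm.sign π : ℤ) : ℂ) • wedgeA n (Function.update v i (B (v i))))]
    refine Finset.sum_congr rfl fun i _ => ?_
    rw [antisymmetrize_tensorProd, ← wedgeA_comp_perm]
    congr 1
    funext j
    simp only [Function.comp_apply, Function.update_apply, π.injective.eq_iff]
  simp only [map_smul, h]
  exact smul_sum_sign_smul_sign _

theorem createPairN_coe_wedgeA (φ ψ : G) (n : ℕ) (v : Fin n → G) :
    createPairN ((φ ⊗ₜ[ℂ] ψ : G ⊗[ℂ] G) : HilbertTensor G G) n (wedgeA n v) =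
      wedgeA (n + 2) (Fin.cons φ (Fin.cons ψ v : Fin (n + 1) → G) : Fin (n + 2) → G) := by
  have h0 : createPairN ((φ ⊗ₜ[ℂ] ψ : G ⊗[ℂ] G) : HilbertTensor G G) n (wedgeA n v) =
      antisymmetrize (n + 2) (tmulL (n + 1) φ (tmulL n ψ (wedge n v))) := by
    change antisymmetrize (n + 2) (pairTensor n (wedge n v) _) = _
    rw [pairTensor_coe]
    rfl
  rw [h0]
  unfold wedge
  rw [map_smul, map_smul, map_smul, map_sum, map_sum, map_sum]
  have h (π : Equiv.Perm (Fin n)) :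
      (Fin.cons ψ (v ∘ π) : Fin (n + 1) → G) =
      (Fin.cons ψ v : Fin (n + 1) → G) ∘ Equiv.Perm.decomposeFin.symm (0, π) := by
    funext i
    refine Fin.cases ?_ (fun i => ?_) i
    · simp
    · simp
  simp only [map_smul, ← tensorProd_cons, antisymmetrize_tensorProd, h, wedgeA_cons_comp_perm,
    Equiv.Perm.decomposeFin.symm_sign]
  simp only [if_true, one_mul]
  exact smul_sum_sign_smul_sign _

/-! ### The operators on wedge products in the Fock space -/

/-- The wedge product `v 0 ∧ ⋯ ∧ v (n - 1)` as a vector of the Fock space. -/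
def fockWedge (n : ℕ) (v : Fin n → G) : FockFin G := FockFin.of n (wedgeA n v)

theorem create_of (φ : G) (n : ℕ) (g : AntisymPow G n) :
    create φ (FockFin.of n g) = FockFin.of (n + 1) (createN φ n g) :=
  FockFin.liftₗ_of _ n g

theorem annihilate_of (φ : G) (n : ℕ) (g : AntisymPow G n) :
    annihilate φ (FockFin.of n g) = FockFin.of (n - 1) (annihilateN φ n g) := by
  cases n with
  | zero => exact (FockFin.liftₗ_of _ 0 g).trans (map_zero (FockFin.of (G := G) 0)).symm
  | succ n => exact FockFin.liftₗ_of _ (n + 1) g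

theorem create_fockWedge (φ : G) (n : ℕ) (v : Fin n → G) :
    create φ (fockWedge n v) = fockWedge (n + 1) (Fin.cons φ v : Fin (n + 1) → G) := by
  rw [fockWedge, create_of, createN_wedgeA, fockWedge]

theorem annihilate_fockWedge_zero (φ : G) (v : Fin 0 → G) : annihilate φ (fockWedge 0 v) = 0 :=
  (annihilate_of φ 0 _).trans (map_zero (FockFin.of (G := G) 0))

theorem annihilate_fockWedge (φ : G) (n : ℕ) (v : Fin (n + 1) → G) :
    annihilate φ (fockWedge (n + 1) v) =
      ∑ i : Fin (n + 1), ((-1 : ℂ) ^ (i : ℕ) * ⟪φ, v i⟫) • fockWedge n (v ∘ i.succAbove) := by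
  rw [fockWedge, annihilate_of, annihilateN_wedgeA]
  change FockFin.of n _ = _
  rw [map_sum]
  simp only [map_smul]
  rfl

theorem secondQuant_fockWedge (B : G →L[ℂ] G) (n : ℕ) (v : Fin n → G) :
    secondQuant B (fockWedge n v) = ∑ i, fockWedge n (Function.update v i (B (v i))) := by
  refine (FockFin.liftₗ_of _ n _).trans ?_
  change FockFin.of n (secondQuantN B n (wedgeA n v)) = _
  rw [secondQuantN_wedgeA, map_sum]
  rfl

theorem createPair_coe_fockWedge (φ ψ : G) (n : ℕ) (v : Fin n → G) :
    createPair ((φ ⊗ₜ[ℂ] ψ : G ⊗[ℂ] G) : HilbertTensor G G) (fockWedge n v) =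
      create φ (create ψ (fockWedge n v)) := by
  rw [create_fockWedge, create_fockWedge]
  refine (FockFin.liftₗ_of _ n _).trans ?_
  change FockFin.of (n + 2) (createPairN _ n (wedgeA n v)) = _
  rw [createPairN_coe_wedgeA]
  rfl

end FockAlgebra

section FockTopology

variable {G : Type u} [NormedAddCommGroup G] [InnerProductSpace ℂ G]

/-! ### The locally convex direct sum topology -/

/-- The `n`-particle component of a finite vector. -/
def FockFin.coord (n : ℕ) : FockFin G →ₗ[ℂ] AntisymPow G n :=
  DirectSum.component ℂ ℕ (fun n => AntisymPow G n) n

theorem FockFin.coord_of_self (n : ℕ) (g : AntisymPow G n) :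
    FockFin.coord n (FockFin.of n g) = g :=
  DirectSum.component.lof_self ℂ n g

theorem FockFin.coord_of_ne {n m : ℕ} (h : n ≠ m) (g : AntisymPow G n) :
    FockFin.coord m (FockFin.of n g) = 0 :=
  (DirectSum.component.of (R := ℂ) m n g).trans (dif_neg h)

theorem FockFin.induction {p : FockFin G → Prop} (v : FockFin G) (zero : p 0)
    (add : ∀ x y, p x → p y → p (x + y)) (of : ∀ n g, p (FockFin.of n g)) : p v :=
  DirectSum.induction_on (motive := p) v zero of add

theorem FockFin.exists_eq_sum (v : FockFin G) :
    ∃ N, (∀ n, N ≤ n → FockFin.coord n v = 0) ∧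
      ∀ M, N ≤ M → v = ∑ n ∈ Finset.range M, FockFin.of n (FockFin.coord n v) := by
  refine FockFin.induction (p := fun v => ∃ N, (∀ n, N ≤ n → FockFin.coord n v = 0) ∧
      ∀ M, N ≤ M → v = ∑ n ∈ Finset.range M, FockFin.of n (FockFin.coord n v)) v
    ⟨0, by simp⟩ ?_ ?_
  · rintro x y ⟨N, hN, hN'⟩ ⟨N', hM, hM'⟩
    refine ⟨max N N', fun n hn => ?_, fun M hn => ?_⟩
    · rw [map_add, hN n (by omega), hM n (by omega), add_zero]
    · conv_lhs => rw [hN' M (by omega), hM' M (by omega)]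
      simp [Finset.sum_add_distrib]
  · intro n g
    refine ⟨n + 1, fun m hm => FockFin.coord_of_ne (by omega) g, fun M hM => ?_⟩
    rw [Finset.sum_eq_single n]
    · rw [FockFin.coord_of_self]
    · intro m _ hm
      rw [FockFin.coord_of_ne (Ne.symm hm), map_zero]
    · intro h
      exact absurd (Finset.mem_range.2 (by omega)) h

theorem FockFin.ext_coord {v w : FockFin G} (h : ∀ n, FockFin.coord n v = FockFin.coord n w) :
    v = w := by
  obtain ⟨N, -, hN⟩ := FockFin.exists_eq_sum v
  obtain ⟨M, -, hM⟩ := FockFin.exists_eq_sum w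
  rw [hN (max N M) (le_max_left _ _), hM (max N M) (le_max_right _ _)]
  simp only [h]

/-- The seminorm `∑ n, c n * ‖v⁽ⁿ⁾‖` on the finite vectors. -/
def FockFin.wnorm (c : ℕ → NNReal) : Seminorm ℂ (FockFin G) :=
  Seminorm.of (fun v => ∑' n, (c n : ℝ) * ‖FockFin.coord n v‖)
    (fun v w => by
      have hs (v : FockFin G) : Summable fun n => (c n : ℝ) * ‖FockFin.coord n v‖ := by
        obtain ⟨N, hN, -⟩ := FockFin.exists_eq_sum v
        refine summable_of_ne_finset_zero (s := Finset.range N) fun n hn => ?_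
        rw [hN n (by simpa using hn), norm_zero, mul_zero]
      rw [← (hs v).tsum_add (hs w)]
      refine (hs _).tsum_le_tsum (fun n => ?_) ((hs v).add (hs w))
      rw [← mul_add, map_add]
      gcongr
      exact norm_add_le _ _)
    (fun a v => by
      rw [← tsum_mul_left]
      refine tsum_congr fun n => ?_
      rw [map_smul, norm_smul]
      ring)

theorem FockFin.wnorm_eq_sum (c : ℕ → NNReal) (v : FockFin G) {N : ℕ}
    (hN : ∀ n, N ≤ n → FockFin.coord n v = 0) :
    FockFin.wnorm c v = ∑ n ∈ Finset.range N, (c n : ℝ) * ‖FockFin.coord n v‖ :=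
  tsum_eq_sum fun n hn => by rw [hN n (by simpa using hn), norm_zero, mul_zero]

theorem FockFin.wnorm_of (c : ℕ → NNReal) (n : ℕ) (g : AntisymPow G n) :
    FockFin.wnorm c (FockFin.of n g) = c n * ‖g‖ := by
  refine (tsum_eq_single n fun m hm => ?_).trans ?_
  · rw [FockFin.coord_of_ne (Ne.symm hm), norm_zero, mul_zero]
  · rw [FockFin.coord_of_self]

theorem FockFin.sum_range_le_wnorm (c : ℕ → NNReal) (v : FockFin G) (N : ℕ) :
    ∑ n ∈ Finset.range N, (c n : ℝ) * ‖FockFin.coord n v‖ ≤ FockFin.wnorm c v := by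
  obtain ⟨M, hM, -⟩ := FockFin.exists_eq_sum v
  rw [FockFin.wnorm_eq_sum c v (N := max N M) fun n hn => hM n (by omega)]
  exact Finset.sum_le_sum_of_subset_of_nonneg (by simp) fun _ _ _ => by positivity

theorem FockFin.coord_le_wnorm (c : ℕ → NNReal) (v : FockFin G) (n : ℕ) :
    c n * ‖FockFin.coord n v‖ ≤ FockFin.wnorm c v := by
  refine le_trans ?_ (FockFin.sum_range_le_wnorm c v (n + 1))
  exact Finset.single_le_sum (f := fun n => (c n : ℝ) * ‖FockFin.coord n v‖)
    (fun _ _ => by positivity) (by simp)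

theorem FockFin.wnorm_add_index (c d : ℕ → NNReal) (v : FockFin G) :
    FockFin.wnorm (c + d) v = FockFin.wnorm c v + FockFin.wnorm d v := by
  obtain ⟨N, hN, -⟩ := FockFin.exists_eq_sum v
  rw [FockFin.wnorm_eq_sum _ v hN, FockFin.wnorm_eq_sum _ v hN, FockFin.wnorm_eq_sum _ v hN,
    ← Finset.sum_add_distrib]
  refine Finset.sum_congr rfl fun n _ => ?_
  simp [add_mul]

theorem FockFin.wnorm_smul_index (a : NNReal) (c : ℕ → NNReal) (v : FockFin G) :
    FockFin.wnorm (a • c) v = a * FockFin.wnorm c v := by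
  obtain ⟨N, hN, -⟩ := FockFin.exists_eq_sum v
  rw [FockFin.wnorm_eq_sum _ v hN, FockFin.wnorm_eq_sum _ v hN, Finset.mul_sum]
  refine Finset.sum_congr rfl fun n _ => ?_
  simp [mul_assoc]

theorem FockFin.continuous_wnorm (c : ℕ → NNReal) :
    Continuous (FockFin.wnorm (G := G) c) :=
  FockFin.withSeminorms.continuous_seminorm
    (⟨FockFin.wnorm c, fun n => by
      simp only [FockFin.wnorm_of]
      fun_prop⟩ : FockFin.SumSeminorm G)

/-- The seminorms `FockFin.wnorm c` generate the topology. -/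
theorem FockFin.exists_le_wnorm (p : Seminorm ℂ (FockFin G))
    (hp : ∀ n, Continuous fun g : AntisymPow G n => p (FockFin.of n g)) :
    ∃ c, ∀ v, p v ≤ FockFin.wnorm c v := by
  have h (n : ℕ) : ∃ C : NNReal, ∀ g : AntisymPow G n, p (FockFin.of n g) ≤ C * ‖g‖ := by
    obtain ⟨C, hC, h⟩ := (p.comp (FockFin.of n)).bound_of_continuous_normedSpace (hp n)
    exact ⟨⟨C, hC.le⟩, h⟩
  choose c hc using h
  refine ⟨c, fun v => ?_⟩
  obtain ⟨N, hN, hN'⟩ := FockFin.exists_eq_sum v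
  rw [FockFin.wnorm_eq_sum c v hN]
  conv_lhs => rw [hN' N le_rfl]
  exact (Finset.le_sum_of_subadditive p (map_zero p).le (map_add_le_add p) _ _).trans
    (Finset.sum_le_sum fun n _ => hc n _)

theorem FockFin.exists_wnorm_apply_le (R : FockOp G) (c : ℕ → NNReal) :
    ∃ d, ∀ v, FockFin.wnorm c (R v) ≤ FockFin.wnorm d v :=
  FockFin.exists_le_wnorm ((FockFin.wnorm c).comp R.toLinearMap) fun n =>
    (FockFin.continuous_wnorm c).comp (R.continuous.comp (FockFin.continuous_of n))

theorem FockFin.tendsto_iff {α : Type*} {l : Filter α} {f : α → FockFin G} {x : FockFin G} :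
    Tendsto f l (𝓝 x) ↔ ∀ c : ℕ → NNReal, ∀ ε > 0, ∀ᶠ a in l, FockFin.wnorm c (f a - x) < ε := by
  rw [FockFin.withSeminorms.tendsto_nhds]
  constructor
  · intro h c ε hε
    exact h ⟨FockFin.wnorm c, fun n => (FockFin.continuous_wnorm c).comp
      (FockFin.continuous_of n)⟩ ε hε
  · rintro h ⟨p, hp⟩ ε hε
    obtain ⟨c, hc⟩ := FockFin.exists_le_wnorm p hp
    filter_upwards [h c ε hε] with a ha using (hc _).trans_lt ha

theorem FockFin.continuous_coord (n : ℕ) : Continuous (FockFin.coord (G := G) n) := by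
  refine continuous_of_continuousAt_zero (FockFin.coord (G := G) n) ?_
  rw [ContinuousAt, map_zero, tendsto_zero_iff_norm_tendsto_zero]
  have h := (FockFin.continuous_wnorm (G := G) (Pi.single n 1)).tendsto 0
  rw [map_zero] at h
  refine squeeze_zero (fun _ => norm_nonneg _) (fun v => ?_) h
  simpa using FockFin.coord_le_wnorm (Pi.single n 1) v n

instance : T2Space (FockFin G) := by
  refine T2Space.of_injective_continuous (f := fun v n => FockFin.coord n v) ?_
    (continuous_pi fun n => FockFin.continuous_coord (G := G) n)
  intro v w h
  exact FockFin.ext_coord fun n => congrFun h n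

/-- A Cauchy net of finite vectors converges. If infinitely many of the limits `x n` of the
components were non-zero, the net would not be Cauchy for the seminorm with the weights
`1 / ‖x n‖`. -/
theorem FockFin.exists_tendsto_of_cauchy {α : Type*} {l : Filter α} [l.NeBot] {f : α → FockFin G}
    (h : ∀ c : ℕ → NNReal, ∀ ε > 0, ∃ A ∈ l, ∀ a ∈ A, ∀ b ∈ A,
      FockFin.wnorm c (f a - f b) ≤ ε) : ∃ x, Tendsto f l (𝓝 x) := by
  have hx (n : ℕ) : ∃ x, Tendsto (fun a => FockFin.coord n (f a)) l (𝓝 x) := by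
    refine cauchy_map_iff_exists_tendsto.1 (Metric.cauchy_iff.2 ⟨inferInstance, fun ε hε => ?_⟩)
    obtain ⟨A, hA, hA'⟩ := h (Pi.single n 1) (ε / 2) (half_pos hε)
    refine ⟨_, image_mem_map hA, ?_⟩
    rintro _ ⟨a, ha, rfl⟩ _ ⟨b, hb, rfl⟩
    rw [dist_eq_norm, ← map_sub]
    have h1 := FockFin.coord_le_wnorm (Pi.single n 1) (f a - f b) n
    have h2 := hA' a ha b hb
    simp only [Pi.single_eq_same, NNReal.coe_one, one_mul] at h1
    linarith
  choose x hx using hx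
  have key (c : ℕ → NNReal) (ε : ℝ) (hε : 0 < ε) : ∃ A ∈ l, ∀ a ∈ A, ∀ N,
      ∑ n ∈ Finset.range N, (c n : ℝ) * ‖FockFin.coord n (f a) - x n‖ ≤ ε := by
    obtain ⟨A, hA, hA'⟩ := h c ε hε
    refine ⟨A, hA, fun a ha N => ?_⟩
    have ht : Tendsto (fun b => ∑ n ∈ Finset.range N,
        (c n : ℝ) * ‖FockFin.coord n (f a) - FockFin.coord n (f b)‖) l
        (𝓝 (∑ n ∈ Finset.range N, (c n : ℝ) * ‖FockFin.coord n (f a) - x n‖)) :=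
      tendsto_finsetSum _ fun n _ => ((tendsto_const_nhds.sub (hx n)).norm.const_mul _)
    refine le_of_tendsto ht ?_
    filter_upwards [hA] with b hb
    simp only [← map_sub]
    exact (FockFin.sum_range_le_wnorm c _ N).trans (hA' a ha b hb)
  have hfin : ∃ N, ∀ n, N ≤ n → x n = 0 := by
    obtain ⟨A, hA, hA'⟩ := key (fun n => ‖x n‖₊⁻¹) (1 / 2) (by norm_num)
    obtain ⟨a, ha⟩ := l.nonempty_of_mem hA
    obtain ⟨N, hN, -⟩ := FockFin.exists_eq_sum (f a)
    refine ⟨N, fun n hn => ?_⟩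
    by_contra hne
    have h1 := hA' a ha (n + 1)
    have h2 := (Finset.single_le_sum (f := fun n => ((‖x n‖₊⁻¹ : NNReal) : ℝ) *
      ‖FockFin.coord n (f a) - x n‖) (fun _ _ => by positivity)
      (Finset.self_mem_range_succ n)).trans h1
    simp only [hN n hn, zero_sub, norm_neg, NNReal.coe_inv, coe_nnnorm] at h2
    rw [inv_mul_cancel₀ (norm_ne_zero_iff.2 hne)] at h2
    norm_num at h2
  obtain ⟨N, hN⟩ := hfin
  have hcoord (n : ℕ) :
      FockFin.coord n (∑ m ∈ Finset.range N, FockFin.of m (x m)) = x n := by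
    rw [map_sum]
    by_cases hn : n < N
    · rw [Finset.sum_eq_single n, FockFin.coord_of_self]
      · exact fun m _ hm => FockFin.coord_of_ne hm _
      · exact fun h => absurd (Finset.mem_range.2 hn) h
    · rw [hN n (by omega)]
      refine Finset.sum_eq_zero fun m hm => FockFin.coord_of_ne ?_ _
      have := Finset.mem_range.1 hm
      omega
  refine ⟨∑ n ∈ Finset.range N, FockFin.of n (x n), FockFin.tendsto_iff.2 fun c ε hε => ?_⟩
  obtain ⟨A, hA, hA'⟩ := key c (ε / 2) (half_pos hε)
  filter_upwards [hA] with a ha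
  refine lt_of_le_of_lt ?_ (half_lt_self hε)
  obtain ⟨M, hM, -⟩ := FockFin.exists_eq_sum (f a - ∑ n ∈ Finset.range N, FockFin.of n (x n))
  rw [FockFin.wnorm_eq_sum c _ hM]
  refine le_trans (le_of_eq ?_) (hA' a ha M)
  simp only [map_sub, hcoord]

theorem FockOp.ext_fockWedge {S T : FockOp G}
    (h : ∀ n v, S (fockWedge n v) = T (fockWedge n v)) : S = T := by
  ext f
  refine FockFin.induction (p := fun f => S f = T f) f (by simp) ?_ ?_
  · intro x y hx hy
    simp [hx, hy]
  · intro n g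
    have h2 : S.comp (⟨FockFin.of n, FockFin.continuous_of n⟩ : AntisymPow G n →L[ℂ] FockFin G) =
        T.comp (⟨FockFin.of n, FockFin.continuous_of n⟩ : AntisymPow G n →L[ℂ] FockFin G) :=
      AntisymPow.clm_ext fun v => h n v
    exact congrArg (fun U : AntisymPow G n →L[ℂ] FockFin G => U g) h2

end FockTopology

section Commutation

variable {G : Type u} [NormedAddCommGroup G] [InnerProductSpace ℂ G]

/-! ### Dependence of the field operators on their arguments -/

theorem createN_add (φ ψ : G) (n : ℕ) : createN (φ + ψ) n = createN φ n + createN ψ n := by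
  simp only [createN, map_add, ContinuousLinearMap.add_comp, ContinuousLinearMap.comp_add]

theorem createN_smul (c : ℂ) (φ : G) (n : ℕ) : createN (c • φ) n = c • createN φ n := by
  simp only [createN, map_smul, ContinuousLinearMap.smul_comp, ContinuousLinearMap.comp_smul]

theorem continuous_createN (n : ℕ) : Continuous fun φ : G => createN φ n := by
  unfold createN
  fun_prop

theorem annihilateN_add (φ ψ : G) (n : ℕ) :
    annihilateN (φ + ψ) n = annihilateN φ n + annihilateN ψ n := by
  cases n with
  | zero => exact (add_zero _).symm
  | succ n =>
    change ((n + 1 : ℕ) : ℂ) • _ = ((n + 1 : ℕ) : ℂ) • _ + ((n + 1 : ℕ) : ℂ) • _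
    rw [createN_add, map_add, smul_add]

theorem annihilateN_smul (c : ℂ) (φ : G) (n : ℕ) :
    annihilateN (c • φ) n = star c • annihilateN φ n := by
  cases n with
  | zero => exact (smul_zero (A := AntisymPow G 0 →L[ℂ] AntisymPow G 0) (star c)).symm
  | succ n =>
    change ((n + 1 : ℕ) : ℂ) • _ = star c • ((n + 1 : ℕ) : ℂ) • _
    rw [createN_smul, map_smulₛₗ, smul_comm]
    rfl

theorem continuous_annihilateN (n : ℕ) : Continuous fun φ : G => annihilateN φ n := by
  cases n with
  | zero => exact continuous_const
  | succ n =>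
    exact (ContinuousLinearMap.adjoint.continuous.comp (continuous_createN n)).const_smul
      ((n + 1 : ℕ) : ℂ)

/-- Two operators agreeing on every `n`-particle space are equal. -/
theorem FockOp.ext_of {S T : FockOp G} (h : ∀ n g, S (FockFin.of n g) = T (FockFin.of n g)) :
    S = T :=
  FockOp.ext_fockWedge fun n _ => h n _

theorem create_add (φ ψ : G) : create (φ + ψ) = create φ + create ψ :=
  FockOp.ext_of fun n g => by
    rw [add_apply, create_of, create_of, create_of, createN_add, add_apply, map_add]

theorem create_smul (c : ℂ) (φ : G) : create (c • φ) = c • create φ :=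
  FockOp.ext_of fun n g => by
    rw [smul_apply, create_of, create_of, createN_smul, smul_apply, map_smul]

theorem annihilate_add (φ ψ : G) : annihilate (φ + ψ) = annihilate φ + annihilate ψ :=
  FockOp.ext_of fun n g => by
    rw [add_apply, annihilate_of, annihilate_of, annihilate_of, annihilateN_add, add_apply, map_add]

theorem annihilate_smul (c : ℂ) (φ : G) : annihilate (c • φ) = star c • annihilate φ :=
  FockOp.ext_of fun n g => by
    rw [smul_apply, annihilate_of, annihilate_of, annihilateN_smul, smul_apply, map_smul]

theorem create_neg (φ : G) : create (-φ) = -create φ := by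
  rw [← neg_one_smul ℂ, create_smul, neg_one_smul]

theorem annihilate_neg (φ : G) : annihilate (-φ) = -annihilate φ := by
  rw [← neg_one_smul ℂ, annihilate_smul, star_neg, star_one, neg_one_smul]

theorem create_sub (φ ψ : G) : create (φ - ψ) = create φ - create ψ := by
  rw [sub_eq_add_neg, create_add, create_neg, ← sub_eq_add_neg]

theorem annihilate_sub (φ ψ : G) : annihilate (φ - ψ) = annihilate φ - annihilate ψ := by
  rw [sub_eq_add_neg, annihilate_add, annihilate_neg, ← sub_eq_add_neg]

theorem continuous_create (f : FockFin G) : Continuous fun φ : G => create φ f := by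
  refine FockFin.induction (p := fun f => Continuous fun φ : G => create φ f) f ?_ ?_ ?_
  · simp only [map_zero]
    exact continuous_const
  · intro x y hx hy
    simp only [map_add]
    exact hx.add hy
  · intro n g
    simp only [create_of]
    exact (FockFin.continuous_of _).comp ((continuous_createN n).clm_apply continuous_const)

theorem continuous_annihilate (f : FockFin G) : Continuous fun φ : G => annihilate φ f := by
  refine FockFin.induction (p := fun f => Continuous fun φ : G => annihilate φ f) f ?_ ?_ ?_
  · simp only [map_zero]
    exact continuous_const
  · intro x y hx hy
    simp only [map_add]
    exact hx.add hy
  · intro n g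
    simp only [annihilate_of]
    exact (FockFin.continuous_of _).comp ((continuous_annihilateN n).clm_apply continuous_const)

/-! ### Canonical anticommutation relations -/

theorem cons_comp_zero_succAbove {α : Type*} (n : ℕ) (ψ : α) (v : Fin n → α) :
    (Fin.cons ψ v : Fin (n + 1) → α) ∘ (0 : Fin (n + 1)).succAbove = v := by
  funext i
  simp

theorem annihilate_mul_create (φ ψ : G) :
    annihilate φ * create ψ = ⟪φ, ψ⟫ • (1 : FockOp G) - create ψ * annihilate φ := by
  refine FockOp.ext_fockWedge fun n v => ?_
  rw [sub_apply, mul_apply_eq_comp, mul_apply_eq_comp, smul_apply, one_apply_eq_self,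
    create_fockWedge, annihilate_fockWedge, Fin.sum_univ_succ, cons_comp_zero_succAbove]
  simp only [Fin.val_zero, pow_zero, one_mul, Fin.cons_zero, Fin.cons_succ, Fin.val_succ]
  rw [sub_eq_add_neg]
  congr 1
  cases n with
  | zero => rw [annihilate_fockWedge_zero, map_zero, neg_zero]; simp
  | succ n =>
    rw [annihilate_fockWedge, map_sum, ← Finset.sum_neg_distrib]
    refine Finset.sum_congr rfl fun i _ => ?_
    rw [map_smul, create_fockWedge, Fin.cons_comp_succ_succAbove, pow_succ, ← neg_smul]
    congr 1
    ring

theorem create_mul_create (φ ψ : G) : create φ * create ψ = -(create ψ * create φ) := by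
  refine FockOp.ext_fockWedge fun n v => ?_
  rw [neg_apply, mul_apply_eq_comp, mul_apply_eq_comp, create_fockWedge, create_fockWedge,
    create_fockWedge, create_fockWedge]
  have h : (Fin.cons φ (Fin.cons ψ v : Fin (n + 1) → G) : Fin (n + 2) → G) =
      (Fin.cons ψ (Fin.cons φ v : Fin (n + 1) → G) : Fin (n + 2) → G) ∘ Equiv.swap 0 1 := by
    funext i
    refine Fin.cases ?_ (fun i => ?_) i
    · simp
    · refine Fin.cases ?_ (fun i => ?_) i
      · simp
      · have h1 : (Equiv.swap (0 : Fin (n + 2)) 1) i.succ.succ = i.succ.succ :=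
          Equiv.swap_apply_of_ne_of_ne (Fin.succ_ne_zero _)
            (fun h => Fin.succ_ne_zero i (Fin.succ_injective _ h))
        simp [h1]
  rw [h, fockWedge, wedgeA_comp_perm, Equiv.Perm.sign_swap (by simp)]
  simp [fockWedge]

theorem annihilate_mul_annihilate (φ ψ : G) :
    annihilate φ * annihilate ψ = -(annihilate ψ * annihilate φ) := by
  have hc (n : ℕ) : (createN ψ (n + 1)) ∘L createN φ n = -((createN φ (n + 1)) ∘L createN ψ n) := by
    ext g
    have h := congrArg (fun T : FockOp G => FockFin.coord (n + 2) (T (FockFin.of n g)))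
      (create_mul_create ψ φ)
    simp only [neg_apply, mul_apply_eq_comp, create_of] at h
    rw [FockFin.coord_of_self, map_neg, FockFin.coord_of_self] at h
    rw [ContinuousLinearMap.comp_apply, h]
    rfl
  refine FockOp.ext_of fun n g => ?_
  rw [neg_apply, mul_apply_eq_comp, mul_apply_eq_comp]
  match n with
  | 0 =>
    rw [annihilate_of, annihilate_of, annihilate_of, annihilate_of]
    change FockFin.of 0 (annihilateN φ 0 0) = -FockFin.of 0 (annihilateN ψ 0 0)
    simp
  | 1 =>
    rw [annihilate_of, annihilate_of, annihilate_of, annihilate_of]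
    change FockFin.of 0 (0 : AntisymPow G 0) = -FockFin.of 0 (0 : AntisymPow G 0)
    simp
  | n + 2 =>
    rw [annihilate_of, annihilate_of, annihilate_of, annihilate_of, ← map_neg]
    refine congrArg (FockFin.of n) ?_
    have h := congrArg (fun T => ContinuousLinearMap.adjoint T g) (hc n)
    simp only [map_neg, ContinuousLinearMap.adjoint_comp, neg_apply,
      ContinuousLinearMap.comp_apply] at h
    change ((n + 1 : ℕ) : ℂ) • (createN φ n).adjoint (((n + 2 : ℕ) : ℂ) •
      (createN ψ (n + 1)).adjoint g) = -(((n + 1 : ℕ) : ℂ) • (createN ψ n).adjoint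
      (((n + 2 : ℕ) : ℂ) • (createN φ (n + 1)).adjoint g))
    rw [map_smul, map_smul, h, smul_neg, smul_neg]

/-! ### Commutators with the second quantization of an operator -/

theorem secondQuant_mul_create (B : G →L[ℂ] G) (φ : G) :
    secondQuant B * create φ = create φ * secondQuant B + create (B φ) := by
  refine FockOp.ext_fockWedge fun n v => ?_
  rw [add_apply, mul_apply_eq_comp, mul_apply_eq_comp, create_fockWedge, create_fockWedge,
    secondQuant_fockWedge, secondQuant_fockWedge, Fin.sum_univ_succ, map_sum, add_comm]
  simp only [Fin.cons_zero, Fin.cons_succ, Fin.cons_update, create_fockWedge, Fin.update_cons_zero]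

theorem secondQuant_mul_annihilate [CompleteSpace G] (B : G →L[ℂ] G) (φ : G) :
    secondQuant B * annihilate φ = annihilate φ * secondQuant B - annihilate (B.adjoint φ) := by
  refine FockOp.ext_fockWedge fun n v => ?_
  rw [sub_apply, mul_apply_eq_comp, mul_apply_eq_comp]
  cases n with
  | zero =>
    rw [annihilate_fockWedge_zero, annihilate_fockWedge_zero, secondQuant_fockWedge]
    simp
  | succ n =>
    rw [annihilate_fockWedge, annihilate_fockWedge, secondQuant_fockWedge, map_sum, map_sum]
    simp only [annihilate_fockWedge, map_smul, secondQuant_fockWedge]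
    rw [Finset.sum_comm, ← Finset.sum_sub_distrib]
    refine Finset.sum_congr rfl fun i _ => ?_
    rw [Fin.sum_univ_succAbove _ i, Finset.smul_sum]
    have h1 : (Function.update v i (B (v i))) ∘ i.succAbove = v ∘ i.succAbove :=
      Fin.removeNth_update i _ v
    have h2 (j : Fin n) : (Function.update v (i.succAbove j) (B (v (i.succAbove j)))) ∘ i.succAbove
        = Function.update (v ∘ i.succAbove) j (B (v (i.succAbove j))) :=
      Fin.removeNth_update_succAbove i j _ v
    simp only [h1, h2, Function.update_self, ContinuousLinearMap.adjoint_inner_left,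
      add_sub_cancel_left]
    refine Finset.sum_congr rfl fun j _ => ?_
    rw [Function.update_of_ne (Fin.succAbove_ne i j).symm]
    rfl

end Commutation

section PairOperators

variable {G : Type u} [NormedAddCommGroup G] [InnerProductSpace ℂ G]

/-! ### Pair creation and pair annihilation -/

theorem norm_antisymmetrize_le (n : ℕ) (x : TensorPow G n) : ‖antisymmetrize n x‖ ≤ ‖x‖ :=
  Submodule.norm_orthogonalProjectionOnto_apply_le _ x

theorem createPairN_apply (κ : HilbertTensor G G) (n : ℕ) (g : AntisymPow G n) :
    createPairN κ n g = antisymmetrize (n + 2) (pairTensor n (g : TensorPow G n) κ) := rfl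

theorem norm_createPairN_le (κ : HilbertTensor G G) (n : ℕ) : ‖createPairN κ n‖ ≤ ‖κ‖ := by
  refine ContinuousLinearMap.opNorm_le_bound (createPairN κ n) (norm_nonneg κ) fun g => ?_
  rw [createPairN_apply]
  exact (norm_antisymmetrize_le (n + 2) (pairTensor n (g : TensorPow G n) κ)).trans
    (norm_pairTensor_le n (g : TensorPow G n) κ)

theorem createPairN_add (κ κ' : HilbertTensor G G) (n : ℕ) :
    createPairN (κ + κ') n = createPairN κ n + createPairN κ' n :=
  ContinuousLinearMap.ext fun g => by
    rw [add_apply, createPairN_apply, createPairN_apply, createPairN_apply, map_add, map_add]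

theorem continuous_createPairN (n : ℕ) : Continuous fun κ : HilbertTensor G G => createPairN κ n :=
  AddMonoidHomClass.continuous_of_bound
    (AddMonoidHom.mk' (fun κ : HilbertTensor G G => createPairN κ n)
      fun κ κ' => createPairN_add κ κ' n) 1 fun κ => by
    rw [one_mul]
    exact norm_createPairN_le κ n

/-- Pair annihilation on `n` particles, which vanishes for `n = 0` and `n = 1`. -/
def annihilatePairN (κ : HilbertTensor G G) : ∀ n : ℕ, AntisymPow G n →L[ℂ] AntisymPow G (n - 2)
  | 0 => 0
  | 1 => 0
  | n + 2 => (((n + 2) * (n + 1) : ℕ) : ℂ) • (createPairN κ n).adjoint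

theorem createPair_of (κ : HilbertTensor G G) (n : ℕ) (g : AntisymPow G n) :
    createPair κ (FockFin.of n g) = FockFin.of (n + 2) (createPairN κ n g) :=
  FockFin.liftₗ_of _ n g

theorem annihilatePair_of (κ : HilbertTensor G G) (n : ℕ) (g : AntisymPow G n) :
    annihilatePair κ (FockFin.of n g) = FockFin.of (n - 2) (annihilatePairN κ n g) := by
  match n with
  | 0 => exact (FockFin.liftₗ_of _ 0 g).trans (map_zero (FockFin.of (G := G) 0)).symm
  | 1 => exact (FockFin.liftₗ_of _ 1 g).trans (map_zero (FockFin.of (G := G) 0)).symm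
  | n + 2 => exact FockFin.liftₗ_of _ (n + 2) g

theorem annihilatePairN_add (κ κ' : HilbertTensor G G) (n : ℕ) :
    annihilatePairN (κ + κ') n = annihilatePairN κ n + annihilatePairN κ' n := by
  match n with
  | 0 => exact (add_zero _).symm
  | 1 => exact (add_zero _).symm
  | n + 2 =>
    change _ • (createPairN (κ + κ') n).adjoint =
      _ • (createPairN κ n).adjoint + _ • (createPairN κ' n).adjoint
    rw [createPairN_add, map_add, smul_add]

theorem continuous_annihilatePairN (n : ℕ) :
    Continuous fun κ : HilbertTensor G G => annihilatePairN κ n := by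
  match n with
  | 0 => exact continuous_const
  | 1 => exact continuous_const
  | n + 2 =>
    exact (ContinuousLinearMap.adjoint.continuous.comp (continuous_createPairN n)).const_smul
      (((n + 2) * (n + 1) : ℕ) : ℂ)

theorem createPair_add (κ κ' : HilbertTensor G G) :
    createPair (κ + κ') = createPair κ + createPair κ' :=
  FockOp.ext_of fun n g => by
    rw [add_apply, createPair_of, createPair_of, createPair_of, createPairN_add, add_apply, map_add]

theorem annihilatePair_add (κ κ' : HilbertTensor G G) :
    annihilatePair (κ + κ') = annihilatePair κ + annihilatePair κ' :=
  FockOp.ext_of fun n g => by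
    rw [add_apply, annihilatePair_of, annihilatePair_of, annihilatePair_of, annihilatePairN_add,
      add_apply, map_add]

theorem continuous_createPair (f : FockFin G) :
    Continuous fun κ : HilbertTensor G G => createPair κ f := by
  refine FockFin.induction
    (p := fun f => Continuous fun κ : HilbertTensor G G => createPair κ f) f ?_ ?_ ?_
  · simp only [map_zero]
    exact continuous_const
  · intro x y hx hy
    simp only [map_add]
    exact hx.add hy
  · intro n g
    simp only [createPair_of]
    exact (FockFin.continuous_of _).comp ((continuous_createPairN n).clm_apply continuous_const)

theorem continuous_annihilatePair (f : FockFin G) :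
    Continuous fun κ : HilbertTensor G G => annihilatePair κ f := by
  refine FockFin.induction
    (p := fun f => Continuous fun κ : HilbertTensor G G => annihilatePair κ f) f ?_ ?_ ?_
  · simp only [map_zero]
    exact continuous_const
  · intro x y hx hy
    simp only [map_add]
    exact hx.add hy
  · intro n g
    simp only [annihilatePair_of]
    exact (FockFin.continuous_of _).comp
      ((continuous_annihilatePairN n).clm_apply continuous_const)

theorem createPair_zero : createPair (0 : HilbertTensor G G) = 0 := by
  have h := createPair_add (0 : HilbertTensor G G) 0
  rwa [add_zero, left_eq_add] at h

theorem createPair_neg (κ : HilbertTensor G G) : createPair (-κ) = -createPair κ :=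
  eq_neg_of_add_eq_zero_left (by rw [← createPair_add, neg_add_cancel, createPair_zero])

theorem createPair_tmul (φ ψ : G) :
    createPair ((φ ⊗ₜ[ℂ] ψ : G ⊗[ℂ] G) : HilbertTensor G G) = create φ * create ψ :=
  FockOp.ext_fockWedge fun n v => createPair_coe_fockWedge φ ψ n v

theorem annihilatePair_tmul (φ ψ : G) :
    annihilatePair ((φ ⊗ₜ[ℂ] ψ : G ⊗[ℂ] G) : HilbertTensor G G) =
      annihilate ψ * annihilate φ := by
  have hc (n : ℕ) : createPairN ((φ ⊗ₜ[ℂ] ψ : G ⊗[ℂ] G) : HilbertTensor G G) n =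
      createN φ (n + 1) ∘L createN ψ n :=
    AntisymPow.clm_ext fun v => by
      rw [createPairN_coe_wedgeA, ContinuousLinearMap.comp_apply, createN_wedgeA, createN_wedgeA]
  refine FockOp.ext_of fun n g => ?_
  rw [mul_apply_eq_comp, annihilatePair_of, annihilate_of, annihilate_of]
  match n with
  | 0 =>
    change FockFin.of 0 (0 : AntisymPow G 0) = FockFin.of 0 (0 : AntisymPow G 0)
    rfl
  | 1 =>
    change FockFin.of 0 (0 : AntisymPow G 0) = FockFin.of 0 (0 : AntisymPow G 0)
    rfl
  | n + 2 =>
    refine congrArg (FockFin.of n) ?_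
    change (((n + 2) * (n + 1) : ℕ) : ℂ) • (createPairN _ n).adjoint g =
      ((n + 1 : ℕ) : ℂ) • (createN ψ n).adjoint (((n + 2 : ℕ) : ℂ) •
      (createN φ (n + 1)).adjoint g)
    rw [hc, ContinuousLinearMap.adjoint_comp, ContinuousLinearMap.comp_apply, map_smul, smul_smul,
      mul_comm (n + 2), Nat.cast_mul]

/-- Two continuous additive functions on a Hilbert tensor product which agree on the product
vectors are equal. -/
theorem HilbertTensor.eq_of_tmul {E F : Type u} [NormedAddCommGroup E] [InnerProductSpace ℂ E]
    [NormedAddCommGroup F] [InnerProductSpace ℂ F] {V : Type*} [AddCommGroup V]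
    [TopologicalSpace V] [T2Space V] {S T : HilbertTensor E F → V} (hS : Continuous S)
    (hT : Continuous T) (hSadd : ∀ x y, S (x + y) = S x + S y)
    (hTadd : ∀ x y, T (x + y) = T x + T y)
    (h : ∀ a b, S ((a ⊗ₜ[ℂ] b : E ⊗[ℂ] F) : HilbertTensor E F) =
      T ((a ⊗ₜ[ℂ] b : E ⊗[ℂ] F) : HilbertTensor E F)) (κ : HilbertTensor E F) : S κ = T κ := by
  induction κ using Completion.induction_on with
  | hp => exact isClosed_eq hS hT
  | ih x =>
    induction x using TensorProduct.induction_on with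
    | zero =>
      have h1 := hSadd 0 0
      have h2 := hTadd 0 0
      rw [add_zero, left_eq_add] at h1 h2
      rw [Completion.coe_zero, h1, h2]
    | tmul a b => exact h a b
    | add x y hx hy => rw [Completion.coe_add, hSadd, hTadd, hx, hy]

theorem createPair_mul_create (κ : HilbertTensor G G) (φ : G) :
    createPair κ * create φ = create φ * createPair κ := by
  ext f
  refine HilbertTensor.eq_of_tmul (S := fun κ => (createPair κ * create φ) f)
    (T := fun κ => (create φ * createPair κ) f) (continuous_createPair _)
    ((create φ).continuous.comp (continuous_createPair f)) ?_ ?_ ?_ κ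
  · intro x y
    rw [createPair_add, add_mul, add_apply]
  · intro x y
    rw [createPair_add, mul_add, add_apply]
  · intro a b
    rw [createPair_tmul, mul_assoc, create_mul_create b, mul_neg, ← mul_assoc,
      create_mul_create a, neg_mul, neg_neg, mul_assoc]

theorem annihilatePair_mul_annihilate (κ : HilbertTensor G G) (φ : G) :
    annihilatePair κ * annihilate φ = annihilate φ * annihilatePair κ := by
  ext f
  refine HilbertTensor.eq_of_tmul (S := fun κ => (annihilatePair κ * annihilate φ) f)
    (T := fun κ => (annihilate φ * annihilatePair κ) f) (continuous_annihilatePair _)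
    ((annihilate φ).continuous.comp (continuous_annihilatePair f)) ?_ ?_ ?_ κ
  · intro x y
    rw [annihilatePair_add, add_mul, add_apply]
  · intro x y
    rw [annihilatePair_add, mul_add, add_apply]
  · intro a b
    rw [annihilatePair_tmul, mul_assoc, annihilate_mul_annihilate a, mul_neg, ← mul_assoc,
      annihilate_mul_annihilate b, neg_mul, neg_neg, mul_assoc]

/-- An operator is determined by its commutators with the creation operators and its value on the
vacuum: the difference of two operators for which these agree commutes with all creation operators
and kills the vacuum, which is cyclic for them. -/
theorem FockOp.eq_of_commute_create {S T : FockOp G}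
    (h : ∀ φ f, S (create φ f) - create φ (S f) = T (create φ f) - create φ (T f))
    (h0 : ∀ v, S (fockWedge 0 v) = T (fockWedge 0 v)) : S = T := by
  refine FockOp.ext_fockWedge fun n v => ?_
  induction n with
  | zero => exact h0 v
  | succ n ih =>
    have h1 := h (v 0) (fockWedge n (Fin.tail v))
    rw [ih, create_fockWedge, Fin.cons_self_tail] at h1
    exact sub_left_injective h1

variable [CompleteSpace G]

/-- `φ ⊗ ·` as an operator from `G` to `G ⊗ G`. -/
def tmulLeft (φ : G) : G →L[ℂ] HilbertTensor G G :=
  Completion.toComplL.comp (TensorProduct.mkL ℂ G G φ)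

/-- `· ⊗ φ` as an operator from `G` to `G ⊗ G`. -/
def tmulRight (φ : G) : G →L[ℂ] HilbertTensor G G :=
  Completion.toComplL.comp ((TensorProduct.mkL ℂ G G).flip φ)

/-- The antisymmetric contraction `x ⊗ y ↦ ⟪φ, y⟫ x - ⟪φ, x⟫ y`, which is the commutator of pair
creation and annihilation. -/
def antiContract (φ : G) : HilbertTensor G G →L[ℂ] G :=
  (tmulRight φ).adjoint - (tmulLeft φ).adjoint

theorem antiContract_tmul (φ x y : G) :
    antiContract φ ((x ⊗ₜ[ℂ] y : G ⊗[ℂ] G) : HilbertTensor G G) = ⟪φ, y⟫ • x - ⟪φ, x⟫ • y := by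
  refine _root_.ext_inner_left ℂ fun z => ?_
  have h1 : ⟪tmulRight φ z, ((x ⊗ₜ[ℂ] y : G ⊗[ℂ] G) : HilbertTensor G G)⟫ = ⟪z, x⟫ * ⟪φ, y⟫ :=
    (Completion.inner_coe (z ⊗ₜ[ℂ] φ) (x ⊗ₜ[ℂ] y)).trans (TensorProduct.inner_tmul _ _ _ _ _)
  have h2 : ⟪tmulLeft φ z, ((x ⊗ₜ[ℂ] y : G ⊗[ℂ] G) : HilbertTensor G G)⟫ = ⟪φ, x⟫ * ⟪z, y⟫ :=
    (Completion.inner_coe (φ ⊗ₜ[ℂ] z) (x ⊗ₜ[ℂ] y)).trans (TensorProduct.inner_tmul _ _ _ _ _)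
  rw [antiContract, sub_apply, inner_sub_right, ContinuousLinearMap.adjoint_inner_right,
    ContinuousLinearMap.adjoint_inner_right, h1, h2, inner_sub_right, inner_smul_right,
    inner_smul_right, mul_comm]

theorem createPair_mul_annihilate (κ : HilbertTensor G G) (φ : G) :
    createPair κ * annihilate φ = annihilate φ * createPair κ + create (antiContract φ κ) := by
  ext f
  refine HilbertTensor.eq_of_tmul (S := fun κ => (createPair κ * annihilate φ) f)
    (T := fun κ => (annihilate φ * createPair κ + create (antiContract φ κ)) f)
    (continuous_createPair _)
    (((annihilate φ).continuous.comp (continuous_createPair f)).add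
      ((continuous_create f).comp (antiContract φ).continuous)) ?_ ?_ ?_ κ
  · intro x y
    rw [createPair_add, add_mul, add_apply]
  · intro x y
    rw [createPair_add, mul_add, map_add, create_add]
    simp only [add_apply]
    abel
  · intro a b
    rw [createPair_tmul, antiContract_tmul, create_sub, create_smul, create_smul, ← mul_assoc,
      annihilate_mul_create, sub_mul, mul_assoc (create a), mul_assoc (create a),
      annihilate_mul_create, mul_sub, smul_mul_assoc, mul_smul_comm, one_mul, mul_one]
    congr 1
    abel

theorem annihilatePair_mul_create (κ : HilbertTensor G G) (φ : G) :
    annihilatePair κ * create φ =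
      create φ * annihilatePair κ - annihilate (antiContract φ κ) := by
  ext f
  refine HilbertTensor.eq_of_tmul (S := fun κ => (annihilatePair κ * create φ) f)
    (T := fun κ => (create φ * annihilatePair κ - annihilate (antiContract φ κ)) f)
    (continuous_annihilatePair _)
    (((create φ).continuous.comp (continuous_annihilatePair f)).sub
      ((continuous_annihilate f).comp (antiContract φ).continuous)) ?_ ?_ ?_ κ
  · intro x y
    rw [annihilatePair_add, add_mul, add_apply]
  · intro x y
    rw [annihilatePair_add, mul_add, map_add, annihilate_add]
    simp only [add_apply, sub_apply]
    abel
  · intro a b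
    rw [annihilatePair_tmul, antiContract_tmul, annihilate_sub, annihilate_smul, annihilate_smul,
      mul_assoc, annihilate_mul_create, mul_sub, ← mul_assoc, annihilate_mul_create, sub_mul,
      smul_mul_assoc, mul_smul_comm, one_mul, mul_one, mul_assoc]
    have h1 : star ⟪φ, a⟫ = ⟪a, φ⟫ := inner_conj_symm _ _
    have h2 : star ⟪φ, b⟫ = ⟪b, φ⟫ := inner_conj_symm _ _
    rw [h1, h2]
    congr 1
    abel

end PairOperators

section Estimates

/-! ### Square function estimates for creation and annihilation operators -/

/-- If `g ↦ ∑ k, T k (g k)` is bounded by `C` in square mean, then so is its adjoint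
`f ↦ ((T k)* f)_k`. -/
theorem sum_sq_norm_adjoint_le {ι : Type*} {H H' : Type*} [NormedAddCommGroup H]
    [InnerProductSpace ℂ H] [CompleteSpace H] [NormedAddCommGroup H'] [InnerProductSpace ℂ H']
    [CompleteSpace H'] (T : ι → H →L[ℂ] H') (C : ℝ) (s : Finset ι)
    (hT : ∀ g : ι → H, ‖∑ k ∈ s, T k (g k)‖ ^ 2 ≤ C ^ 2 * ∑ k ∈ s, ‖g k‖ ^ 2) (f : H') :
    ∑ k ∈ s, ‖(T k).adjoint f‖ ^ 2 ≤ C ^ 2 * ‖f‖ ^ 2 := by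
  set S := ∑ k ∈ s, ‖(T k).adjoint f‖ ^ 2 with hS
  have hS0 : 0 ≤ S := Finset.sum_nonneg fun _ _ => by positivity
  have h1 : (S : ℂ) = ⟪f, ∑ k ∈ s, T k ((T k).adjoint f)⟫ := by
    rw [inner_sum, hS, Complex.ofReal_sum]
    refine Finset.sum_congr rfl fun k _ => ?_
    rw [← ContinuousLinearMap.adjoint_inner_left, inner_self_eq_norm_sq_to_K]
    norm_cast
  have h2 : S ≤ ‖f‖ * ‖∑ k ∈ s, T k ((T k).adjoint f)‖ := by
    have := norm_inner_le_norm (𝕜 := ℂ) f (∑ k ∈ s, T k ((T k).adjoint f))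
    rw [← h1, Complex.norm_real] at this
    exact (le_abs_self _).trans this
  have h3 : S ^ 2 ≤ ‖f‖ ^ 2 * (C ^ 2 * S) := by
    calc S ^ 2 ≤ (‖f‖ * ‖∑ k ∈ s, T k ((T k).adjoint f)‖) ^ 2 := by gcongr
      _ = ‖f‖ ^ 2 * ‖∑ k ∈ s, T k ((T k).adjoint f)‖ ^ 2 := by ring
      _ ≤ ‖f‖ ^ 2 * (C ^ 2 * S) := by
        gcongr
        exact hT fun k => (T k).adjoint f
  rcases hS0.eq_or_lt with h | h
  · rw [← h]
    positivity
  · nlinarith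

variable {E G : Type u} [NormedAddCommGroup E] [InnerProductSpace ℂ E]
  [NormedAddCommGroup G] [InnerProductSpace ℂ G] {ι : Type*}

/-- A square function bound for `∑ k, A e_k ⊗ g_k`: this is the image under `A ⊗ 1` of the sum
`∑ k, e_k ⊗ g_k` of pairwise orthogonal vectors. -/
theorem norm_sum_tmul_sq_le {F : Type u} [NormedAddCommGroup F] [InnerProductSpace ℂ F]
    {e : ι → E} (he : Orthonormal ℂ e) (A : E →L[ℂ] G) (s : Finset ι) (g : ι → F) :
    ‖∑ k ∈ s, (A (e k) ⊗ₜ[ℂ] g k : G ⊗[ℂ] F)‖ ^ 2 ≤ ‖A‖ ^ 2 * ∑ k ∈ s, ‖g k‖ ^ 2 := by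
  classical
  set z : E ⊗[ℂ] F := ∑ k ∈ s, e k ⊗ₜ[ℂ] g k with hz
  have h1 : ∑ k ∈ s, (A (e k) ⊗ₜ[ℂ] g k : G ⊗[ℂ] F) = A.rTensor F z := by
    rw [hz, map_sum]
    rfl
  have h3 : ‖z‖ ^ 2 = ∑ k ∈ s, ‖g k‖ ^ 2 := by
    have h4 : ((‖z‖ ^ 2 : ℝ) : ℂ) = ((∑ k ∈ s, ‖g k‖ ^ 2 : ℝ) : ℂ) := by
      push_cast
      refine (inner_self_eq_norm_sq_to_K (𝕜 := ℂ) z).symm.trans ?_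
      rw [hz, sum_inner]
      refine Finset.sum_congr rfl fun k hk => ?_
      rw [inner_sum, Finset.sum_eq_single k]
      · rw [TensorProduct.inner_tmul, inner_self_eq_norm_sq_to_K, he.1 k,
          inner_self_eq_norm_sq_to_K]
        simp
      · intro l _ hl
        rw [TensorProduct.inner_tmul, he.2 (Ne.symm hl), zero_mul]
      · exact fun h => absurd hk h
    exact_mod_cast h4
  rw [h1, ← h3, ← mul_pow]
  gcongr
  exact ((A.rTensor F).le_opNorm z).trans
    (mul_le_mul_of_nonneg_right (ContinuousLinearMap.norm_rTensor_le _ A) (norm_nonneg _))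

theorem norm_sum_tmulL_sq_le {e : ι → E} (he : Orthonormal ℂ e) (A : E →L[ℂ] G) (n : ℕ)
    (s : Finset ι) (g : ι → TensorPow G n) :
    ‖∑ k ∈ s, tmulL n (A (e k)) (g k)‖ ^ 2 ≤ ‖A‖ ^ 2 * ∑ k ∈ s, ‖g k‖ ^ 2 := by
  refine le_trans (le_of_eq ?_) (norm_sum_tmul_sq_le he A s g)
  congr 1
  exact (congrArg norm (map_sum (Completion.toComplL (𝕜 := ℂ) (E := G ⊗[ℂ] TensorPow G n))
    (fun k => A (e k) ⊗ₜ[ℂ] g k) s).symm).trans (Completion.norm_coe _)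

theorem norm_sum_createN_sq_le {e : ι → E} (he : Orthonormal ℂ e) (A : E →L[ℂ] G) (n : ℕ)
    (s : Finset ι) (g : ι → AntisymPow G n) :
    ‖∑ k ∈ s, createN (A (e k)) n (g k)‖ ^ 2 ≤ ‖A‖ ^ 2 * ∑ k ∈ s, ‖g k‖ ^ 2 := by
  have h1 : ∑ k ∈ s, createN (A (e k)) n (g k) =
      antisymmetrize (n + 1) (∑ k ∈ s, tmulL n (A (e k)) (g k : TensorPow G n)) := by
    rw [map_sum]
    rfl
  rw [h1]
  refine le_trans ?_ (norm_sum_tmulL_sq_le he A n s fun k => (g k : TensorPow G n))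
  gcongr
  exact norm_antisymmetrize_le _ _

theorem sum_annihilateN_sq_le {e : ι → E} (he : Orthonormal ℂ e) (A : E →L[ℂ] G) (n : ℕ)
    (s : Finset ι) (f : AntisymPow G n) :
    ∑ k ∈ s, ‖annihilateN (A (e k)) n f‖ ^ 2 ≤ n ^ 2 * ‖A‖ ^ 2 * ‖f‖ ^ 2 := by
  cases n with
  | zero =>
    refine le_trans (Finset.sum_nonpos fun k _ => ?_) (by positivity)
    change ‖(0 : AntisymPow G 0)‖ ^ 2 ≤ 0
    simp
  | succ n =>
    have h1 := sum_sq_norm_adjoint_le (fun k => createN (A (e k)) n) ‖A‖ s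
      (norm_sum_createN_sq_le he A n s) f
    have h2 (k : ι) : ‖annihilateN (A (e k)) (n + 1) f‖ ^ 2 =
        ((n + 1 : ℕ) : ℝ) ^ 2 * ‖(createN (A (e k)) n).adjoint f‖ ^ 2 := by
      change ‖((n + 1 : ℕ) : ℂ) • (createN (A (e k)) n).adjoint f‖ ^ 2 = _
      rw [norm_smul, mul_pow, Complex.norm_natCast]
    simp only [h2]
    rw [← Finset.mul_sum, mul_assoc]
    gcongr

theorem norm_createN_le (φ : G) (n : ℕ) : ‖createN φ n‖ ≤ ‖φ‖ := by
  refine ContinuousLinearMap.opNorm_le_bound _ (norm_nonneg _) fun g => ?_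
  exact (norm_antisymmetrize_le _ _).trans (norm_tmulL n φ _).le

theorem norm_annihilateN_le (φ : G) (n : ℕ) : ‖annihilateN φ n‖ ≤ n * ‖φ‖ := by
  cases n with
  | zero =>
    exact (norm_zero (E := AntisymPow G 0 →L[ℂ] AntisymPow G 0)).le.trans (by positivity)
  | succ n =>
    change ‖((n + 1 : ℕ) : ℂ) • (createN φ n).adjoint‖ ≤ _
    rw [norm_smul, Complex.norm_natCast, LinearIsometryEquiv.norm_map]
    gcongr
    exact norm_createN_le φ n

theorem norm_sum_apply_sq_le {H H' : Type*} [NormedAddCommGroup H] [InnerProductSpace ℂ H]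
    [NormedAddCommGroup H'] [InnerProductSpace ℂ H'] (T : ι → H →L[ℂ] H') (s : Finset ι)
    (g : ι → H) : ‖∑ k ∈ s, T k (g k)‖ ^ 2 ≤ (∑ k ∈ s, ‖T k‖ ^ 2) * ∑ k ∈ s, ‖g k‖ ^ 2 := by
  refine le_trans ?_ (Finset.sum_mul_sq_le_sq_mul_sq s (fun k => ‖T k‖) fun k => ‖g k‖)
  gcongr
  exact (norm_sum_le _ _).trans (Finset.sum_le_sum fun k _ => (T k).le_opNorm _)

/-- Square function estimates on the particle-number spaces give one on the Fock space. The weights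
`2 ^ n` compensate for exchanging a sum of square functions with a square function of sums. -/
theorem exists_wnorm_sum_sq_le (σ : ℕ → ℕ) (C : ℕ → NNReal) (c : ℕ → NNReal) :
    ∃ d : ℕ → NNReal, ∀ (T : ι → FockOp G) (T' : ι → ∀ n, AntisymPow G n →L[ℂ] AntisymPow G (σ n)),
      (∀ k n g, T k (FockFin.of n g) = FockFin.of (σ n) (T' k n g)) →
      (∀ n (s : Finset ι) (g : ι → AntisymPow G n),
        ‖∑ k ∈ s, T' k n (g k)‖ ^ 2 ≤ (C n : ℝ) ^ 2 * ∑ k ∈ s, ‖g k‖ ^ 2) →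
      ∀ (s : Finset ι) (v : ι → FockFin G),
        FockFin.wnorm c (∑ k ∈ s, T k (v k)) ^ 2 ≤ ∑ k ∈ s, FockFin.wnorm d (v k) ^ 2 := by
  refine ⟨fun n => 2 * (2 ^ n * (c (σ n) * C n)), fun T T' hT hC s v => ?_⟩
  choose M hM hM' using fun k => FockFin.exists_eq_sum (v k)
  obtain ⟨N, hN⟩ : ∃ N, ∀ k ∈ s, M k ≤ N := ⟨s.sup M, fun k hk => Finset.le_sup hk⟩
  have h1 : ∑ k ∈ s, T k (v k) =
      ∑ n ∈ Finset.range N, FockFin.of (σ n) (∑ k ∈ s, T' k n (FockFin.coord n (v k))) := by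
    simp only [map_sum]
    rw [Finset.sum_comm]
    refine Finset.sum_congr rfl fun k hk => ?_
    conv_lhs => rw [hM' k N (hN k hk), map_sum]
    exact Finset.sum_congr rfl fun n _ => hT k n _
  set S : ℕ → ℝ := fun n => ∑ k ∈ s, ‖FockFin.coord n (v k)‖ ^ 2 with hS
  have hS0 (n : ℕ) : 0 ≤ S n := Finset.sum_nonneg fun _ _ => by positivity
  set D : ℕ → ℝ := fun n => (c (σ n) * C n : ℝ) with hD
  have hD0 (n : ℕ) : 0 ≤ D n := by positivity
  have h2 : FockFin.wnorm c (∑ k ∈ s, T k (v k)) ≤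
      ∑ n ∈ Finset.range N, (1 / 2 : ℝ) ^ n * (2 ^ n * (D n * √(S n))) := by
    rw [h1]
    refine (Finset.le_sum_of_subadditive (FockFin.wnorm c) (map_zero _).le (map_add_le_add _)
      _ _).trans (Finset.sum_le_sum fun n _ => ?_)
    have h5 : (1 / 2 : ℝ) * 2 = 1 := by norm_num
    rw [FockFin.wnorm_of, ← mul_assoc, ← mul_pow, h5, one_pow, one_mul, hD, mul_assoc]
    gcongr
    refine le_of_sq_le_sq ?_ (by positivity)
    rw [mul_pow, Real.sq_sqrt (hS0 n)]
    exact hC n s _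
  have h3 : ∑ n ∈ Finset.range N, ((1 / 2 : ℝ) ^ n) ^ 2 ≤ 4 := by
    have h4 : ∀ n, ((1 / 2 : ℝ) ^ n) ^ 2 = (1 / 4 : ℝ) ^ n := fun n => by
      rw [← pow_mul, mul_comm, pow_mul]; norm_num
    simp only [h4]
    rw [geom_sum_eq (by norm_num), div_le_iff_of_neg (by norm_num)]
    have : (0 : ℝ) ≤ (1 / 4) ^ N := by positivity
    linarith
  calc FockFin.wnorm c (∑ k ∈ s, T k (v k)) ^ 2
      ≤ (∑ n ∈ Finset.range N, (1 / 2 : ℝ) ^ n * (2 ^ n * (D n * √(S n)))) ^ 2 := by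
        gcongr
    _ ≤ (∑ n ∈ Finset.range N, ((1 / 2 : ℝ) ^ n) ^ 2) *
        ∑ n ∈ Finset.range N, (2 ^ n * (D n * √(S n))) ^ 2 := Finset.sum_mul_sq_le_sq_mul_sq _ _ _
    _ ≤ 4 * ∑ n ∈ Finset.range N, (2 ^ n * (D n * √(S n))) ^ 2 := by
        gcongr
    _ = ∑ k ∈ s, ∑ n ∈ Finset.range N, (2 * (2 ^ n * D n) * ‖FockFin.coord n (v k)‖) ^ 2 := by
        rw [Finset.sum_comm, Finset.mul_sum]
        refine Finset.sum_congr rfl fun n _ => ?_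
        simp only [mul_pow, Real.sq_sqrt (hS0 n), ← Finset.mul_sum]
        ring
    _ ≤ ∑ k ∈ s, (∑ n ∈ Finset.range N, 2 * (2 ^ n * D n) * ‖FockFin.coord n (v k)‖) ^ 2 := by
        refine Finset.sum_le_sum fun k _ => Finset.sum_sq_le_sq_sum_of_nonneg fun n _ => ?_
        have := hD0 n
        positivity
    _ ≤ _ := by
        refine Finset.sum_le_sum fun k _ => ?_
        refine pow_le_pow_left₀ (Finset.sum_nonneg fun n _ => ?_) ?_ 2
        · have := hD0 n
          positivity
        · refine le_trans (le_of_eq ?_) (FockFin.sum_range_le_wnorm _ (v k) N)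
          refine Finset.sum_congr rfl fun n _ => ?_
          simp [hD]

end Estimates

section Convergence

variable {G : Type u} [NormedAddCommGroup G] [InnerProductSpace ℂ G] {ι : Type*}

/-! ### Convergence of operator-valued series -/

theorem Seminorm.add_sq_le {V : Type*} [AddCommGroup V] [Module ℂ V] (p : Seminorm ℂ V) (x y : V) :
    p (x + y) ^ 2 ≤ 2 * p x ^ 2 + 2 * p y ^ 2 := by
  have h1 := map_add_le_add p x y
  have h2 : p (x + y) ^ 2 ≤ (p x + p y) ^ 2 := by
    gcongr
  nlinarith [sq_nonneg (p x - p y)]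

/-- The row of operators `v ↦ ∑ k, T k (v k)` is bounded in square mean from the seminorm with
weights `d` to the one with weights `c`. -/
def IsRowBounded (T : ι → FockOp G) (c d : ℕ → NNReal) : Prop :=
  ∀ (s : Finset ι) (v : ι → FockFin G),
    FockFin.wnorm c (∑ k ∈ s, T k (v k)) ^ 2 ≤ ∑ k ∈ s, FockFin.wnorm d (v k) ^ 2

theorem IsRowBounded.add {T T' : ι → FockOp G} {c d d' : ℕ → NNReal} (h : IsRowBounded T c d)
    (h' : IsRowBounded T' c d') :
    IsRowBounded (fun k => T k + T' k) c ((2 : NNReal) • (d + d')) := by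
  intro s v
  simp only [add_apply, Finset.sum_add_distrib]
  refine (Seminorm.add_sq_le _ _ _).trans ?_
  refine (add_le_add (mul_le_mul_of_nonneg_left (h s v) zero_le_two)
    (mul_le_mul_of_nonneg_left (h' s v) zero_le_two)).trans ?_
  rw [Finset.mul_sum, Finset.mul_sum, ← Finset.sum_add_distrib]
  refine Finset.sum_le_sum fun k _ => ?_
  rw [FockFin.wnorm_smul_index, FockFin.wnorm_add_index]
  have h1 : 0 ≤ FockFin.wnorm d (v k) := apply_nonneg _ _
  have h2 : 0 ≤ FockFin.wnorm d' (v k) := apply_nonneg _ _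
  push_cast
  nlinarith [mul_nonneg h1 h2]

theorem IsRowBounded.of_tendsto {α : Type*} {l : Filter α} [l.NeBot] {Ta : α → ι → FockOp G}
    {T : ι → FockOp G} {c d : ℕ → NNReal} (h : ∀ a, IsRowBounded (Ta a) c d)
    (hT : ∀ k v, Tendsto (fun a => Ta a k v) l (𝓝 (T k v))) : IsRowBounded T c d := by
  intro s v
  have h1 : Tendsto (fun a => FockFin.wnorm c (∑ k ∈ s, Ta a k (v k)) ^ 2) l
      (𝓝 (FockFin.wnorm c (∑ k ∈ s, T k (v k)) ^ 2)) :=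
    (((FockFin.continuous_wnorm c).tendsto _).comp (tendsto_finsetSum s fun k _ => hT k (v k))).pow 2
  exact le_of_tendsto h1 (Eventually.of_forall fun a => h a s v)

theorem exists_sum_disjoint_lt {f : ι → ℝ} (hf : Summable f) (ε : ℝ) (hε : 0 < ε) :
    ∃ s : Finset ι, ∀ t, Disjoint t s → ∑ k ∈ t, f k < ε := by
  obtain ⟨s, hs⟩ := summable_iff_vanishing_norm.1 hf ε hε
  exact ⟨s, fun t ht => (le_abs_self _).trans_lt (hs t ht)⟩

/-- A row of operators, bounded in square mean, can be summed against a square summable family of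
vectors. -/
theorem IsRowBounded.exists_hasSum {T : ι → FockOp G} {y : ι → FockFin G}
    (hT : ∀ c, ∃ d, IsRowBounded T c d)
    (hy : ∀ d, Summable fun k => FockFin.wnorm d (y k) ^ 2) : ∃ x, HasSum (fun k => T k (y k)) x := by
  classical
  refine FockFin.exists_tendsto_of_cauchy fun c ε hε => ?_
  obtain ⟨d, hd⟩ := hT c
  obtain ⟨s, hs⟩ := exists_sum_disjoint_lt (hy d) ((ε / 2) ^ 2) (by positivity)
  have key (t : Finset ι) (ht : Disjoint t s) : FockFin.wnorm c (∑ k ∈ t, T k (y k)) ≤ ε / 2 :=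
    le_of_sq_le_sq ((hd t y).trans (hs t ht).le) (by positivity)
  refine ⟨_, mem_atTop s, fun a ha b hb => ?_⟩
  have h1 : ∑ k ∈ a, T k (y k) - ∑ k ∈ b, T k (y k) =
      ∑ k ∈ a \ b, T k (y k) - ∑ k ∈ b \ a, T k (y k) := by
    rw [← Finset.sum_sdiff_sub_sum_sdiff]
  have ha' : s ⊆ a := ha
  have hb' : s ⊆ b := hb
  rw [h1]
  refine (map_sub_le_add _ _ _).trans ?_
  have h2 := key (a \ b) (Finset.disjoint_of_subset_right hb' Finset.sdiff_disjoint)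
  have h3 := key (b \ a) (Finset.disjoint_of_subset_right ha' Finset.sdiff_disjoint)
  linarith

theorem IsRowBounded.wnorm_hasSum_sq_le {T : ι → FockOp G} {y : ι → FockFin G} {c d : ℕ → NNReal}
    (hT : IsRowBounded T c d) {M : ℝ} (hM : ∀ s : Finset ι, ∑ k ∈ s, FockFin.wnorm d (y k) ^ 2 ≤ M)
    {x : FockFin G} (hx : HasSum (fun k => T k (y k)) x) : FockFin.wnorm c x ^ 2 ≤ M := by
  have h1 : Tendsto (fun s : Finset ι => FockFin.wnorm c (∑ k ∈ s, T k (y k)) ^ 2) atTop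
      (𝓝 (FockFin.wnorm c x ^ 2)) :=
    (((FockFin.continuous_wnorm c).tendsto _).comp hx).pow 2
  exact le_of_tendsto h1 (Eventually.of_forall fun s => (hT s y).trans (hM s))

/-- Joint continuity of `∑ k, T k (y k)` in `T` and `y`: if the operators converge pointwise with
uniform square function bounds, and the vectors converge in square mean, then the sums converge. -/
theorem tendsto_hasSum_of_isRowBounded {α β : Type*} {la : Filter α} {lb : Filter β} [la.NeBot]
    {Ta : α → ι → FockOp G} {T : ι → FockOp G} {yb : β → ι → FockFin G} {y : ι → FockFin G}
    (hTa : ∀ c, ∃ d, ∀ a, IsRowBounded (Ta a) c d)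
    (hT : ∀ k v, Tendsto (fun a => Ta a k v) la (𝓝 (T k v)))
    (hy : ∀ d, Summable fun k => FockFin.wnorm d (y k) ^ 2)
    (hyb : ∀ d, ∀ ε > 0, ∀ᶠ b in lb, ∀ s : Finset ι,
      ∑ k ∈ s, FockFin.wnorm d (yb b k - y k) ^ 2 ≤ ε)
    {x : FockFin G} (hx : HasSum (fun k => T k (y k)) x) {z : α × β → FockFin G}
    (hz : ∀ a b, HasSum (fun k => Ta a k (yb b k)) (z (a, b))) :
    Tendsto z (la ×ˢ lb) (𝓝 x) := by
  classical
  refine FockFin.tendsto_iff.2 fun c ε hε => ?_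
  obtain ⟨d, hd⟩ := hTa c
  have hdT : IsRowBounded T c d := IsRowBounded.of_tendsto hd hT
  -- the error is split into four parts of size `η`; a fifth one makes the bound strict
  set η := ε / 5 with hη
  have hη0 : 0 < η := by positivity
  obtain ⟨s, hs⟩ := exists_sum_disjoint_lt (hy d) (η ^ 2) (by positivity)
  have h1 : ∀ᶠ a in la, FockFin.wnorm c (∑ k ∈ s, (Ta a k (y k) - T k (y k))) < η := by
    have h : Tendsto (fun a => ∑ k ∈ s, Ta a k (y k)) la (𝓝 (∑ k ∈ s, T k (y k))) :=
      tendsto_finsetSum s fun k _ => hT k (y k)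
    filter_upwards [FockFin.tendsto_iff.1 h c η hη0] with a ha
    rwa [Finset.sum_sub_distrib]
  have h2 := hyb d (η ^ 2) (by positivity)
  filter_upwards [h1.prod_mk h2] with ⟨a, b⟩ ⟨ha, hb⟩
  refine lt_of_le_of_lt (b := 4 * η) ?_ (by rw [hη]; linarith)
  have ht : Tendsto (fun t : Finset ι => FockFin.wnorm c
      (∑ k ∈ t, Ta a k (yb b k) - ∑ k ∈ t, T k (y k))) atTop
      (𝓝 (FockFin.wnorm c (z (a, b) - x))) :=
    ((FockFin.continuous_wnorm c).tendsto _).comp (Tendsto.sub (hz a b) hx)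
  refine le_of_tendsto ht ?_
  filter_upwards [eventually_ge_atTop s] with t hst
  have hst' : s ⊆ t := hst
  have h3 : ∑ k ∈ t, Ta a k (yb b k) - ∑ k ∈ t, T k (y k) =
      ∑ k ∈ t, Ta a k (yb b k - y k) + ∑ k ∈ s, (Ta a k (y k) - T k (y k)) +
        ∑ k ∈ t \ s, Ta a k (y k) - ∑ k ∈ t \ s, T k (y k) := by
    rw [← Finset.sum_sdiff hst' (f := fun k => T k (y k))]
    simp only [map_sub, Finset.sum_sub_distrib]
    rw [← Finset.sum_sdiff hst' (f := fun k => Ta a k (y k))]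
    abel
  have h4 : FockFin.wnorm c (∑ k ∈ t, Ta a k (yb b k - y k)) ≤ η :=
    le_of_sq_le_sq ((hd a t _).trans (hb t)) hη0.le
  have h5 : FockFin.wnorm c (∑ k ∈ t \ s, Ta a k (y k)) ≤ η :=
    le_of_sq_le_sq ((hd a _ y).trans (hs _ Finset.sdiff_disjoint).le) hη0.le
  have h6 : FockFin.wnorm c (∑ k ∈ t \ s, T k (y k)) ≤ η :=
    le_of_sq_le_sq ((hdT _ y).trans (hs _ Finset.sdiff_disjoint).le) hη0.le
  -- each of the four parts of the decomposition `h3` is at most `η`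
  rw [h3]
  have h7 := map_sub_le_add (FockFin.wnorm c) (∑ k ∈ t, Ta a k (yb b k - y k) +
    ∑ k ∈ s, (Ta a k (y k) - T k (y k)) + ∑ k ∈ t \ s, Ta a k (y k)) (∑ k ∈ t \ s, T k (y k))
  have h8 := map_add_le_add (FockFin.wnorm c) (∑ k ∈ t, Ta a k (yb b k - y k) +
    ∑ k ∈ s, (Ta a k (y k) - T k (y k))) (∑ k ∈ t \ s, Ta a k (y k))
  have h9 := map_add_le_add (FockFin.wnorm c) (∑ k ∈ t, Ta a k (yb b k - y k))
    (∑ k ∈ s, (Ta a k (y k) - T k (y k)))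
  linarith

/-! ### Square function bounds of the field operators -/

variable {E : Type u} [NormedAddCommGroup E] [InnerProductSpace ℂ E]

theorem exists_isRowBounded_create {e : ι → E} (he : Orthonormal ℂ e) (C : NNReal)
    (c : ℕ → NNReal) :
    ∃ d, ∀ A : E →L[ℂ] G, ‖A‖ ≤ C → IsRowBounded (fun k => create (A (e k))) c d := by
  obtain ⟨d, hd⟩ := exists_wnorm_sum_sq_le (G := G) (ι := ι) (fun n => n + 1) (fun _ => C) c
  refine ⟨d, fun A hA => hd _ (fun k n => createN (A (e k)) n) (fun k n g => create_of _ n g) ?_⟩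
  intro n s g
  refine (norm_sum_createN_sq_le he A n s g).trans ?_
  gcongr

theorem exists_isRowBounded_annihilate (C : NNReal) (c : ℕ → NNReal) :
    ∃ d, ∀ h : ι → G, (∀ s : Finset ι, ∑ k ∈ s, ‖h k‖ ^ 2 ≤ C) →
      IsRowBounded (fun k => annihilate (h k)) c d := by
  obtain ⟨d, hd⟩ := exists_wnorm_sum_sq_le (G := G) (ι := ι) (fun n => n - 1)
    (fun n => n * NNReal.sqrt C) c
  refine ⟨d, fun h hh => hd _ (fun k n => annihilateN (h k) n)
    (fun k n g => annihilate_of _ n g) ?_⟩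
  intro n s g
  refine (norm_sum_apply_sq_le (fun k => annihilateN (h k) n) s g).trans ?_
  gcongr
  push_cast
  rw [mul_pow, Real.sq_sqrt C.coe_nonneg]
  refine le_trans ?_ (mul_le_mul_of_nonneg_left (hh s) (by positivity))
  rw [Finset.mul_sum]
  refine Finset.sum_le_sum fun k _ => ?_
  rw [← mul_pow]
  gcongr
  exact norm_annihilateN_le _ _

theorem sum_wnorm_annihilate_sq_le {e : ι → E} (he : Orthonormal ℂ e) (A : E →L[ℂ] G)
    (c : ℕ → NNReal) (n : ℕ) (g : AntisymPow G n) (s : Finset ι) :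
    ∑ k ∈ s, FockFin.wnorm c (annihilate (A (e k)) (FockFin.of n g)) ^ 2 ≤
      (c (n - 1) * n * ‖A‖) ^ 2 * ‖g‖ ^ 2 := by
  simp only [annihilate_of, FockFin.wnorm_of, mul_pow]
  rw [← Finset.mul_sum, mul_assoc, mul_assoc]
  gcongr
  rw [← mul_assoc]
  exact sum_annihilateN_sq_le he A n s g

theorem sum_wnorm_create_sq_le (h : ι → G) (c : ℕ → NNReal) (n : ℕ) (g : AntisymPow G n)
    (s : Finset ι) :
    ∑ k ∈ s, FockFin.wnorm c (create (h k) (FockFin.of n g)) ^ 2 ≤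
      (c (n + 1) ^ 2 * ∑ k ∈ s, ‖h k‖ ^ 2) * ‖g‖ ^ 2 := by
  simp only [create_of, FockFin.wnorm_of, mul_pow]
  rw [← Finset.mul_sum, mul_assoc]
  gcongr
  rw [Finset.sum_mul]
  refine Finset.sum_le_sum fun k _ => ?_
  rw [← mul_pow]
  gcongr
  exact (createN (h k) n).le_of_opNorm_le (norm_createN_le _ _) g

end Convergence

section FieldSeries

variable {G : Type u} [NormedAddCommGroup G] [InnerProductSpace ℂ G] {ι : Type*}

/-! ### Square mean convergence -/

/-- The families `yb b` of vectors converge to the family `y` in square mean. -/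
def SqTendsto {β : Type*} (l : Filter β) (yb : β → ι → FockFin G) (y : ι → FockFin G) : Prop :=
  ∀ d, ∀ ε > 0, ∀ᶠ b in l, ∀ s : Finset ι, ∑ k ∈ s, FockFin.wnorm d (yb b k - y k) ^ 2 ≤ ε

theorem sum_wnorm_add_sq_le (d : ℕ → NNReal) (s : Finset ι) (y z : ι → FockFin G) :
    ∑ k ∈ s, FockFin.wnorm d (y k + z k) ^ 2 ≤
      2 * ∑ k ∈ s, FockFin.wnorm d (y k) ^ 2 + 2 * ∑ k ∈ s, FockFin.wnorm d (z k) ^ 2 := by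
  rw [Finset.mul_sum, Finset.mul_sum, ← Finset.sum_add_distrib]
  exact Finset.sum_le_sum fun k _ => Seminorm.add_sq_le _ _ _

theorem SqTendsto.add {β : Type*} {l : Filter β} {yb zb : β → ι → FockFin G}
    {y z : ι → FockFin G} (hy : SqTendsto l yb y) (hz : SqTendsto l zb z) :
    SqTendsto l (fun b k => yb b k + zb b k) fun k => y k + z k := by
  intro d ε hε
  filter_upwards [hy d (ε / 4) (by positivity), hz d (ε / 4) (by positivity)] with b h1 h2 s
  simp only [add_sub_add_comm]
  refine (sum_wnorm_add_sq_le d s _ _).trans ?_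
  linarith [h1 s, h2 s]

theorem SqTendsto.map {β : Type*} {l : Filter β} {yb : β → ι → FockFin G}
    {y : ι → FockFin G} (hy : SqTendsto l yb y) (R : FockOp G) :
    SqTendsto l (fun b k => R (yb b k)) fun k => R (y k) := by
  intro d ε hε
  obtain ⟨d', hd'⟩ := FockFin.exists_wnorm_apply_le R d
  filter_upwards [hy d' ε hε] with b h1 s
  refine (Finset.sum_le_sum fun k _ => ?_).trans (h1 s)
  rw [← map_sub]
  gcongr
  exact hd' _

/-- Square summability, for all continuous seminorms. -/
def SqSummable (y : ι → FockFin G) : Prop := ∀ d, Summable fun k => FockFin.wnorm d (y k) ^ 2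

theorem SqSummable.add {y z : ι → FockFin G} (hy : SqSummable y) (hz : SqSummable z) :
    SqSummable fun k => y k + z k := fun d =>
  Summable.of_nonneg_of_le (fun _ => by positivity) (fun _ => Seminorm.add_sq_le _ _ _)
    (((hy d).mul_left 2).add ((hz d).mul_left 2))

theorem SqSummable.map {y : ι → FockFin G} (hy : SqSummable y) (R : FockOp G) :
    SqSummable fun k => R (y k) := fun d => by
  obtain ⟨d', hd'⟩ := FockFin.exists_wnorm_apply_le R d
  refine Summable.of_nonneg_of_le (fun _ => by positivity) (fun k => ?_) (hy d')
  gcongr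
  exact hd' _

variable {E : Type u} [NormedAddCommGroup E] [InnerProductSpace ℂ E]

theorem sqSummable_annihilate {e : ι → E} (he : Orthonormal ℂ e) (A : E →L[ℂ] G) (f : FockFin G) :
    SqSummable fun k => annihilate (A (e k)) f := by
  refine FockFin.induction (p := fun f => SqSummable fun k => annihilate (A (e k)) f) f ?_ ?_ ?_
  · intro d
    simp [summable_zero]
  · intro x y hx hy
    simp only [map_add]
    exact hx.add hy
  · intro n g d
    exact summable_of_sum_le (fun _ => by positivity) (sum_wnorm_annihilate_sq_le he A d n g)

theorem sqSummable_create {h : ι → G} (hh : Summable fun k => ‖h k‖ ^ 2) (f : FockFin G) :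
    SqSummable fun k => create (h k) f := by
  refine FockFin.induction (p := fun f => SqSummable fun k => create (h k) f) f ?_ ?_ ?_
  · intro d
    simp [summable_zero]
  · intro x y hx hy
    simp only [map_add]
    exact hx.add hy
  · intro n g d
    refine summable_of_sum_le (c := (d (n + 1) ^ 2 * ∑' k, ‖h k‖ ^ 2) * ‖g‖ ^ 2)
      (fun _ => by positivity) fun s => (sum_wnorm_create_sq_le h d n g s).trans ?_
    gcongr
    exact hh.sum_le_tsum s fun _ _ => by positivity

theorem sqTendsto_create {β : Type*} {l : Filter β} {h : ι → G}
    (hh : Summable fun k => ‖h k‖ ^ 2) {Q : β → G →L[ℂ] G} (hQ : ∀ b, ‖Q b‖ ≤ 1)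
    (hQt : ∀ x, Tendsto (fun b => Q b x) l (𝓝 x)) (f : FockFin G) :
    SqTendsto l (fun b k => create (Q b (h k)) f) fun k => create (h k) f := by
  refine FockFin.induction (p := fun f => SqTendsto l (fun b k => create (Q b (h k)) f)
    fun k => create (h k) f) f ?_ ?_ ?_
  · intro d ε hε
    refine Eventually.of_forall fun b s => ?_
    simpa using hε.le
  · intro x y hx hy
    simp only [map_add]
    exact hx.add hy
  · intro n g d ε hε
    have h1 (b : β) (k : ι) : ‖Q b (h k) - h k‖ ^ 2 ≤ 4 * ‖h k‖ ^ 2 := by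
      have h2 : ‖Q b (h k)‖ ≤ 1 * ‖h k‖ := (Q b).le_of_opNorm_le (hQ b) _
      have h3 := norm_sub_le (Q b (h k)) (h k)
      calc ‖Q b (h k) - h k‖ ^ 2 ≤ (2 * ‖h k‖) ^ 2 := by
            gcongr
            linarith
        _ = _ := by ring
    have h2 : Tendsto (fun b => ∑' k, ‖Q b (h k) - h k‖ ^ 2) l (𝓝 (∑' _ : ι, 0)) := by
      refine tendsto_tsum_of_dominated_convergence (hh.mul_left 4) (fun k => ?_)
        (Eventually.of_forall fun b k => ?_)
      · have := (((hQt (h k)).sub_const (h k)).norm).pow 2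
        simpa using this
      · rw [Real.norm_of_nonneg (by positivity)]
        exact h1 b k
    rw [tsum_zero] at h2
    have h3 := (h2.const_mul ((d (n + 1) : ℝ) ^ 2)).mul_const (‖g‖ ^ 2)
    rw [mul_zero, zero_mul] at h3
    filter_upwards [h3.eventually_lt_const hε] with b hb s
    have h4 (k : ι) : create (Q b (h k)) (FockFin.of n g) - create (h k) (FockFin.of n g) =
        create (Q b (h k) - h k) (FockFin.of n g) := by
      rw [create_sub, sub_apply]
    simp only [h4]
    refine (sum_wnorm_create_sq_le _ d n g s).trans (le_trans ?_ hb.le)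
    gcongr
    exact (Summable.of_nonneg_of_le (fun _ => by positivity) (h1 b)
      (hh.mul_left 4)).sum_le_tsum s fun _ _ => by positivity

/-- If `B b` are uniformly bounded operators whose adjoints tend strongly to zero, then the
annihilation operators of `B b (e k)` tend to zero in square mean on the `n`-particle space. By the
uniform square function bound, it suffices to check this on wedge products. -/
theorem sqTendsto_annihilateN_zero [CompleteSpace E] [CompleteSpace G] {β : Type*} {l : Filter β}
    {e : ι → E} (he : Orthonormal ℂ e) {B : β → E →L[ℂ] G} {C : ℝ} (hB : ∀ b, ‖B b‖ ≤ C)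
    (hBt : ∀ x, Tendsto (fun b => (B b).adjoint x) l (𝓝 0)) (n : ℕ) (g : AntisymPow G n) :
    ∀ ε > 0, ∀ᶠ b in l, ∀ s : Finset ι, ∑ k ∈ s, ‖annihilateN (B b (e k)) n g‖ ^ 2 ≤ ε := by
  have hadd (b : β) (s : Finset ι) (x y : AntisymPow G n) :
      ∑ k ∈ s, ‖annihilateN (B b (e k)) n (x + y)‖ ^ 2 ≤
        2 * ∑ k ∈ s, ‖annihilateN (B b (e k)) n x‖ ^ 2 +
        2 * ∑ k ∈ s, ‖annihilateN (B b (e k)) n y‖ ^ 2 := by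
    rw [Finset.mul_sum, Finset.mul_sum, ← Finset.sum_add_distrib]
    refine Finset.sum_le_sum fun k _ => ?_
    rw [map_add]
    exact Seminorm.add_sq_le (normSeminorm ℂ _) _ _
  refine AntisymPow.induction_closed (p := fun g => ∀ ε > 0, ∀ᶠ b in l, ∀ s : Finset ι,
    ∑ k ∈ s, ‖annihilateN (B b (e k)) n g‖ ^ 2 ≤ ε) ?_ ?_ ?_ ?_ ?_ g
  · refine isClosed_of_closure_subset fun x hx ε hε => ?_
    have hM : 0 < (n : ℝ) ^ 2 * C ^ 2 + 1 := by positivity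
    obtain ⟨y, hy, hxy⟩ := Metric.mem_closure_iff.1 hx (√(ε / (4 * ((n : ℝ) ^ 2 * C ^ 2 + 1))))
      (by positivity)
    filter_upwards [hy (ε / 4) (by positivity)] with b hb s
    have h1 := hadd b s (x - y) y
    rw [sub_add_cancel] at h1
    have h2 := sum_annihilateN_sq_le he (B b) n s (x - y)
    rw [dist_eq_norm] at hxy
    have h3 : ‖x - y‖ ^ 2 ≤ ε / (4 * ((n : ℝ) ^ 2 * C ^ 2 + 1)) := by
      rw [← Real.sq_sqrt (show 0 ≤ ε / (4 * ((n : ℝ) ^ 2 * C ^ 2 + 1)) by positivity)]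
      gcongr
    have h4 : (n : ℝ) ^ 2 * ‖B b‖ ^ 2 * ‖x - y‖ ^ 2 ≤
        ((n : ℝ) ^ 2 * C ^ 2 + 1) * (ε / (4 * ((n : ℝ) ^ 2 * C ^ 2 + 1))) := by
      gcongr
      have : (n : ℝ) ^ 2 * ‖B b‖ ^ 2 ≤ (n : ℝ) ^ 2 * C ^ 2 := by
        gcongr
        exact hB b
      linarith
    have h5 : ((n : ℝ) ^ 2 * C ^ 2 + 1) * (ε / (4 * ((n : ℝ) ^ 2 * C ^ 2 + 1))) = ε / 4 := by
      field_simp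
    linarith [hb s]
  · intro ε hε
    refine Eventually.of_forall fun b s => ?_
    simpa using hε.le
  · intro x y hx hy ε hε
    filter_upwards [hx (ε / 4) (by positivity), hy (ε / 4) (by positivity)] with b h1 h2 s
    linarith [hadd b s x y, h1 s, h2 s]
  · intro c x hx ε hε
    filter_upwards [hx (ε / (‖c‖ ^ 2 + 1)) (by positivity)] with b hb s
    simp only [map_smul, norm_smul, mul_pow]
    rw [← Finset.mul_sum]
    calc ‖c‖ ^ 2 * ∑ k ∈ s, ‖annihilateN (B b (e k)) n x‖ ^ 2
        ≤ (‖c‖ ^ 2 + 1) * (ε / (‖c‖ ^ 2 + 1)) := by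
          gcongr
          · linarith
          · exact hb s
      _ = ε := by field_simp
  · intro v ε hε
    cases n with
    | zero =>
      refine Eventually.of_forall fun b s => ?_
      refine (Finset.sum_nonpos fun k _ => ?_).trans hε.le
      change ‖(0 : AntisymPow G 0)‖ ^ 2 ≤ 0
      simp
    | succ n =>
      have h1 (b : β) (s : Finset ι) :
          ∑ k ∈ s, ‖annihilateN (B b (e k)) (n + 1) (wedgeA (n + 1) v)‖ ^ 2 ≤
            ((n + 1 : ℕ) : ℝ) * ∑ i, ‖(B b).adjoint (v i)‖ ^ 2 *
              ‖wedgeA n (v ∘ i.succAbove)‖ ^ 2 := by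
        calc ∑ k ∈ s, ‖annihilateN (B b (e k)) (n + 1) (wedgeA (n + 1) v)‖ ^ 2
            ≤ ∑ k ∈ s, ((n + 1 : ℕ) : ℝ) * ∑ i, ‖⟪e k, (B b).adjoint (v i)⟫‖ ^ 2 *
              ‖wedgeA n (v ∘ i.succAbove)‖ ^ 2 := by
              refine Finset.sum_le_sum fun k _ => ?_
              rw [annihilateN_wedgeA]
              have h2 := sq_sum_le_card_mul_sum_sq (s := (Finset.univ : Finset (Fin (n + 1))))
                (f := fun i => ‖⟪e k, (B b).adjoint (v i)⟫‖ * ‖wedgeA n (v ∘ i.succAbove)‖)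
              simp only [mul_pow, Finset.card_univ, Fintype.card_fin] at h2
              refine le_trans ?_ h2
              gcongr
              refine (norm_sum_le _ _).trans (Finset.sum_le_sum fun i _ => ?_)
              rw [norm_smul, ContinuousLinearMap.adjoint_inner_right]
              simp
          _ ≤ _ := by
              rw [← Finset.mul_sum, Finset.sum_comm]
              gcongr with i
              rw [← Finset.sum_mul]
              gcongr
              exact he.sum_inner_products_le _
      have h2 : Tendsto (fun b => ((n + 1 : ℕ) : ℝ) * ∑ i, ‖(B b).adjoint (v i)‖ ^ 2 *
          ‖wedgeA n (v ∘ i.succAbove)‖ ^ 2) l (𝓝 (((n + 1 : ℕ) : ℝ) * ∑ i : Fin (n + 1),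
            ‖(0 : E)‖ ^ 2 * ‖wedgeA n (v ∘ i.succAbove)‖ ^ 2)) :=
        (tendsto_finsetSum _ fun i _ => (((hBt (v i)).norm.pow 2).mul_const _)).const_mul _
      simp only [norm_zero, ne_eq, OfNat.ofNat_ne_zero, not_false_eq_true, zero_pow, zero_mul,
        Finset.sum_const_zero, mul_zero] at h2
      filter_upwards [h2.eventually_lt_const hε] with b hb s
      exact (h1 b s).trans hb.le

theorem sqTendsto_annihilate [CompleteSpace E] [CompleteSpace G] {β : Type*} {l : Filter β}
    {e : ι → E} (he : Orthonormal ℂ e) (A : E →L[ℂ] G) {Q : β → G →L[ℂ] G}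
    (hQ : ∀ b, ‖Q b‖ ≤ 1) (hQs : ∀ b, IsSelfAdjoint (Q b))
    (hQt : ∀ x, Tendsto (fun b => Q b x) l (𝓝 x)) (f : FockFin G) :
    SqTendsto l (fun b k => annihilate (Q b (A (e k))) f) fun k => annihilate (A (e k)) f := by
  refine FockFin.induction (p := fun f => SqTendsto l (fun b k => annihilate (Q b (A (e k))) f)
    fun k => annihilate (A (e k)) f) f ?_ ?_ ?_
  · intro d ε hε
    refine Eventually.of_forall fun b s => ?_
    simpa using hε.le
  · intro x y hx hy
    simp only [map_add]
    exact hx.add hy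
  · intro n g d ε hε
    have hB (b : β) : ‖Q b ∘L A - A‖ ≤ 2 * ‖A‖ := by
      have h1 := norm_sub_le (Q b ∘L A) A
      have h2 := (Q b).opNorm_comp_le A
      have h3 := mul_le_mul_of_nonneg_right (hQ b) (norm_nonneg A)
      linarith
    have hBt (x : G) : Tendsto (fun b => (Q b ∘L A - A).adjoint x) l (𝓝 0) := by
      have h1 : Tendsto (fun b => A.adjoint (Q b x) - A.adjoint x) l
          (𝓝 (A.adjoint x - A.adjoint x)) :=
        ((A.adjoint.continuous.tendsto x).comp (hQt x)).sub_const _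
      rw [sub_self] at h1
      refine h1.congr fun b => ?_
      rw [map_sub, ContinuousLinearMap.adjoint_comp, ContinuousLinearMap.isSelfAdjoint_iff'.1 (hQs b)]
      rfl
    have h1 := sqTendsto_annihilateN_zero he hB hBt n g (ε / ((d (n - 1) : ℝ) ^ 2 + 1))
      (by positivity)
    filter_upwards [h1] with b hb s
    have h4 (k : ι) : FockFin.wnorm d (annihilate (Q b (A (e k))) (FockFin.of n g) -
        annihilate (A (e k)) (FockFin.of n g)) ^ 2 =
        (d (n - 1) : ℝ) ^ 2 * ‖annihilateN ((Q b ∘L A - A) (e k)) n g‖ ^ 2 := by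
      rw [← sub_apply, ← annihilate_sub, annihilate_of, FockFin.wnorm_of, mul_pow]
      rfl
    simp only [h4]
    rw [← Finset.mul_sum]
    calc (d (n - 1) : ℝ) ^ 2 * ∑ k ∈ s, ‖annihilateN ((Q b ∘L A - A) (e k)) n g‖ ^ 2
        ≤ ((d (n - 1) : ℝ) ^ 2 + 1) * (ε / ((d (n - 1) : ℝ) ^ 2 + 1)) := by
          gcongr
          · linarith
          · exact hb s
      _ = ε := by field_simp

/-- The series `∑ k, (a⁺(A e_k) + a⁻(h_k)) R (a⁻(A' e_k) + a⁺(h'_k))`, for bounded operators `A`,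
`A'` and square summable families `h`, `h'`, converges strongly to a continuous operator, and it
is jointly stable under truncation of its left and right arguments by operators `Q` tending strongly
to the identity. -/
theorem exists_hasSum_fieldSeries [CompleteSpace E] [CompleteSpace G] {β : Type*}
    {l : Filter β} [l.NeBot] {e : ι → E} (he : Orthonormal ℂ e) (A A' : E →L[ℂ] G) {h h' : ι → G}
    (hh : Summable fun k => ‖h k‖ ^ 2) (hh' : Summable fun k => ‖h' k‖ ^ 2)
    {Q : β → G →L[ℂ] G} (hQ : ∀ b, ‖Q b‖ ≤ 1) (hQs : ∀ b, IsSelfAdjoint (Q b))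
    (hQt : ∀ x, Tendsto (fun b => Q b x) l (𝓝 x)) (R : FockOp G) :
    ∃ S : FockOp G,
      (∀ f, HasSum (fun k => (create (A (e k)) + annihilate (h k))
        (R ((annihilate (A' (e k)) + create (h' k)) f))) (S f)) ∧
      ∀ (f : FockFin G) (z : β × β → FockFin G),
        (∀ a b, HasSum (fun k => (create (Q a (A (e k))) + annihilate (Q a (h k)))
          (R ((annihilate (Q b (A' (e k))) + create (Q b (h' k))) f))) (z (a, b))) →
        Tendsto z (l ×ˢ l) (𝓝 (S f)) := by
  set T : ι → FockOp G := fun k => create (A (e k)) + annihilate (h k) with hT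
  set Ta : β → ι → FockOp G := fun a k => create (Q a (A (e k))) + annihilate (Q a (h k)) with hTa
  set y : FockFin G → ι → FockFin G :=
    fun f k => (annihilate (A' (e k)) + create (h' k)) f with hy
  have hrow (c : ℕ → NNReal) : ∃ d, ∀ a, IsRowBounded (Ta a) c d := by
    obtain ⟨d1, hd1⟩ := exists_isRowBounded_create (G := G) he ‖A‖₊ c
    obtain ⟨d2, hd2⟩ := exists_isRowBounded_annihilate (G := G) (ι := ι)
      (Real.toNNReal (∑' k, ‖h k‖ ^ 2)) c
    refine ⟨_, fun a => (hd1 (Q a ∘L A) ?_).add (hd2 (fun k => Q a (h k)) fun s => ?_)⟩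
    · refine ((Q a).opNorm_comp_le A).trans ?_
      have h3 := mul_le_mul_of_nonneg_right (hQ a) (norm_nonneg A)
      simpa using h3
    · rw [Real.coe_toNNReal _ (tsum_nonneg fun _ => by positivity)]
      refine le_trans (Finset.sum_le_sum fun k _ => ?_)
        (hh.sum_le_tsum s fun _ _ => by positivity)
      have h2 : ‖Q a (h k)‖ ≤ 1 * ‖h k‖ := (Q a).le_of_opNorm_le (hQ a) _
      rw [one_mul] at h2
      gcongr
  have hpt (k : ι) (v : FockFin G) : Tendsto (fun a => Ta a k v) l (𝓝 (T k v)) := by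
    simp only [hT, hTa, add_apply]
    exact (((continuous_create v).tendsto _).comp (hQt _)).add
      (((continuous_annihilate v).tendsto _).comp (hQt _))
  have hrowT (c : ℕ → NNReal) : ∃ d, IsRowBounded T c d := by
    obtain ⟨d, hd⟩ := hrow c
    exact ⟨d, IsRowBounded.of_tendsto hd hpt⟩
  have hysum (f : FockFin G) : SqSummable (y f) := by
    simp only [hy, add_apply]
    exact (sqSummable_annihilate he A' f).add (sqSummable_create hh' f)
  have hsum (f : FockFin G) : Summable fun k => T k (R (y f k)) := by
    obtain ⟨x, hx⟩ := IsRowBounded.exists_hasSum hrowT ((hysum f).map R)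
    exact hx.summable
  let S₀ : FockFin G →ₗ[ℂ] FockFin G :=
    { toFun := fun f => ∑' k, T k (R (y f k))
      map_add' := fun f g => by
        rw [← (hsum f).tsum_add (hsum g)]
        simp only [hy, map_add]
      map_smul' := fun c f => by
        rw [RingHom.id_apply, ← (hsum f).tsum_const_smul]
        simp only [hy, map_smul] }
  have hS₀ (f : FockFin G) : HasSum (fun k => T k (R (y f k))) (S₀ f) := (hsum f).hasSum
  have hcont : Continuous S₀ := by
    refine FockFin.continuous_linearMap S₀ fun n => ?_
    refine continuous_of_continuousAt_zero (S₀ ∘ₗ FockFin.of (G := G) n) ?_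
    rw [ContinuousAt, map_zero]
    refine FockFin.tendsto_iff.2 fun c ε hε => ?_
    obtain ⟨d, hd⟩ := hrowT c
    obtain ⟨d', hd'⟩ := FockFin.exists_wnorm_apply_le R d
    set M : ℝ := 2 * (d' (n - 1) * n * ‖A'‖) ^ 2 + 2 * (d' (n + 1) ^ 2 * ∑' k, ‖h' k‖ ^ 2) with hM
    have hM0 : 0 ≤ M := by
      have : 0 ≤ ∑' k, ‖h' k‖ ^ 2 := tsum_nonneg fun _ => by positivity
      positivity
    have key (g : AntisymPow G n) : FockFin.wnorm c (S₀ (FockFin.of n g)) ^ 2 ≤ M * ‖g‖ ^ 2 := by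
      refine hd.wnorm_hasSum_sq_le (fun s => ?_) (hS₀ (FockFin.of n g))
      have h1 : ∑ k ∈ s, FockFin.wnorm d (R (y (FockFin.of n g) k)) ^ 2 ≤
          ∑ k ∈ s, FockFin.wnorm d' (y (FockFin.of n g) k) ^ 2 := by
        gcongr
        exact hd' _
      have h5 := sum_wnorm_add_sq_le d' s (fun k => annihilate (A' (e k)) (FockFin.of n g))
        fun k => create (h' k) (FockFin.of n g)
      refine h1.trans (h5.trans ?_)
      have h2 := sum_wnorm_annihilate_sq_le he A' d' n g s
      have h3 := sum_wnorm_create_sq_le h' d' n g s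
      have h4 : (d' (n + 1) ^ 2 * ∑ k ∈ s, ‖h' k‖ ^ 2) * ‖g‖ ^ 2 ≤
          (d' (n + 1) ^ 2 * ∑' k, ‖h' k‖ ^ 2) * ‖g‖ ^ 2 := by
        gcongr
        exact hh'.sum_le_tsum s fun _ _ => by positivity
      rw [hM, add_mul]
      linarith
    have h1 : Tendsto (fun g : AntisymPow G n => M * ‖g‖ ^ 2) (𝓝 0) (𝓝 (M * ‖(0 : AntisymPow G n)‖ ^ 2)) :=
      Continuous.tendsto (by fun_prop) 0
    simp only [norm_zero, ne_eq, OfNat.ofNat_ne_zero, not_false_eq_true, zero_pow, mul_zero] at h1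
    filter_upwards [h1.eventually_lt_const (show (0 : ℝ) < ε ^ 2 by positivity)] with g hg
    rw [sub_zero]
    exact lt_of_pow_lt_pow_left₀ 2 hε.le ((key g).trans_lt hg)
  refine ⟨⟨S₀, hcont⟩, hS₀, fun f z hz => ?_⟩
  refine tendsto_hasSum_of_isRowBounded hrow hpt ((hysum f).map R) ?_ (hS₀ f) hz
  have h1 : SqTendsto l (fun b k => (annihilate (Q b (A' (e k))) + create (Q b (h' k))) f) (y f) := by
    simp only [hy, add_apply]
    exact (sqTendsto_annihilate he A' hQ hQs hQt f).add (sqTendsto_create hh' hQ hQt f)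
  exact h1.map R

end FieldSeries

section OneParticleLemmas

variable {X : Type u} [MeasurableSpace X] {σ : Measure X}

/-! ### Complex conjugation and multiplication by indicator functions -/

theorem L2.star_add (f g : L2 σ) : star (f + g) = star f + star g := by
  refine Lp.ext ?_
  filter_upwards [Lp.coeFn_star (f + g), Lp.coeFn_add f g, Lp.coeFn_add (star f) (star g),
    Lp.coeFn_star f, Lp.coeFn_star g] with x h1 h2 h3 h4 h5
  rw [h1, h3, Pi.star_apply, h2, Pi.add_apply, Pi.add_apply, h4, h5, StarAddMonoid.star_add]
  rfl

theorem L2.inner_star_star (f g : L2 σ) : ⟪star f, star g⟫ = ⟪g, f⟫ := by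
  rw [MeasureTheory.L2.inner_def, MeasureTheory.L2.inner_def]
  refine integral_congr_ae ?_
  filter_upwards [Lp.coeFn_star f, Lp.coeFn_star g] with x h1 h2
  rw [h1, h2, Pi.star_apply, Pi.star_apply, RCLike.inner_apply, RCLike.inner_apply]
  simp [mul_comm]

theorem L2.inner_star_left (f g : L2 σ) : ⟪star f, g⟫ = ⟪star g, f⟫ := by
  rw [← L2.inner_star_star, star_star]

theorem L2.inner_star_right (f g : L2 σ) : ⟪f, star g⟫ = ⟪g, star f⟫ := by
  rw [← L2.inner_star_star, star_star]

theorem L2.norm_star (f : L2 σ) : ‖star f‖ = ‖f‖ := by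
  have h : ((‖star f‖ ^ 2 : ℝ) : ℂ) = ((‖f‖ ^ 2 : ℝ) : ℂ) := by
    push_cast
    refine (inner_self_eq_norm_sq_to_K (𝕜 := ℂ) (star f)).symm.trans ?_
    rw [L2.inner_star_star]
    exact inner_self_eq_norm_sq_to_K (𝕜 := ℂ) f
  have h2 : ‖star f‖ ^ 2 = ‖f‖ ^ 2 := by exact_mod_cast h
  exact (sq_eq_sq₀ (norm_nonneg _) (norm_nonneg _)).1 h2

theorem L2.star_smul (c : ℂ) (f : L2 σ) : star (c • f) = star c • star f := by
  refine _root_.ext_inner_left ℂ fun g => ?_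
  rw [L2.inner_star_right, inner_smul_left, inner_smul_right, L2.inner_star_right]
  rfl

variable (σ) in
/-- Complex conjugation as a continuous conjugate-linear map. -/
def L2.conj : L2 σ →L⋆[ℂ] L2 σ :=
  LinearMap.mkContinuous
    { toFun := fun f => star f
      map_add' := L2.star_add
      map_smul' := fun c f => L2.star_smul c f } 1 fun f => by
    rw [one_mul]
    exact (L2.norm_star f).le

theorem L2.star_neg (f : L2 σ) : star (-f) = -star f := map_neg (L2.conj σ) f

theorem conjOp_apply (B : L2 σ →L[ℂ] L2 σ) (f : L2 σ) : conjOp B f = star (B (star f)) := rfl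

theorem restrictProj_coeFn {Δ : Set X} (hΔ : MeasurableSet Δ) (f : L2 σ) :
    restrictProj σ Δ f =ᵐ[σ] Δ.indicator f := by
  rw [restrictProj, dif_pos hΔ]
  exact ((Lp.memLp f).indicator hΔ).coeFn_toLp

theorem restrictProj_comp {Δ Δ' : Set X} (hΔ : MeasurableSet Δ) (hΔ' : MeasurableSet Δ')
    (f : L2 σ) : restrictProj σ Δ (restrictProj σ Δ' f) = restrictProj σ (Δ ∩ Δ') f := by
  refine Lp.ext ?_
  filter_upwards [restrictProj_coeFn hΔ (restrictProj σ Δ' f), restrictProj_coeFn hΔ' f,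
    restrictProj_coeFn (hΔ.inter hΔ') f] with x h1 h2 h3
  rw [h1, h3]
  by_cases h : x ∈ Δ
  · rw [Set.indicator_of_mem h, h2]
    by_cases h' : x ∈ Δ'
    · rw [Set.indicator_of_mem h', Set.indicator_of_mem (Set.mem_inter h h')]
    · rw [Set.indicator_of_notMem h', Set.indicator_of_notMem (fun h'' : x ∈ Δ ∩ Δ' => h' h''.2)]
  · rw [Set.indicator_of_notMem h, Set.indicator_of_notMem (fun h'' : x ∈ Δ ∩ Δ' => h h''.1)]

theorem restrictProj_idem {Δ : Set X} (hΔ : MeasurableSet Δ) (f : L2 σ) :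
    restrictProj σ Δ (restrictProj σ Δ f) = restrictProj σ Δ f := by
  rw [restrictProj_comp hΔ hΔ, Set.inter_self]

theorem inner_restrictProj {Δ : Set X} (hΔ : MeasurableSet Δ) (f g : L2 σ) :
    ⟪restrictProj σ Δ f, g⟫ = ⟪f, restrictProj σ Δ g⟫ := by
  rw [MeasureTheory.L2.inner_def, MeasureTheory.L2.inner_def]
  refine integral_congr_ae ?_
  filter_upwards [restrictProj_coeFn hΔ f, restrictProj_coeFn hΔ g] with x h1 h2
  rw [h1, h2]
  by_cases h : x ∈ Δ
  · rw [Set.indicator_of_mem h, Set.indicator_of_mem h]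
  · rw [Set.indicator_of_notMem h, Set.indicator_of_notMem h, inner_zero_left, inner_zero_right]

theorem restrictProj_empty (f : L2 σ) : restrictProj σ ∅ f = 0 := by
  refine Lp.ext ?_
  filter_upwards [restrictProj_coeFn MeasurableSet.empty f, Lp.coeFn_zero ℂ 2 σ] with x h1 h2
  rw [h1, h2, Set.indicator_empty]
  rfl

/-! ### The doubled one-particle space -/

theorem inner_inFst (φ : L2 σ) (x : L2Double σ) : ⟪inFst σ φ, x⟫ = ⟪φ, x.fst⟫ := by
  rw [WithLp.prod_inner_apply]
  change ⟪φ, x.fst⟫ + ⟪(0 : L2 σ), x.snd⟫ = _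
  rw [inner_zero_left, add_zero]

theorem inner_inSnd (φ : L2 σ) (x : L2Double σ) : ⟪inSnd σ φ, x⟫ = ⟪φ, x.snd⟫ := by
  rw [WithLp.prod_inner_apply]
  change ⟪(0 : L2 σ), x.fst⟫ + ⟪φ, x.snd⟫ = _
  rw [inner_zero_left, zero_add]

theorem inner_right_inFst (φ : L2 σ) (x : L2Double σ) : ⟪x, inFst σ φ⟫ = ⟪x.fst, φ⟫ := by
  rw [← inner_conj_symm, inner_inFst, inner_conj_symm]

theorem inner_right_inSnd (φ : L2 σ) (x : L2Double σ) : ⟪x, inSnd σ φ⟫ = ⟪x.snd, φ⟫ := by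
  rw [← inner_conj_symm, inner_inSnd, inner_conj_symm]

theorem inFst_fst (φ : L2 σ) : (inFst σ φ).fst = φ := rfl
theorem inFst_snd (φ : L2 σ) : (inFst σ φ).snd = 0 := rfl
theorem inSnd_fst (φ : L2 σ) : (inSnd σ φ).fst = 0 := rfl
theorem inSnd_snd (φ : L2 σ) : (inSnd σ φ).snd = φ := rfl

theorem directSumOp_apply (B₁ B₂ : L2 σ →L[ℂ] L2 σ) (x : L2Double σ) :
    directSumOp B₁ B₂ x = inFst σ (B₁ x.fst) + inSnd σ (B₂ x.snd) := rfl

theorem inFst_add_inSnd (x : L2Double σ) : inFst σ x.fst + inSnd σ x.snd = x := by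
  refine _root_.ext_inner_left ℂ fun z => ?_
  rw [inner_add_right, inner_right_inFst, inner_right_inSnd, WithLp.prod_inner_apply]
  rfl

theorem norm_inFst (φ : L2 σ) : ‖inFst σ φ‖ = ‖φ‖ := by
  have h : ((‖inFst σ φ‖ ^ 2 : ℝ) : ℂ) = ((‖φ‖ ^ 2 : ℝ) : ℂ) := by
    push_cast
    refine (inner_self_eq_norm_sq_to_K (𝕜 := ℂ) (inFst σ φ)).symm.trans ?_
    rw [inner_inFst]
    exact inner_self_eq_norm_sq_to_K (𝕜 := ℂ) φ
  have h2 : ‖inFst σ φ‖ ^ 2 = ‖φ‖ ^ 2 := by exact_mod_cast h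
  exact (sq_eq_sq₀ (norm_nonneg _) (norm_nonneg _)).1 h2

theorem norm_inSnd (φ : L2 σ) : ‖inSnd σ φ‖ = ‖φ‖ := by
  have h : ((‖inSnd σ φ‖ ^ 2 : ℝ) : ℂ) = ((‖φ‖ ^ 2 : ℝ) : ℂ) := by
    push_cast
    refine (inner_self_eq_norm_sq_to_K (𝕜 := ℂ) (inSnd σ φ)).symm.trans ?_
    rw [inner_inSnd]
    exact inner_self_eq_norm_sq_to_K (𝕜 := ℂ) φ
  have h2 : ‖inSnd σ φ‖ ^ 2 = ‖φ‖ ^ 2 := by exact_mod_cast h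
  exact (sq_eq_sq₀ (norm_nonneg _) (norm_nonneg _)).1 h2

/-! ### Finite truncations -/

variable {ι : Type*}

/-- The orthogonal projection `x ↦ ∑ i ∈ F, ⟪e i, x⟫ e i` for an orthonormal family `e`. -/
def finProj (e : ι → L2 σ) (F : Finset ι) : L2 σ →L[ℂ] L2 σ :=
  ∑ i ∈ F, (innerSL ℂ (e i)).smulRight (e i)

theorem finProj_apply (e : ι → L2 σ) (F : Finset ι) (x : L2 σ) :
    finProj e F x = ∑ i ∈ F, ⟪e i, x⟫ • e i := by
  rw [finProj, sum_apply]
  rfl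

theorem inner_finProj (e : ι → L2 σ) (F : Finset ι) (x y : L2 σ) :
    ⟪finProj e F x, y⟫ = ⟪x, finProj e F y⟫ := by
  rw [finProj_apply, finProj_apply, sum_inner, inner_sum]
  refine Finset.sum_congr rfl fun i _ => ?_
  rw [inner_smul_left, inner_smul_right, inner_conj_symm, mul_comm]

theorem norm_finProj_apply_le {e : ι → L2 σ} (he : Orthonormal ℂ e) (F : Finset ι) (x : L2 σ) :
    ‖finProj e F x‖ ≤ ‖x‖ := by
  have h1 : ‖finProj e F x‖ ^ 2 ≤ ‖x‖ ^ 2 := by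
    refine le_trans (le_of_eq ?_) (he.sum_inner_products_le (s := F) (x := x))
    have h : ((‖finProj e F x‖ ^ 2 : ℝ) : ℂ) = ((∑ i ∈ F, ‖⟪e i, x⟫‖ ^ 2 : ℝ) : ℂ) := by
      push_cast
      refine (inner_self_eq_norm_sq_to_K (𝕜 := ℂ) (finProj e F x)).symm.trans ?_
      rw [finProj_apply, he.inner_sum]
      refine Finset.sum_congr rfl fun i _ => ?_
      exact RCLike.conj_mul _
    exact_mod_cast h
  exact (sq_le_sq₀ (norm_nonneg _) (norm_nonneg _)).1 h1

theorem tendsto_finProj (e : HilbertBasis ι ℂ (L2 σ)) (x : L2 σ) :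
    Tendsto (fun F => finProj e F x) atTop (𝓝 x) := by
  have h := e.hasSum_repr x
  simp only [e.repr_apply_apply] at h
  refine (show Tendsto _ atTop (𝓝 x) from h).congr fun F => ?_
  rw [finProj_apply]

/-- The truncation `finProj e F` on both components. -/
def finProjDouble (e : ι → L2 σ) (F : Finset ι) : L2Double σ →L[ℂ] L2Double σ :=
  directSumOp (finProj e F) (finProj e F)

theorem finProjDouble_inFst (e : ι → L2 σ) (F : Finset ι) (x : L2 σ) :
    finProjDouble e F (inFst σ x) = ∑ i ∈ F, ⟪e i, x⟫ • inFst σ (e i) := by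
  rw [finProjDouble, directSumOp_apply, inFst_fst, inFst_snd, map_zero, map_zero, add_zero,
    finProj_apply, map_sum]
  simp only [map_smul]

theorem finProjDouble_inSnd (e : ι → L2 σ) (F : Finset ι) (x : L2 σ) :
    finProjDouble e F (inSnd σ x) = ∑ i ∈ F, ⟪e i, x⟫ • inSnd σ (e i) := by
  rw [finProjDouble, directSumOp_apply, inSnd_fst, inSnd_snd, map_zero, map_zero, zero_add,
    finProj_apply, map_sum]
  simp only [map_smul]

theorem isSelfAdjoint_directSumOp {B₁ B₂ : L2 σ →L[ℂ] L2 σ}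
    (h₁ : ∀ x y, ⟪B₁ x, y⟫ = ⟪x, B₁ y⟫) (h₂ : ∀ x y, ⟪B₂ x, y⟫ = ⟪x, B₂ y⟫) :
    IsSelfAdjoint (directSumOp B₁ B₂) := by
  refine ContinuousLinearMap.isSelfAdjoint_iff_isSymmetric.2 fun x y => ?_
  change ⟪directSumOp B₁ B₂ x, y⟫ = ⟪x, directSumOp B₁ B₂ y⟫
  rw [directSumOp_apply, directSumOp_apply, inner_add_left, inner_add_right, inner_inFst,
    inner_inSnd, inner_right_inFst, inner_right_inSnd, h₁, h₂]

theorem norm_finProjDouble_le {e : ι → L2 σ} (he : Orthonormal ℂ e) (F : Finset ι) :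
    ‖finProjDouble e F‖ ≤ 1 := by
  refine ContinuousLinearMap.opNorm_le_bound _ zero_le_one fun x => ?_
  rw [one_mul]
  refine (sq_le_sq₀ (norm_nonneg _) (norm_nonneg _)).1 ?_
  rw [WithLp.prod_norm_sq_eq_of_L2, WithLp.prod_norm_sq_eq_of_L2]
  have h1 : (finProjDouble e F x).fst = finProj e F x.fst := by
    change finProj e F x.fst + 0 = _
    rw [add_zero]
  have h2 : (finProjDouble e F x).snd = finProj e F x.snd := by
    change 0 + finProj e F x.snd = _
    rw [zero_add]
  rw [h1, h2]
  gcongr <;> exact norm_finProj_apply_le he F _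

theorem tendsto_finProjDouble (e : HilbertBasis ι ℂ (L2 σ)) (x : L2Double σ) :
    Tendsto (fun F => finProjDouble e F x) atTop (𝓝 x) := by
  have h : Tendsto (fun F => inFst σ (finProj e F x.fst) + inSnd σ (finProj e F x.snd)) atTop
      (𝓝 (inFst σ x.fst + inSnd σ x.snd)) :=
    (((inFst σ).continuous.tendsto _).comp (tendsto_finProj e _)).add
      (((inSnd σ).continuous.tendsto _).comp (tendsto_finProj e _))
  rwa [inFst_add_inSnd] at h

end OneParticleLemmas

section Fields

variable {X : Type u} [MeasurableSpace X] {σ : Measure X}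

/-! ### The transformed field operators and their commutators with the density -/

/-- The field `a₂⁺(K₂ u) + a₁⁻(conj (K₁ u))`, linear in `u`. -/
def fieldOp (K₁ K₂ : L2 σ →L[ℂ] L2 σ) (u : L2 σ) : FockOp (L2Double σ) :=
  create (inSnd σ (K₂ u)) + annihilate (inFst σ (star (K₁ u)))

/-- The field `a₂⁻(K₂ u) + a₁⁺(conj (K₁ u))`, conjugate-linear in `u`, which is the formal adjoint
of `fieldOp K₁ K₂ u`. -/
def fieldAdj (K₁ K₂ : L2 σ →L[ℂ] L2 σ) (u : L2 σ) : FockOp (L2Double σ) :=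
  annihilate (inSnd σ (K₂ u)) + create (inFst σ (star (K₁ u)))

theorem fieldOp_neg (K₁ K₂ : L2 σ →L[ℂ] L2 σ) (u : L2 σ) :
    fieldOp K₁ K₂ (-u) = -fieldOp K₁ K₂ u := by
  simp only [fieldOp, map_neg, L2.star_neg, create_neg, annihilate_neg, neg_add]

theorem fieldAdj_neg (K₁ K₂ : L2 σ →L[ℂ] L2 σ) (u : L2 σ) :
    fieldAdj K₁ K₂ (-u) = -fieldAdj K₁ K₂ u := by
  simp only [fieldAdj, map_neg, L2.star_neg, create_neg, annihilate_neg, neg_add]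

/-- `κ` is the integral kernel of `S`. -/
def IsKernel (S : L2 σ →L[ℂ] L2 σ) (κ : HilbertTensor (L2 σ) (L2 σ)) : Prop :=
  ∀ φ ψ : L2 σ, ⟪((φ ⊗ₜ[ℂ] ψ : L2 σ ⊗[ℂ] L2 σ) : HilbertTensor (L2 σ) (L2 σ)), κ⟫ = ⟪φ, S (star ψ)⟫

theorem inner_tmul_pairTwoOne (x y : L2Double σ) (k : HilbertTensor (L2 σ) (L2 σ)) :
    ⟪((x ⊗ₜ[ℂ] y : L2Double σ ⊗[ℂ] L2Double σ) : HilbertTensor (L2Double σ) (L2Double σ)),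
      pairTwoOne k⟫ =
    ⟪((x.snd ⊗ₜ[ℂ] y.fst : L2 σ ⊗[ℂ] L2 σ) : HilbertTensor (L2 σ) (L2 σ)), k⟫ := by
  refine HilbertTensor.eq_of_tmul
    (S := fun k => ⟪((x ⊗ₜ[ℂ] y : L2Double σ ⊗[ℂ] L2Double σ) :
      HilbertTensor (L2Double σ) (L2Double σ)), pairTwoOne k⟫)
    (T := fun k => ⟪((x.snd ⊗ₜ[ℂ] y.fst : L2 σ ⊗[ℂ] L2 σ) : HilbertTensor (L2 σ) (L2 σ)), k⟫)
    (by fun_prop) (by fun_prop) ?_ ?_ ?_ k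
  · intro a b
    rw [map_add, inner_add_right]
  · intro a b
    rw [inner_add_right]
  · intro a b
    have h1 : pairTwoOne ((a ⊗ₜ[ℂ] b : L2 σ ⊗[ℂ] L2 σ) : HilbertTensor (L2 σ) (L2 σ)) =
        ((inSnd σ a ⊗ₜ[ℂ] inFst σ b : L2Double σ ⊗[ℂ] L2Double σ) :
          HilbertTensor (L2Double σ) (L2Double σ)) :=
      (ContinuousLinearMap.completion_apply_coe _ _).trans rfl
    rw [h1, Completion.inner_coe, Completion.inner_coe, TensorProduct.inner_tmul,
      TensorProduct.inner_tmul, inner_right_inSnd, inner_right_inFst]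

theorem antiContract_pairTwoOne {S S' : L2 σ →L[ℂ] L2 σ} (hS : ∀ x y, ⟪S x, y⟫ = ⟪x, S' y⟫)
    {k : HilbertTensor (L2 σ) (L2 σ)} (hk : IsKernel S k) (φ : L2Double σ) :
    antiContract φ (pairTwoOne k) =
      inSnd σ (S (star φ.fst)) - inFst σ (star (S' φ.snd)) := by
  refine _root_.ext_inner_left ℂ fun z => ?_
  rw [antiContract, sub_apply, inner_sub_right, ContinuousLinearMap.adjoint_inner_right,
    ContinuousLinearMap.adjoint_inner_right, inner_sub_right, inner_right_inFst, inner_right_inSnd]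
  congr 1
  · exact (inner_tmul_pairTwoOne z φ k).trans (hk _ _)
  · refine ((inner_tmul_pairTwoOne φ z k).trans (hk _ _)).trans ?_
    rw [← inner_conj_symm, hS, inner_conj_symm, L2.inner_star_right]

/-- The particle density for arbitrary operators `K₁`, `K₂`, a localization `J`, a kernel `k` in
place of that of `K₂ J K₁`, and a constant `t` in place of the traces. -/
def densityOp (K₁ K₂ J : L2 σ →L[ℂ] L2 σ) (k : HilbertTensor (L2 σ) (L2 σ)) (t : ℂ) :
    FockOp (L2Double σ) :=
  createPair (pairTwoOne k) + annihilatePair (pairTwoOne k)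
    + secondQuant (directSumOp (conjOp (-(K₁ ∘L J ∘L K₁))) (K₂ ∘L J ∘L K₂))
    + t • (1 : FockOp (L2Double σ))

/-- `K₁` and `K₂` are symmetric with `K₁² + K₂² = 1`. -/
structure IsSqrtPair (K₁ K₂ : L2 σ →L[ℂ] L2 σ) : Prop where
  symm₁ : ∀ x y, ⟪K₁ x, y⟫ = ⟪x, K₁ y⟫
  symm₂ : ∀ x y, ⟪K₂ x, y⟫ = ⟪x, K₂ y⟫
  sq_add_sq : ∀ x, K₁ (K₁ x) + K₂ (K₂ x) = x

variable {K₁ K₂ J : L2 σ →L[ℂ] L2 σ} {k : HilbertTensor (L2 σ) (L2 σ)}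

theorem densityOp_mul_create (hK : IsSqrtPair K₁ K₂) (hJ : ∀ x y, ⟪J x, y⟫ = ⟪x, J y⟫)
    (hk : IsKernel (K₂ ∘L J ∘L K₁) k) (t : ℂ) (φ : L2Double σ) :
    densityOp K₁ K₂ J k t * create φ = create φ * densityOp K₁ K₂ J k t
      + create (inSnd σ (K₂ (J (K₂ φ.snd))) - inFst σ (star (K₁ (J (K₁ (star φ.fst))))))
      + annihilate (inFst σ (star (K₁ (J (K₂ φ.snd)))) - inSnd σ (K₂ (J (K₁ (star φ.fst))))) := by
  have hc := antiContract_pairTwoOne (S' := K₁ ∘L J ∘L K₂)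
    (fun x y => by simp [hK.symm₁, hK.symm₂, hJ]) hk φ
  have hd : directSumOp (conjOp (-(K₁ ∘L J ∘L K₁))) (K₂ ∘L J ∘L K₂) φ =
      inSnd σ (K₂ (J (K₂ φ.snd))) - inFst σ (star (K₁ (J (K₁ (star φ.fst))))) := by
    rw [directSumOp_apply, conjOp_apply, neg_apply, L2.star_neg, map_neg]
    simp only [ContinuousLinearMap.comp_apply]
    abel
  unfold densityOp
  rw [add_mul, add_mul, add_mul, createPair_mul_create, annihilatePair_mul_create,
    secondQuant_mul_create, hc, hd, mul_add, mul_add, mul_add, smul_mul_assoc, mul_smul_comm,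
    one_mul, mul_one]
  simp only [ContinuousLinearMap.comp_apply, annihilate_sub]
  abel

theorem densityOp_mul_annihilate (hK : IsSqrtPair K₁ K₂) (hJ : ∀ x y, ⟪J x, y⟫ = ⟪x, J y⟫)
    (hk : IsKernel (K₂ ∘L J ∘L K₁) k) (t : ℂ) (φ : L2Double σ) :
    densityOp K₁ K₂ J k t * annihilate φ = annihilate φ * densityOp K₁ K₂ J k t
      - annihilate (inSnd σ (K₂ (J (K₂ φ.snd))) - inFst σ (star (K₁ (J (K₁ (star φ.fst))))))
      - create (inFst σ (star (K₁ (J (K₂ φ.snd)))) - inSnd σ (K₂ (J (K₁ (star φ.fst))))) := by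
  have hc := antiContract_pairTwoOne (S' := K₁ ∘L J ∘L K₂)
    (fun x y => by simp [hK.symm₁, hK.symm₂, hJ]) hk φ
  have hd : directSumOp (conjOp (-(K₁ ∘L J ∘L K₁))) (K₂ ∘L J ∘L K₂) φ =
      inSnd σ (K₂ (J (K₂ φ.snd))) - inFst σ (star (K₁ (J (K₁ (star φ.fst))))) := by
    rw [directSumOp_apply, conjOp_apply, neg_apply, L2.star_neg, map_neg]
    simp only [ContinuousLinearMap.comp_apply]
    abel
  have hs : IsSelfAdjoint (directSumOp (conjOp (-(K₁ ∘L J ∘L K₁))) (K₂ ∘L J ∘L K₂)) := by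
    refine isSelfAdjoint_directSumOp (fun x y => ?_) fun x y => ?_
    · rw [conjOp_apply, conjOp_apply, L2.inner_star_left, L2.inner_star_right x]
      simp [hK.symm₁, hJ]
    · simp [hK.symm₂, hJ]
  unfold densityOp
  rw [add_mul, add_mul, add_mul, createPair_mul_annihilate, annihilatePair_mul_annihilate,
    secondQuant_mul_annihilate, hc, ContinuousLinearMap.isSelfAdjoint_iff'.1 hs, hd, mul_add,
    mul_add, mul_add, smul_mul_assoc, mul_smul_comm, one_mul, mul_one]
  simp only [ContinuousLinearMap.comp_apply, create_sub]
  abel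

/-- The density acts on the fields by `[ρ, D(u)] = D(J u)`: the pair terms and the second
quantization contribute `K₁²` and `K₂²`, which add up to `1`. -/
theorem densityOp_mul_fieldOp (hK : IsSqrtPair K₁ K₂) (hJ : ∀ x y, ⟪J x, y⟫ = ⟪x, J y⟫)
    (hk : IsKernel (K₂ ∘L J ∘L K₁) k) (t : ℂ) (u : L2 σ) :
    densityOp K₁ K₂ J k t * fieldOp K₁ K₂ u =
      fieldOp K₁ K₂ u * densityOp K₁ K₂ J k t + fieldOp K₁ K₂ (J u) := by
  have h1 : K₂ (J u) = K₂ (J (K₁ (K₁ u))) + K₂ (J (K₂ (K₂ u))) := by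
    conv_lhs => rw [← hK.sq_add_sq u]
    rw [map_add, map_add]
  have h2 : K₁ (J u) = K₁ (J (K₁ (K₁ u))) + K₁ (J (K₂ (K₂ u))) := by
    conv_lhs => rw [← hK.sq_add_sq u]
    rw [map_add, map_add]
  simp only [fieldOp, mul_add, add_mul, densityOp_mul_create hK hJ hk,
    densityOp_mul_annihilate hK hJ hk, h1, h2, inFst_fst, inFst_snd, inSnd_fst, inSnd_snd,
    map_zero, star_star, L2.star_add, create_add, annihilate_add, create_sub, annihilate_sub,
    map_add]
  have h0 : star (0 : L2 σ) = 0 := map_zero (L2.conj σ)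
  have h3 : create (0 : L2Double σ) = 0 := by
    rw [← zero_smul ℂ (0 : L2Double σ), create_smul, zero_smul]
  have h4 : annihilate (0 : L2Double σ) = 0 := by
    rw [← zero_smul ℂ (0 : L2Double σ), annihilate_smul, star_zero, zero_smul]
  simp only [h0, map_zero, h3, h4]
  abel

theorem densityOp_mul_fieldAdj (hK : IsSqrtPair K₁ K₂) (hJ : ∀ x y, ⟪J x, y⟫ = ⟪x, J y⟫)
    (hk : IsKernel (K₂ ∘L J ∘L K₁) k) (t : ℂ) (u : L2 σ) :
    densityOp K₁ K₂ J k t * fieldAdj K₁ K₂ u =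
      fieldAdj K₁ K₂ u * densityOp K₁ K₂ J k t - fieldAdj K₁ K₂ (J u) := by
  have h1 : K₂ (J u) = K₂ (J (K₁ (K₁ u))) + K₂ (J (K₂ (K₂ u))) := by
    conv_lhs => rw [← hK.sq_add_sq u]
    rw [map_add, map_add]
  have h2 : K₁ (J u) = K₁ (J (K₁ (K₁ u))) + K₁ (J (K₂ (K₂ u))) := by
    conv_lhs => rw [← hK.sq_add_sq u]
    rw [map_add, map_add]
  simp only [fieldAdj, mul_add, add_mul, densityOp_mul_create hK hJ hk,
    densityOp_mul_annihilate hK hJ hk, h1, h2, inFst_fst, inFst_snd, inSnd_fst, inSnd_snd,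
    map_zero, star_star, L2.star_add, create_add, annihilate_add, create_sub, annihilate_sub,
    map_add]
  have h0 : star (0 : L2 σ) = 0 := map_zero (L2.conj σ)
  have h3 : create (0 : L2Double σ) = 0 := by
    rw [← zero_smul ℂ (0 : L2Double σ), create_smul, zero_smul]
  have h4 : annihilate (0 : L2Double σ) = 0 := by
    rw [← zero_smul ℂ (0 : L2Double σ), annihilate_smul, star_zero, zero_smul]
  simp only [h0, map_zero, h3, h4]
  abel

end Fields

section FieldSeries

/-! ### The operators `W(Δ, R)` as series of products of fields -/

/-- A series of products of two finite linear combinations, reordered as a finite double sum whose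
coefficients are series. -/
theorem hasSum_apply_sum_smul {G : Type u} [NormedAddCommGroup G] [InnerProductSpace ℂ G]
    {κ ι : Type*} (R : FockOp G) (f : FockFin G) (F F' : Finset ι) (X Y U V : ι → FockOp G)
    {a b c d : κ → ι → ℂ} {m₁ m₂ m₃ m₄ : ι → ι → ℂ}
    (h₁ : ∀ i j, HasSum (fun k => a k i * c k j) (m₁ i j))
    (h₂ : ∀ i j, HasSum (fun k => b k i * d k j) (m₂ i j))
    (h₃ : ∀ i j, HasSum (fun k => a k i * d k j) (m₃ i j))
    (h₄ : ∀ i j, HasSum (fun k => b k i * c k j) (m₄ i j)) :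
    HasSum (fun k => (∑ i ∈ F, a k i • X i + ∑ i ∈ F, b k i • Y i)
        (R ((∑ j ∈ F', d k j • V j + ∑ j ∈ F', c k j • U j) f)))
      (∑ i ∈ F, ∑ j ∈ F', (m₁ i j • (X i * R * U j) + m₂ i j • (Y i * R * V j)
        + m₃ i j • (X i * R * V j) + m₄ i j • (Y i * R * U j)) f) := by
  have h : HasSum (fun k => ∑ i ∈ F, ∑ j ∈ F', ((a k i * c k j) • (X i) (R (U j f))
      + (b k i * d k j) • (Y i) (R (V j f)) + (a k i * d k j) • (X i) (R (V j f))
      + (b k i * c k j) • (Y i) (R (U j f))))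
      (∑ i ∈ F, ∑ j ∈ F', (m₁ i j • (X i) (R (U j f)) + m₂ i j • (Y i) (R (V j f))
        + m₃ i j • (X i) (R (V j f)) + m₄ i j • (Y i) (R (U j f)))) :=
    hasSum_sum fun i _ => hasSum_sum fun j _ =>
      ((((h₁ i j).smul_const _).add ((h₂ i j).smul_const _)).add ((h₃ i j).smul_const _)).add
        ((h₄ i j).smul_const _)
  convert h using 1
  · funext k
    simp only [add_apply, sum_apply, smul_apply, map_add, map_sum, map_smul, smul_add,
      Finset.smul_sum, smul_smul, Finset.sum_add_distrib]
    rw [Finset.sum_comm (s := F'), Finset.sum_comm (s := F'), Finset.sum_comm (s := F'),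
      Finset.sum_comm (s := F')]
    simp only [mul_comm]
    abel
  · simp only [add_apply, smul_apply, mul_apply_eq_comp]

variable {X : Type u} [MeasurableSpace X] {σ : Measure X} {ι : Type*}

theorem hasSum_inner_mul_inner_restrictProj (e : HilbertBasis ι ℂ (L2 σ)) {A B : L2 σ →L[ℂ] L2 σ}
    (hA : ∀ x y, ⟪A x, y⟫ = ⟪x, A y⟫) (hB : ∀ x y, ⟪B x, y⟫ = ⟪x, B y⟫)
    {Δl Δr : Set X} (hl : MeasurableSet Δl) (hr : MeasurableSet Δr) (x y : L2 σ) :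
    HasSum (fun k => ⟪x, A (restrictProj σ Δl (e k))⟫ * ⟪B (restrictProj σ Δr (e k)), y⟫)
      ⟪x, A (restrictProj σ (Δl ∩ Δr) (B y))⟫ := by
  have h := e.hasSum_inner_mul_inner (restrictProj σ Δl (A x)) (restrictProj σ Δr (B y))
  rw [inner_restrictProj hl, hA, restrictProj_comp hl hr] at h
  simpa only [inner_restrictProj hl, hA, ← inner_restrictProj hr, ← hB] using h

theorem create_sum {G : Type u} [NormedAddCommGroup G] [InnerProductSpace ℂ G] (F : Finset ι)
    (c : ι → ℂ) (φ : ι → G) : create (∑ i ∈ F, c i • φ i) = ∑ i ∈ F, c i • create (φ i) := by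
  classical
  induction F using Finset.induction_on with
  | empty => rw [Finset.sum_empty, Finset.sum_empty, ← zero_smul ℂ (0 : G), create_smul, zero_smul]
  | insert i F hi ih => rw [Finset.sum_insert hi, Finset.sum_insert hi, create_add, create_smul, ih]

theorem annihilate_sum {G : Type u} [NormedAddCommGroup G] [InnerProductSpace ℂ G] (F : Finset ι)
    (c : ι → ℂ) (φ : ι → G) :
    annihilate (∑ i ∈ F, c i • φ i) = ∑ i ∈ F, star (c i) • annihilate (φ i) := by
  classical
  induction F using Finset.induction_on with
  | empty =>
    rw [Finset.sum_empty, Finset.sum_empty, ← zero_smul ℂ (0 : G), annihilate_smul, star_zero,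
      zero_smul]
  | insert i F hi ih =>
    rw [Finset.sum_insert hi, Finset.sum_insert hi, annihilate_add, annihilate_smul, ih]

variable {X₁ X₂ : Set X} {𝕂 : L2 σ →L[ℂ] L2 σ}

/-- The double series `W(Δ, R)` for `Δ ⊆ X₁`, summed along an orthonormal basis: the coefficients
of the double series are sums over `k` by Parseval's identity, for any factorization
`P Δl P Δr` of the projection `P Δ`. -/
theorem exists_hasSum_wTerm₁ (hK : IsSqrtPair (sqrtK₁ X₁ X₂ 𝕂) (sqrtK₂ X₁ X₂ 𝕂))
    (e : HilbertBasis ι ℂ (L2 σ)) (he : ∀ i, star (e i) = e i) {Δl Δr : Set X}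
    (hl : MeasurableSet Δl) (hr : MeasurableSet Δr)
    (hsl : Summable fun k => ‖sqrtK₁ X₁ X₂ 𝕂 (restrictProj σ Δl (e k))‖ ^ 2)
    (hsr : Summable fun k => ‖sqrtK₁ X₁ X₂ 𝕂 (restrictProj σ Δr (e k))‖ ^ 2)
    (R : FockOp (L2Double σ)) :
    ∃ S : FockOp (L2Double σ),
      (∀ f, HasSum (fun k => fieldOp (sqrtK₁ X₁ X₂ 𝕂) (sqrtK₂ X₁ X₂ 𝕂) (restrictProj σ Δl (e k))
        (R (fieldAdj (sqrtK₁ X₁ X₂ 𝕂) (sqrtK₂ X₁ X₂ 𝕂) (restrictProj σ Δr (e k)) f))) (S f)) ∧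
      HasStrongSum₂ (wTerm₁ X₁ X₂ 𝕂 e (Δl ∩ Δr) R) S := by
  set K₁ := sqrtK₁ X₁ X₂ 𝕂 with hK₁
  set K₂ := sqrtK₂ X₁ X₂ 𝕂 with hK₂
  obtain ⟨S, hS, hS'⟩ := exists_hasSum_fieldSeries e.orthonormal
    (inSnd σ ∘L K₂ ∘L restrictProj σ Δl) (inSnd σ ∘L K₂ ∘L restrictProj σ Δr)
    (h := fun k => inFst σ (star (K₁ (restrictProj σ Δl (e k)))))
    (h' := fun k => inFst σ (star (K₁ (restrictProj σ Δr (e k)))))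
    (by simpa only [norm_inFst, L2.norm_star] using hsl)
    (by simpa only [norm_inFst, L2.norm_star] using hsr)
    (norm_finProjDouble_le e.orthonormal)
    (fun F => isSelfAdjoint_directSumOp (inner_finProj _ F) (inner_finProj _ F))
    (tendsto_finProjDouble e) R
  refine ⟨S, hS, fun f => ?_⟩
  rw [← prod_atTop_atTop_eq]
  refine hS' f _ fun F F' => ?_
  have h1 (i : ι) (x : L2 σ) : ⟪e i, star x⟫ = ⟪x, e i⟫ := by rw [L2.inner_star_right, he]
  have h2 (i : ι) (x : L2 σ) : star ⟪e i, x⟫ = ⟪x, e i⟫ := inner_conj_symm _ _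
  have h2' (i : ι) (x : L2 σ) : star ⟪x, e i⟫ = ⟪e i, x⟫ := inner_conj_symm _ _
  simp only [finProjDouble_inFst, ContinuousLinearMap.comp_apply, finProjDouble_inSnd, create_sum,
    annihilate_sum, h1, h2, h2']
  exact hasSum_apply_sum_smul R f F F' (fun i => create₂ (e i)) (fun i => annihilate₁ (e i))
    (fun i => create₁ (e i)) (fun i => annihilate₂ (e i))
    (fun i j => hasSum_inner_mul_inner_restrictProj e hK.symm₂ hK.symm₁ hl hr (e i) (e j))
    (fun i j => hasSum_inner_mul_inner_restrictProj e hK.symm₁ hK.symm₂ hl hr (e i) (e j))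
    (fun i j => hasSum_inner_mul_inner_restrictProj e hK.symm₂ hK.symm₂ hl hr (e i) (e j))
    (fun i j => hasSum_inner_mul_inner_restrictProj e hK.symm₁ hK.symm₁ hl hr (e i) (e j))

/-- The analogue of `exists_hasSum_wTerm₁` for `Δ ⊆ X₂`, where the two kinds of fields change
places. -/
theorem exists_hasSum_wTerm₂ (hK : IsSqrtPair (sqrtK₁ X₁ X₂ 𝕂) (sqrtK₂ X₁ X₂ 𝕂))
    (e : HilbertBasis ι ℂ (L2 σ)) (he : ∀ i, star (e i) = e i) {Δl Δr : Set X}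
    (hl : MeasurableSet Δl) (hr : MeasurableSet Δr)
    (hsl : Summable fun k => ‖sqrtK₂ X₁ X₂ 𝕂 (restrictProj σ Δl (e k))‖ ^ 2)
    (hsr : Summable fun k => ‖sqrtK₂ X₁ X₂ 𝕂 (restrictProj σ Δr (e k))‖ ^ 2)
    (R : FockOp (L2Double σ)) :
    ∃ S : FockOp (L2Double σ),
      (∀ f, HasSum (fun k => fieldAdj (sqrtK₁ X₁ X₂ 𝕂) (sqrtK₂ X₁ X₂ 𝕂) (restrictProj σ Δl (e k))
        (R (fieldOp (sqrtK₁ X₁ X₂ 𝕂) (sqrtK₂ X₁ X₂ 𝕂) (restrictProj σ Δr (e k)) f))) (S f)) ∧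
      HasStrongSum₂ (wTerm₂ X₁ X₂ 𝕂 e (Δl ∩ Δr) R) S := by
  set K₁ := sqrtK₁ X₁ X₂ 𝕂 with hK₁
  set K₂ := sqrtK₂ X₁ X₂ 𝕂 with hK₂
  obtain ⟨S, hS, hS'⟩ := exists_hasSum_fieldSeries e.orthonormal
    (inFst σ ∘L conjOp (K₁ ∘L restrictProj σ Δl)) (inFst σ ∘L conjOp (K₁ ∘L restrictProj σ Δr))
    (h := fun k => inSnd σ (K₂ (restrictProj σ Δl (e k))))
    (h' := fun k => inSnd σ (K₂ (restrictProj σ Δr (e k))))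
    (by simpa only [norm_inSnd] using hsl)
    (by simpa only [norm_inSnd] using hsr)
    (norm_finProjDouble_le e.orthonormal)
    (fun F => isSelfAdjoint_directSumOp (inner_finProj _ F) (inner_finProj _ F))
    (tendsto_finProjDouble e) R
  refine ⟨S, fun f => ?_, fun f => ?_⟩
  · convert hS f using 2 with k
    simp only [fieldAdj, fieldOp, ContinuousLinearMap.comp_apply, conjOp_apply, he]
    rw [add_comm (create _), add_comm (create _)]
  rw [← prod_atTop_atTop_eq]
  refine hS' f _ fun F F' => ?_
  have h1 (i : ι) (x : L2 σ) : ⟪e i, star x⟫ = ⟪x, e i⟫ := by rw [L2.inner_star_right, he]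
  have h2 (i : ι) (x : L2 σ) : star ⟪e i, x⟫ = ⟪x, e i⟫ := inner_conj_symm _ _
  have h2' (i : ι) (x : L2 σ) : star ⟪x, e i⟫ = ⟪e i, x⟫ := inner_conj_symm _ _
  simp only [finProjDouble_inFst, ContinuousLinearMap.comp_apply, finProjDouble_inSnd, create_sum,
    annihilate_sum, conjOp_apply, he, h1, h2, h2']
  have key {A B : L2 σ →L[ℂ] L2 σ}
      (hA : ∀ x y, ⟪A x, y⟫ = ⟪x, A y⟫) (hB : ∀ x y, ⟪B x, y⟫ = ⟪x, B y⟫) (i j : ι) :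
      HasSum (fun k => ⟪B (restrictProj σ Δl (e k)), e i⟫ * ⟪e j, A (restrictProj σ Δr (e k))⟫)
        ⟪e j, A (restrictProj σ (Δl ∩ Δr) (B (e i)))⟫ := by
    have := hasSum_inner_mul_inner_restrictProj e hA hB hr hl (e j) (e i)
    rw [Set.inter_comm] at this
    simpa only [mul_comm] using this
  exact hasSum_apply_sum_smul R f F F' (fun i => create₁ (e i)) (fun i => annihilate₂ (e i))
    (fun i => create₂ (e i)) (fun i => annihilate₁ (e i))
    (key hK.symm₂ hK.symm₁) (key hK.symm₁ hK.symm₂) (key hK.symm₁ hK.symm₁) (key hK.symm₂ hK.symm₂)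

theorem HasStrongSum₂.unique {G : Type u} [NormedAddCommGroup G] [InnerProductSpace ℂ G]
    {T : ι → ι → FockOp G} {S S' : FockOp G} (h : HasStrongSum₂ T S) (h' : HasStrongSum₂ T S') :
    S = S' := by
  classical
  exact ContinuousLinearMap.ext fun f => tendsto_nhds_unique (h f) (h' f)

theorem HasStrongSum₂.strongSum₂_eq {G : Type u} [NormedAddCommGroup G] [InnerProductSpace ℂ G]
    {T : ι → ι → FockOp G} {S : FockOp G} (h : HasStrongSum₂ T S) : strongSum₂ T = S := by
  have h' : ∃ S, HasStrongSum₂ T S := ⟨S, h⟩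
  rw [strongSum₂, dif_pos h']
  exact h'.choose_spec.unique h

theorem strongSum₂_wTerm₁_empty (e : ι → L2 σ) (R : FockOp (L2Double σ)) :
    strongSum₂ (wTerm₁ X₁ X₂ 𝕂 e ∅ R) = 0 := by
  refine HasStrongSum₂.strongSum₂_eq fun f => ?_
  simpa [wTerm₁, restrictProj_empty] using tendsto_const_nhds

theorem strongSum₂_wTerm₂_empty (e : ι → L2 σ) (R : FockOp (L2Double σ)) :
    strongSum₂ (wTerm₂ X₁ X₂ 𝕂 e ∅ R) = 0 := by
  refine HasStrongSum₂.strongSum₂_eq fun f => ?_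
  simpa [wTerm₂, restrictProj_empty] using tendsto_const_nhds

end FieldSeries

section HilbertSchmidt

/-! ### Hilbert--Schmidt sums and kernels -/

theorem HilbertBasis.hasSum_norm_inner_sq {ι H : Type*} [NormedAddCommGroup H]
    [InnerProductSpace ℂ H] (b : HilbertBasis ι ℂ H) (x : H) :
    HasSum (fun i => ‖⟪b i, x⟫‖ ^ 2) (‖x‖ ^ 2) := by
  have h := Complex.hasSum_re (b.hasSum_inner_mul_inner x x)
  have h1 (i : ι) : (⟪x, b i⟫ * ⟪b i, x⟫).re = ‖⟪b i, x⟫‖ ^ 2 := by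
    rw [← inner_conj_symm]
    have h2 : (starRingEnd ℂ) ⟪b i, x⟫ * ⟪b i, x⟫ = ((‖⟪b i, x⟫‖ ^ 2 : ℝ) : ℂ) := by
      rw [RCLike.conj_mul]
      norm_cast
    rw [h2, Complex.ofReal_re]
  have h3 : (⟪x, x⟫).re = ‖x‖ ^ 2 := (norm_sq_eq_re_inner (𝕜 := ℂ) x).symm
  simpa only [h1, h3] using h

/-- `T` and its adjoint have the same Hilbert--Schmidt norm, computed in any bases; both sides are
`∑ i, ∑ j, |⟪b' j, T (b i)⟫|²`. -/
theorem tsum_ofReal_norm_sq_adjoint {ι ι' H H' : Type*} [NormedAddCommGroup H]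
    [InnerProductSpace ℂ H] [CompleteSpace H] [NormedAddCommGroup H'] [InnerProductSpace ℂ H']
    [CompleteSpace H'] (b : HilbertBasis ι ℂ H) (b' : HilbertBasis ι' ℂ H') (T : H →L[ℂ] H') :
    ∑' i, ENNReal.ofReal (‖T (b i)‖ ^ 2) = ∑' j, ENNReal.ofReal (‖T.adjoint (b' j)‖ ^ 2) := by
  have h1 (i : ι) : ENNReal.ofReal (‖T (b i)‖ ^ 2) =
      ∑' j, ENNReal.ofReal (‖⟪b' j, T (b i)⟫‖ ^ 2) := by
    have h := b'.hasSum_norm_inner_sq (T (b i))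
    rw [← h.tsum_eq, ENNReal.ofReal_tsum_of_nonneg (fun _ => by positivity) h.summable]
  have h2 (j : ι') : ENNReal.ofReal (‖T.adjoint (b' j)‖ ^ 2) =
      ∑' i, ENNReal.ofReal (‖⟪b' j, T (b i)⟫‖ ^ 2) := by
    have h := b.hasSum_norm_inner_sq (T.adjoint (b' j))
    rw [← h.tsum_eq, ENNReal.ofReal_tsum_of_nonneg (fun _ => by positivity) h.summable]
    refine tsum_congr fun i => ?_
    rw [ContinuousLinearMap.adjoint_inner_right, norm_inner_symm]
  simp only [h1, h2]
  exact ENNReal.tsum_comm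

/-- The Hilbert--Schmidt norm does not depend on the orthonormal basis. -/
theorem hasSum_norm_sq_of_hilbertBasis {ι ι' H H' : Type*} [NormedAddCommGroup H]
    [InnerProductSpace ℂ H] [CompleteSpace H] [NormedAddCommGroup H'] [InnerProductSpace ℂ H']
    [CompleteSpace H'] (b : HilbertBasis ι ℂ H) (b' : HilbertBasis ι' ℂ H) (T : H →L[ℂ] H')
    (h : Summable fun i => ‖T (b i)‖ ^ 2) :
    HasSum (fun j => ‖T (b' j)‖ ^ 2) (∑' i, ‖T (b i)‖ ^ 2) := by
  obtain ⟨w, c, -⟩ := exists_hilbertBasis ℂ H'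
  have h1 : ∑' j, ENNReal.ofReal (‖T (b' j)‖ ^ 2) = ENNReal.ofReal (∑' i, ‖T (b i)‖ ^ 2) := by
    rw [tsum_ofReal_norm_sq_adjoint b' c, ← tsum_ofReal_norm_sq_adjoint b c,
      ENNReal.ofReal_tsum_of_nonneg (fun _ => by positivity) h]
  have h2 := (ENNReal.summable (f := fun j => ENNReal.ofReal (‖T (b' j)‖ ^ 2))).hasSum
  rw [h1] at h2
  have h3 := ENNReal.hasSum_toReal (f := fun j => ENNReal.ofReal (‖T (b' j)‖ ^ 2))
    (by rw [h1]; exact ENNReal.ofReal_ne_top)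
  have h4 : ∀ j, (ENNReal.ofReal (‖T (b' j)‖ ^ 2)).toReal = ‖T (b' j)‖ ^ 2 := fun j =>
    ENNReal.toReal_ofReal (by positivity)
  have h5 : HasSum (fun j => ‖T (b' j)‖ ^ 2) (∑' j, ‖T (b' j)‖ ^ 2) := by
    simpa only [h4] using h3
  have h6 : ∑' j, ‖T (b' j)‖ ^ 2 = ∑' i, ‖T (b i)‖ ^ 2 := by
    rw [← ENNReal.ofReal_tsum_of_nonneg (fun _ => by positivity) h5.summable] at h1
    exact (ENNReal.ofReal_eq_ofReal_iff (tsum_nonneg fun _ => by positivity)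
      (tsum_nonneg fun _ => by positivity)).1 h1
  rwa [h6] at h5

theorem summable_of_norm_sum_sq_le {ι V : Type*} [NormedAddCommGroup V] [CompleteSpace V]
    {x : ι → V} {c : ι → ℝ} {C : ℝ} (hC : 0 ≤ C) (hc0 : ∀ k, 0 ≤ c k) (hc : Summable c)
    (h : ∀ s : Finset ι, ‖∑ k ∈ s, x k‖ ^ 2 ≤ C ^ 2 * ∑ k ∈ s, c k) : Summable x := by
  rw [summable_iff_vanishing_norm]
  intro ε hε
  obtain ⟨s, hs⟩ := summable_iff_vanishing_norm.1 hc ((ε / (C + 1)) ^ 2) (by positivity)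
  refine ⟨s, fun t ht => ?_⟩
  have h1 := (le_abs_self _).trans_lt (hs t ht)
  refine lt_of_pow_lt_pow_left₀ 2 hε.le ?_
  have h3 : (C + 1) ^ 2 * ∑ k ∈ t, c k < ε ^ 2 := by
    rw [div_pow, lt_div_iff₀ (by positivity)] at h1
    linarith
  refine ((h t).trans ?_).trans_lt h3
  have h2 : 0 ≤ ∑ k ∈ t, c k := Finset.sum_nonneg fun k _ => hc0 k
  gcongr
  linarith

variable {X : Type u} [MeasurableSpace X] {σ : Measure X} {ι : Type*}

theorem IsKernel.unique {S : L2 σ →L[ℂ] L2 σ} {κ κ' : HilbertTensor (L2 σ) (L2 σ)}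
    (h : IsKernel S κ) (h' : IsKernel S κ') : κ = κ' := by
  refine _root_.ext_inner_left ℂ fun z => ?_
  exact HilbertTensor.eq_of_tmul (S := fun z => ⟪z, κ⟫) (T := fun z => ⟪z, κ'⟫) (by fun_prop)
    (by fun_prop) (fun _ _ => inner_add_left _ _ _) (fun _ _ => inner_add_left _ _ _)
    (fun a b => (h a b).trans (h' a b).symm) z

theorem IsKernel.sub {S S' : L2 σ →L[ℂ] L2 σ} {κ κ' : HilbertTensor (L2 σ) (L2 σ)}
    (h : IsKernel S κ) (h' : IsKernel S' κ') : IsKernel (S - S') (κ - κ') := fun φ ψ => by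
  rw [inner_sub_right, h, h', sub_apply, inner_sub_right]

theorem IsKernel.isKernel_integralKernel {S : L2 σ →L[ℂ] L2 σ} {κ : HilbertTensor (L2 σ) (L2 σ)}
    (h : IsKernel S κ) : IsKernel S (integralKernel S) := by
  have h' : ∃ κ : HilbertTensor (L2 σ) (L2 σ), ∀ φ ψ : L2 σ,
      ⟪((φ ⊗ₜ[ℂ] ψ : L2 σ ⊗[ℂ] L2 σ) : HilbertTensor (L2 σ) (L2 σ)), κ⟫ = ⟪φ, S (star ψ)⟫ := ⟨κ, h⟩
  rw [integralKernel, dif_pos h']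
  exact h'.choose_spec

/-- The integral kernel of `A B*` is the sum of `A e ⊗ conj (B e)` over an orthonormal basis `e` of
real functions, if one of the two operators is Hilbert--Schmidt. -/
theorem exists_hasSum_isKernel (e : HilbertBasis ι ℂ (L2 σ)) (he : ∀ i, star (e i) = e i)
    (A B : L2 σ →L[ℂ] L2 σ)
    (h : (Summable fun k => ‖A (e k)‖ ^ 2) ∨ Summable fun k => ‖B (e k)‖ ^ 2) :
    ∃ κ : HilbertTensor (L2 σ) (L2 σ),
      HasSum (fun k => ((A (e k) ⊗ₜ[ℂ] star (B (e k)) : L2 σ ⊗[ℂ] L2 σ) :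
        HilbertTensor (L2 σ) (L2 σ))) κ ∧ IsKernel (A ∘L B.adjoint) κ := by
  have hs : Summable fun k => ((A (e k) ⊗ₜ[ℂ] star (B (e k)) : L2 σ ⊗[ℂ] L2 σ) :
      HilbertTensor (L2 σ) (L2 σ)) := by
    have hcoe (s : Finset ι) : ‖∑ k ∈ s, ((A (e k) ⊗ₜ[ℂ] star (B (e k)) : L2 σ ⊗[ℂ] L2 σ) :
        HilbertTensor (L2 σ) (L2 σ))‖ = 
          ‖∑ k ∈ s, (A (e k) ⊗ₜ[ℂ] star (B (e k)) : L2 σ ⊗[ℂ] L2 σ)‖ :=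
      (congrArg norm (map_sum (Completion.toComplL (𝕜 := ℂ) (E := L2 σ ⊗[ℂ] L2 σ))
        (fun k => A (e k) ⊗ₜ[ℂ] star (B (e k))) s).symm).trans (Completion.norm_coe _)
    rcases h with h | h
    · refine summable_of_norm_sum_sq_le (norm_nonneg (conjOp B)) (fun k => by positivity) h
        fun s => ?_
      have h1 := norm_sum_tmul_sq_le e.orthonormal (conjOp B) s fun k => A (e k)
      rw [hcoe]
      convert h1 using 2
      rw [← TensorProduct.norm_comm, map_sum]
      simp only [TensorProduct.comm_tmul, conjOp_apply, he]
    · refine summable_of_norm_sum_sq_le (norm_nonneg A) (fun k => by positivity) h fun s => ?_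
      have h1 := norm_sum_tmul_sq_le e.orthonormal A s fun k => star (B (e k))
      rw [hcoe]
      simpa only [L2.norm_star] using h1
  obtain ⟨κ, hκ⟩ := hs
  refine ⟨κ, hκ, fun φ ψ => ?_⟩
  have h1 := hκ.mapL (innerSL ℂ
    (((φ ⊗ₜ[ℂ] ψ : L2 σ ⊗[ℂ] L2 σ) : HilbertTensor (L2 σ) (L2 σ))))
  have h2 := e.hasSum_inner_mul_inner (A.adjoint φ) (B.adjoint (star ψ))
  rw [ContinuousLinearMap.adjoint_inner_left] at h2
  refine h1.unique ?_
  refine h2.congr_fun ?_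
  refine fun k => (Completion.inner_coe _ _).trans ?_
  rw [TensorProduct.inner_tmul, ContinuousLinearMap.adjoint_inner_left,
    ContinuousLinearMap.adjoint_inner_right, L2.inner_star_right]

/-! ### The operators `K₁` and `K₂` -/

theorem opSqrt_symm {H : Type u} [NormedAddCommGroup H] [InnerProductSpace ℂ H] [CompleteSpace H]
    (S : H →L[ℂ] H) (x y : H) : ⟪opSqrt S x, y⟫ = ⟪x, opSqrt S y⟫ :=
  ((ContinuousLinearMap.nonneg_iff_isPositive _).1 (CFC.sqrt_nonneg S)).isSymmetric x y

theorem opSqrt_apply_opSqrt_apply {H : Type u} [NormedAddCommGroup H] [InnerProductSpace ℂ H]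
    [CompleteSpace H] {S : H →L[ℂ] H} (hS : 0 ≤ S) (x : H) : opSqrt S (opSqrt S x) = S x :=
  congrArg (fun T : H →L[ℂ] H => T x) (CFC.sqrt_mul_sqrt_self S hS)

variable {X₁ X₂ : Set X} {𝕂 : L2 σ →L[ℂ] L2 σ}

theorem isSqrtPair_sqrtK (hK₀ : 0 ≤ hatOp σ X₁ X₂ 𝕂) (hK₁ : hatOp σ X₁ X₂ 𝕂 ≤ 1) :
    IsSqrtPair (sqrtK₁ X₁ X₂ 𝕂) (sqrtK₂ X₁ X₂ 𝕂) where
  symm₁ := opSqrt_symm _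
  symm₂ := opSqrt_symm _
  sq_add_sq x := by
    rw [sqrtK₁, sqrtK₂, opSqrt_apply_opSqrt_apply hK₀,
      opSqrt_apply_opSqrt_apply (sub_nonneg.2 hK₁), sub_apply, one_apply_eq_self,
      add_sub_cancel]

/-- On `X₁`, the operator `𝕂` is locally positive: it coincides with `K = K₁²`. -/
theorem restrictProj_comp_comp_of_subset_fst (hX : IsCompl X₁ X₂) (hX₁ : MeasurableSet X₁)
    (hK₀ : 0 ≤ hatOp σ X₁ X₂ 𝕂) {Δ : Set X} (hΔ : MeasurableSet Δ) (h : Δ ⊆ X₁) :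
    restrictProj σ Δ ∘L 𝕂 ∘L restrictProj σ Δ =
      (sqrtK₁ X₁ X₂ 𝕂 ∘L restrictProj σ Δ).adjoint ∘L (sqrtK₁ X₁ X₂ 𝕂 ∘L restrictProj σ Δ) := by
  have hX₂ : MeasurableSet X₂ := hX.compl_eq ▸ hX₁.compl
  have hd : X₂ ∩ Δ = ∅ := (hX.disjoint.symm.mono_right h).inter_eq
  refine ContinuousLinearMap.ext fun f => _root_.ext_inner_left ℂ fun g => ?_
  simp only [ContinuousLinearMap.comp_apply]
  rw [ContinuousLinearMap.adjoint_inner_right, ContinuousLinearMap.comp_apply, sqrtK₁, opSqrt_symm,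
    opSqrt_apply_opSqrt_apply hK₀, inner_restrictProj hΔ, hatOp, add_apply,
    ContinuousLinearMap.comp_apply, ContinuousLinearMap.comp_apply, restrictProj_comp hX₁ hΔ,
    restrictProj_comp hX₂ hΔ, hd, restrictProj_empty, map_zero, add_zero,
    Set.inter_eq_self_of_subset_right h]

/-- On `X₂`, the operator `𝕂` is locally positive: it coincides with `1 - K = K₂²`. -/
theorem restrictProj_comp_comp_of_subset_snd (hX : IsCompl X₁ X₂) (hX₁ : MeasurableSet X₁)
    (hK₁ : hatOp σ X₁ X₂ 𝕂 ≤ 1) {Δ : Set X} (hΔ : MeasurableSet Δ) (h : Δ ⊆ X₂) :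
    restrictProj σ Δ ∘L 𝕂 ∘L restrictProj σ Δ =
      (sqrtK₂ X₁ X₂ 𝕂 ∘L restrictProj σ Δ).adjoint ∘L (sqrtK₂ X₁ X₂ 𝕂 ∘L restrictProj σ Δ) := by
  have hX₂ : MeasurableSet X₂ := hX.compl_eq ▸ hX₁.compl
  have hd : X₁ ∩ Δ = ∅ := (hX.disjoint.mono_right h).inter_eq
  refine ContinuousLinearMap.ext fun f => _root_.ext_inner_left ℂ fun g => ?_
  simp only [ContinuousLinearMap.comp_apply]
  rw [ContinuousLinearMap.adjoint_inner_right, ContinuousLinearMap.comp_apply, sqrtK₂, opSqrt_symm,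
    opSqrt_apply_opSqrt_apply (sub_nonneg.2 hK₁), inner_restrictProj hΔ, sub_apply, hatOp,
    add_apply, ContinuousLinearMap.comp_apply, ContinuousLinearMap.comp_apply,
    restrictProj_comp hX₁ hΔ, restrictProj_comp hX₂ hΔ, hd, restrictProj_empty, map_zero, zero_add,
    Set.inter_eq_self_of_subset_right h, sub_apply, one_apply_eq_self, sub_sub_cancel]

/-- If `T* T` is of trace class, then `T` is Hilbert--Schmidt, and the trace of `T* T` is the square
of the Hilbert--Schmidt norm of `T`. -/
theorem IsTraceClass.hasSum_norm_sq {H H' : Type u} [NormedAddCommGroup H] [InnerProductSpace ℂ H]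
    [CompleteSpace H] [NormedAddCommGroup H'] [InnerProductSpace ℂ H'] [CompleteSpace H']
    {T : H →L[ℂ] H'} (h : IsTraceClass (T.adjoint ∘L T)) (e : HilbertBasis ι ℂ H) :
    ∃ t : ℝ, HasSum (fun k => ‖T (e k)‖ ^ 2) t ∧ hilbertTrace (T.adjoint ∘L T) = t := by
  have hpos : 0 ≤ T.adjoint ∘L T :=
    (ContinuousLinearMap.nonneg_iff_isPositive _).2 (ContinuousLinearMap.isPositive_adjoint_comp_self T)
  have hinner (x : H) : ⟪x, (T.adjoint ∘L T) x⟫ = ((‖T x‖ ^ 2 : ℝ) : ℂ) := by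
    rw [ContinuousLinearMap.comp_apply, ContinuousLinearMap.adjoint_inner_right,
      inner_self_eq_norm_sq_to_K]
    norm_cast
  set b := (exists_hilbertBasis ℂ H).choose_spec.choose with hb
  have hs := h _ b
  rw [CFC.abs_of_nonneg _ hpos] at hs
  simp only [hinner] at hs
  have hs' := Complex.summable_ofReal.1 hs
  refine ⟨_, hasSum_norm_sq_of_hilbertBasis b e T hs', ?_⟩
  change ∑' i, ⟪b i, (T.adjoint ∘L T) (b i)⟫ = _
  simp only [hinner]
  rw [Complex.ofReal_tsum]

end HilbertSchmidt

/-! ### Wick polynomials -/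

section Wick

variable {X : Type*} {A : Type*} [Ring A] (ρ : Set X → A)

theorem wickPoly_snoc (n : ℕ) (Δ : Fin (n + 1) → Set X) (B : Set X) :
    wickPoly ρ (n + 1) (Fin.snoc (α := fun _ => Set X) Δ B) =
      ρ B * wickPoly ρ n Δ - ∑ i, wickPoly ρ n (Function.update Δ i (Δ i ∩ B)) := by
  rw [wickPoly, Fin.snoc_last, Fin.init_snoc]
  simp only [Fin.snoc_castSucc]

theorem wickPoly_snoc_snoc (n : ℕ) (Δ : Fin (n + 1) → Set X) (B C : Set X) :
    wickPoly ρ (n + 2) (Fin.snoc (α := fun _ => Set X) (Fin.snoc (α := fun _ => Set X) Δ B) C) =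
      ρ C * wickPoly ρ (n + 1) (Fin.snoc (α := fun _ => Set X) Δ B)
        - ∑ i, wickPoly ρ (n + 1)
            (Fin.snoc (α := fun _ => Set X) (Function.update Δ i (Δ i ∩ C)) B)
        - wickPoly ρ (n + 1) (Fin.snoc (α := fun _ => Set X) Δ (B ∩ C)) := by
  rw [wickPoly_snoc ρ (n + 1), Fin.sum_univ_castSucc, sub_sub]
  simp only [Fin.snoc_castSucc, Fin.snoc_last, Fin.update_snoc_last, ← Fin.snoc_update]

/-- Wick polynomials are symmetric in the last two sets if the corresponding operators commute. -/
theorem wickPoly_snoc_snoc_comm (n : ℕ) (Δ : Fin (n + 1) → Set X) (B C : Set X)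
    (h : ρ B * ρ C = ρ C * ρ B) :
    wickPoly ρ (n + 2) (Fin.snoc (α := fun _ => Set X) (Fin.snoc (α := fun _ => Set X) Δ B) C) =
      wickPoly ρ (n + 2)
        (Fin.snoc (α := fun _ => Set X) (Fin.snoc (α := fun _ => Set X) Δ C) B) := by
  have hd : ∑ i, ∑ j, wickPoly ρ n (Function.update (Function.update Δ i (Δ i ∩ C)) j
        (Function.update Δ i (Δ i ∩ C) j ∩ B)) =
      ∑ i, ∑ j, wickPoly ρ n (Function.update (Function.update Δ i (Δ i ∩ B)) j
        (Function.update Δ i (Δ i ∩ B) j ∩ C)) := by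
    rw [Finset.sum_comm]
    refine Finset.sum_congr rfl fun j _ => Finset.sum_congr rfl fun i _ => ?_
    congr 1
    by_cases hij : i = j
    · subst hij
      simp only [Function.update_self, Function.update_idem]
      rw [Set.inter_right_comm]
    · rw [Function.update_of_ne (Ne.symm hij), Function.update_of_ne hij,
        Function.update_comm hij]
  rw [wickPoly_snoc_snoc, wickPoly_snoc_snoc]
  simp only [wickPoly_snoc, Finset.sum_sub_distrib, mul_sub, ← Finset.mul_sum]
  rw [hd, ← mul_assoc, ← mul_assoc, h, Set.inter_comm B C]
  abel

end Wick

section Vacuum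

/-! ### Commutators and vacuum vectors of quadratic expressions in the fields -/

variable {X : Type u} [MeasurableSpace X] {σ : Measure X} {ι : Type*}

theorem fieldOp_add (K₁ K₂ : L2 σ →L[ℂ] L2 σ) (u v : L2 σ) :
    fieldOp K₁ K₂ (u + v) = fieldOp K₁ K₂ u + fieldOp K₁ K₂ v := by
  simp only [fieldOp, map_add, L2.star_add, create_add, annihilate_add]
  abel

theorem fieldAdj_add (K₁ K₂ : L2 σ →L[ℂ] L2 σ) (u v : L2 σ) :
    fieldAdj K₁ K₂ (u + v) = fieldAdj K₁ K₂ u + fieldAdj K₁ K₂ v := by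
  simp only [fieldAdj, map_add, L2.star_add, create_add, annihilate_add]
  abel

theorem fieldOp_sub (K₁ K₂ : L2 σ →L[ℂ] L2 σ) (u v : L2 σ) :
    fieldOp K₁ K₂ (u - v) = fieldOp K₁ K₂ u - fieldOp K₁ K₂ v := by
  rw [sub_eq_add_neg, fieldOp_add, fieldOp_neg, sub_eq_add_neg]

theorem fieldAdj_sub (K₁ K₂ : L2 σ →L[ℂ] L2 σ) (u v : L2 σ) :
    fieldAdj K₁ K₂ (u - v) = fieldAdj K₁ K₂ u - fieldAdj K₁ K₂ v := by
  rw [sub_eq_add_neg, fieldAdj_add, fieldAdj_neg, sub_eq_add_neg]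

theorem fieldOp_smul (K₁ K₂ : L2 σ →L[ℂ] L2 σ) (c : ℂ) (u : L2 σ) :
    fieldOp K₁ K₂ (c • u) = c • fieldOp K₁ K₂ u := by
  simp only [fieldOp, map_smul, L2.star_smul, create_smul, annihilate_smul, star_star, smul_add]

theorem fieldAdj_smul (K₁ K₂ : L2 σ →L[ℂ] L2 σ) (c : ℂ) (u : L2 σ) :
    fieldAdj K₁ K₂ (c • u) = star c • fieldAdj K₁ K₂ u := by
  simp only [fieldAdj, map_smul, L2.star_smul, create_smul, annihilate_smul, smul_add]

theorem continuous_fieldOp (K₁ K₂ : L2 σ →L[ℂ] L2 σ) (f : FockFin (L2Double σ)) :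
    Continuous fun u => fieldOp K₁ K₂ u f :=
  ((continuous_create f).comp ((inSnd σ).continuous.comp K₂.continuous)).add
    ((continuous_annihilate f).comp
      ((inFst σ).continuous.comp ((L2.conj σ).continuous.comp K₁.continuous)))

theorem continuous_fieldAdj (K₁ K₂ : L2 σ →L[ℂ] L2 σ) (f : FockFin (L2Double σ)) :
    Continuous fun u => fieldAdj K₁ K₂ u f :=
  ((continuous_annihilate f).comp ((inSnd σ).continuous.comp K₂.continuous)).add
    ((continuous_create f).comp
      ((inFst σ).continuous.comp ((L2.conj σ).continuous.comp K₁.continuous)))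

theorem hasSum_inner_smul_restrictProj (e : HilbertBasis ι ℂ (L2 σ)) {Δ : Set X}
    (hΔ : MeasurableSet Δ) (v : L2 σ) :
    HasSum (fun k => ⟪restrictProj σ Δ (e k), v⟫ • restrictProj σ Δ (e k))
      (restrictProj σ Δ v) := by
  have h := (e.hasSum_repr (restrictProj σ Δ v)).mapL (restrictProj σ Δ)
  rw [restrictProj_idem hΔ] at h
  simpa only [e.repr_apply_apply, map_smul, inner_restrictProj hΔ] using h

theorem hasSum_inner_smul_fieldOp (e : HilbertBasis ι ℂ (L2 σ)) (K₁ K₂ : L2 σ →L[ℂ] L2 σ)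
    {Δ : Set X} (hΔ : MeasurableSet Δ) (v : L2 σ) (f : FockFin (L2Double σ)) :
    HasSum (fun k => ⟪restrictProj σ Δ (e k), v⟫ • fieldOp K₁ K₂ (restrictProj σ Δ (e k)) f)
      (fieldOp K₁ K₂ (restrictProj σ Δ v) f) := by
  have h := (hasSum_inner_smul_restrictProj e hΔ v).map
    (AddMonoidHom.mk' (fun u => fieldOp K₁ K₂ u f) fun u v => by rw [fieldOp_add, add_apply])
    (continuous_fieldOp K₁ K₂ f)
  refine h.congr_fun fun k => ?_
  change _ = fieldOp K₁ K₂ (_ • _) f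
  rw [fieldOp_smul, smul_apply]

theorem hasSum_inner_smul_fieldAdj (e : HilbertBasis ι ℂ (L2 σ)) (K₁ K₂ : L2 σ →L[ℂ] L2 σ)
    {Δ : Set X} (hΔ : MeasurableSet Δ) (v : L2 σ) (f : FockFin (L2Double σ)) :
    HasSum (fun k => ⟪v, restrictProj σ Δ (e k)⟫ • fieldAdj K₁ K₂ (restrictProj σ Δ (e k)) f)
      (fieldAdj K₁ K₂ (restrictProj σ Δ v) f) := by
  have h := (hasSum_inner_smul_restrictProj e hΔ v).map
    (AddMonoidHom.mk' (fun u => fieldAdj K₁ K₂ u f) fun u v => by rw [fieldAdj_add, add_apply])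
    (continuous_fieldAdj K₁ K₂ f)
  refine h.congr_fun fun k => ?_
  change _ = fieldAdj K₁ K₂ (_ • _) f
  rw [fieldAdj_smul, smul_apply]
  congr 1
  exact (inner_conj_symm _ _).symm

theorem fieldAdj_mul_create (K₁ K₂ : L2 σ →L[ℂ] L2 σ) (u : L2 σ) (φ : L2Double σ) :
    fieldAdj K₁ K₂ u * create φ =
      ⟪K₂ u, φ.snd⟫ • (1 : FockOp (L2Double σ)) - create φ * fieldAdj K₁ K₂ u := by
  rw [fieldAdj, add_mul, annihilate_mul_create, inner_inSnd, create_mul_create _ φ, mul_add]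
  abel

theorem fieldOp_mul_create (K₁ K₂ : L2 σ →L[ℂ] L2 σ) (u : L2 σ) (φ : L2Double σ) :
    fieldOp K₁ K₂ u * create φ =
      ⟪star φ.fst, K₁ u⟫ • (1 : FockOp (L2Double σ)) - create φ * fieldOp K₁ K₂ u := by
  rw [fieldOp, add_mul, annihilate_mul_create, inner_inFst, create_mul_create _ φ, mul_add,
    L2.inner_star_left]
  abel

/-- The commutator of the density with a creation operator is again a field. By
`FockOp.eq_of_commute_create`, this and the vacuum vector determine the density. -/
theorem densityOp_mul_create_eq_field {K₁ K₂ J : L2 σ →L[ℂ] L2 σ}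
    {k : HilbertTensor (L2 σ) (L2 σ)} (hK : IsSqrtPair K₁ K₂)
    (hJ : ∀ x y, ⟪J x, y⟫ = ⟪x, J y⟫) (hk : IsKernel (K₂ ∘L J ∘L K₁) k) (t : ℂ)
    (φ : L2Double σ) :
    densityOp K₁ K₂ J k t * create φ - create φ * densityOp K₁ K₂ J k t =
      fieldOp K₁ K₂ (J (K₂ φ.snd)) - fieldAdj K₁ K₂ (J (K₁ (star φ.fst))) := by
  rw [densityOp_mul_create hK hJ hk, fieldOp, fieldAdj, create_sub, annihilate_sub]
  abel

theorem annihilatePair_fockWedge_zero (κ : HilbertTensor (L2Double σ) (L2Double σ))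
    (v : Fin 0 → L2Double σ) : annihilatePair κ (fockWedge 0 v) = 0 :=
  (annihilatePair_of κ 0 _).trans (map_zero (FockFin.of (G := L2Double σ) _))

theorem secondQuant_fockWedge_zero (B : L2Double σ →L[ℂ] L2Double σ)
    (v : Fin 0 → L2Double σ) : secondQuant B (fockWedge 0 v) = 0 := by
  rw [secondQuant_fockWedge, Finset.univ_eq_empty, Finset.sum_empty]

theorem pairTwoOne_tmul (a b : L2 σ) :
    pairTwoOne ((a ⊗ₜ[ℂ] b : L2 σ ⊗[ℂ] L2 σ) : HilbertTensor (L2 σ) (L2 σ)) =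
      ((inSnd σ a ⊗ₜ[ℂ] inFst σ b : L2Double σ ⊗[ℂ] L2Double σ) :
        HilbertTensor (L2Double σ) (L2Double σ)) :=
  (ContinuousLinearMap.completion_apply_coe _ _).trans rfl

/-- On the vacuum, the product of the two fields yields a pair of particles and a multiple of the
vacuum. -/
theorem fieldOp_fieldAdj_vacuum (K₁ K₂ : L2 σ →L[ℂ] L2 σ) (u : L2 σ) (v : Fin 0 → L2Double σ) :
    fieldOp K₁ K₂ u (fieldAdj K₁ K₂ u (fockWedge 0 v)) =
      createPair (pairTwoOne ((K₂ u ⊗ₜ[ℂ] star (K₁ u) : L2 σ ⊗[ℂ] L2 σ) :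
        HilbertTensor (L2 σ) (L2 σ))) (fockWedge 0 v) + ((‖K₁ u‖ ^ 2 : ℝ) : ℂ) • fockWedge 0 v := by
  have h1 : fieldAdj K₁ K₂ u (fockWedge 0 v) = create (inFst σ (star (K₁ u))) (fockWedge 0 v) := by
    rw [fieldAdj, add_apply, annihilate_fockWedge_zero, zero_add]
  rw [h1, ← mul_apply_eq_comp, fieldOp_mul_create, inFst_fst, star_star, sub_apply, smul_apply,
    one_apply_eq_self, mul_apply_eq_comp, pairTwoOne_tmul, createPair_tmul, mul_apply_eq_comp,
    fieldOp, add_apply, annihilate_fockWedge_zero, add_zero, inner_self_eq_norm_sq_to_K,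
    ← mul_apply_eq_comp (create (inFst σ _)), create_mul_create, neg_apply, sub_neg_eq_add,
    mul_apply_eq_comp, add_comm]
  norm_cast

theorem fieldAdj_fieldOp_vacuum (K₁ K₂ : L2 σ →L[ℂ] L2 σ) (u : L2 σ) (v : Fin 0 → L2Double σ) :
    fieldAdj K₁ K₂ u (fieldOp K₁ K₂ u (fockWedge 0 v)) =
      ((‖K₂ u‖ ^ 2 : ℝ) : ℂ) • fockWedge 0 v -
      createPair (pairTwoOne ((K₂ u ⊗ₜ[ℂ] star (K₁ u) : L2 σ ⊗[ℂ] L2 σ) :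
        HilbertTensor (L2 σ) (L2 σ))) (fockWedge 0 v) := by
  have h1 : fieldOp K₁ K₂ u (fockWedge 0 v) = create (inSnd σ (K₂ u)) (fockWedge 0 v) := by
    rw [fieldOp, add_apply, annihilate_fockWedge_zero, add_zero]
  rw [h1, ← mul_apply_eq_comp, fieldAdj_mul_create, inSnd_snd, sub_apply, smul_apply,
    one_apply_eq_self, mul_apply_eq_comp, pairTwoOne_tmul, createPair_tmul, mul_apply_eq_comp,
    fieldAdj, add_apply, annihilate_fockWedge_zero, zero_add, inner_self_eq_norm_sq_to_K]
  norm_cast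

end Vacuum

section Insertion

/-! ### The operators `W(Δ, R)` and the density -/

variable {X : Type u} [TopologicalSpace X] [MeasurableSpace X] {σ : Measure X} {ι : Type*}

theorem IsBoundedBorel.inter {Δ Δ' : Set X} (h : IsBoundedBorel Δ) (h' : MeasurableSet Δ') :
    IsBoundedBorel (Δ ∩ Δ') :=
  ⟨h.1.inter h', h.2.of_isClosed_subset isClosed_closure (closure_mono Set.inter_subset_left)⟩

/-- What the proof uses of the operator `𝕂` and of the basis `e`: `K₁` and `K₂` are symmetric with
`K₁² + K₂² = 1`, the operators `K₁ P Δ` for `Δ ⊆ X₁` and `K₂ P Δ` for `Δ ⊆ X₂` are Hilbert--Schmidt,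
the squares of their Hilbert--Schmidt norms being traces of `P Δ 𝕂 P Δ`, and `e` is real. -/
structure IsAdmissible (X₁ X₂ : Set X) (𝕂 : L2 σ →L[ℂ] L2 σ) (e : HilbertBasis ι ℂ (L2 σ)) :
    Prop where
  meas : MeasurableSet X₁
  compl : IsCompl X₁ X₂
  pair : IsSqrtPair (sqrtK₁ X₁ X₂ 𝕂) (sqrtK₂ X₁ X₂ 𝕂)
  real : ∀ i, star (e i) = e i
  trace₁ : ∀ Δ, IsBoundedBorel Δ → Δ ⊆ X₁ → ∃ t : ℝ,
    HasSum (fun k => ‖sqrtK₁ X₁ X₂ 𝕂 (restrictProj σ Δ (e k))‖ ^ 2) t ∧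
      hilbertTrace (restrictProj σ Δ ∘L 𝕂 ∘L restrictProj σ Δ) = t
  trace₂ : ∀ Δ, IsBoundedBorel Δ → Δ ⊆ X₂ → ∃ t : ℝ,
    HasSum (fun k => ‖sqrtK₂ X₁ X₂ 𝕂 (restrictProj σ Δ (e k))‖ ^ 2) t ∧
      hilbertTrace (restrictProj σ Δ ∘L 𝕂 ∘L restrictProj σ Δ) = t

theorem isAdmissible {X₁ X₂ : Set X} {𝕂 : L2 σ →L[ℂ] L2 σ} (e : HilbertBasis ι ℂ (L2 σ))
    (hX₁ : MeasurableSet X₁) (hX : IsCompl X₁ X₂)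
    (h₁ : IsLocallyTraceClassOn σ X₁ 𝕂) (h₂ : IsLocallyTraceClassOn σ X₂ 𝕂)
    (hK₀ : 0 ≤ hatOp σ X₁ X₂ 𝕂) (hK₁ : hatOp σ X₁ X₂ 𝕂 ≤ 1) (he : ∀ i, star (e i) = e i) :
    IsAdmissible X₁ X₂ 𝕂 e where
  meas := hX₁
  compl := hX
  pair := isSqrtPair_sqrtK hK₀ hK₁
  real := he
  trace₁ Δ hΔ h := by
    have ht := h₁ Δ hΔ h
    rw [restrictProj_comp_comp_of_subset_fst hX hX₁ hK₀ hΔ.1 h] at ht ⊢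
    exact ht.hasSum_norm_sq e
  trace₂ Δ hΔ h := by
    have ht := h₂ Δ hΔ h
    rw [restrictProj_comp_comp_of_subset_snd hX hX₁ hK₁ hΔ.1 h] at ht ⊢
    exact ht.hasSum_norm_sq e

/-- The `k`-th term of the series for `W(Δl ∩ Δr, R)`. Localizing the left and the right factor by
different sets expresses `W(Δl ∩ Δr, R)` with only one of the factors changed when the density is
commuted past it. -/
def insertTerm (X₁ X₂ : Set X) (𝕂 : L2 σ →L[ℂ] L2 σ) (e : ι → L2 σ) (Δl Δr : Set X)
    (R : FockOp (L2Double σ)) (k : ι) : FockOp (L2Double σ) :=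
  fieldOp (sqrtK₁ X₁ X₂ 𝕂) (sqrtK₂ X₁ X₂ 𝕂) (restrictProj σ (Δl ∩ X₁) (e k)) * R *
      fieldAdj (sqrtK₁ X₁ X₂ 𝕂) (sqrtK₂ X₁ X₂ 𝕂) (restrictProj σ (Δr ∩ X₁) (e k))
    + fieldAdj (sqrtK₁ X₁ X₂ 𝕂) (sqrtK₂ X₁ X₂ 𝕂) (restrictProj σ (Δl ∩ X₂) (e k)) * R *
      fieldOp (sqrtK₁ X₁ X₂ 𝕂) (sqrtK₂ X₁ X₂ 𝕂) (restrictProj σ (Δr ∩ X₂) (e k))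

namespace IsAdmissible

variable {X₁ X₂ : Set X} {𝕂 : L2 σ →L[ℂ] L2 σ} {e : HilbertBasis ι ℂ (L2 σ)}

theorem meas₂ (H : IsAdmissible X₁ X₂ 𝕂 e) : MeasurableSet X₂ :=
  H.compl.compl_eq ▸ H.meas.compl

theorem exists_hasSum₁ (H : IsAdmissible X₁ X₂ 𝕂 e) {Δl Δr : Set X} (hl : IsBoundedBorel Δl)
    (hr : IsBoundedBorel Δr) (hl' : Δl ⊆ X₁) (hr' : Δr ⊆ X₁) (R : FockOp (L2Double σ)) :
    ∃ S : FockOp (L2Double σ),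
      (∀ f, HasSum (fun k => fieldOp (sqrtK₁ X₁ X₂ 𝕂) (sqrtK₂ X₁ X₂ 𝕂) (restrictProj σ Δl (e k))
        (R (fieldAdj (sqrtK₁ X₁ X₂ 𝕂) (sqrtK₂ X₁ X₂ 𝕂) (restrictProj σ Δr (e k)) f))) (S f)) ∧
      HasStrongSum₂ (wTerm₁ X₁ X₂ 𝕂 e (Δl ∩ Δr) R) S := by
  obtain ⟨t, ht, -⟩ := H.trace₁ Δl hl hl'
  obtain ⟨t', ht', -⟩ := H.trace₁ Δr hr hr'
  exact exists_hasSum_wTerm₁ H.pair e H.real hl.1 hr.1 ht.summable ht'.summable R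

theorem exists_hasSum₂ (H : IsAdmissible X₁ X₂ 𝕂 e) {Δl Δr : Set X} (hl : IsBoundedBorel Δl)
    (hr : IsBoundedBorel Δr) (hl' : Δl ⊆ X₂) (hr' : Δr ⊆ X₂) (R : FockOp (L2Double σ)) :
    ∃ S : FockOp (L2Double σ),
      (∀ f, HasSum (fun k => fieldAdj (sqrtK₁ X₁ X₂ 𝕂) (sqrtK₂ X₁ X₂ 𝕂) (restrictProj σ Δl (e k))
        (R (fieldOp (sqrtK₁ X₁ X₂ 𝕂) (sqrtK₂ X₁ X₂ 𝕂) (restrictProj σ Δr (e k)) f))) (S f)) ∧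
      HasStrongSum₂ (wTerm₂ X₁ X₂ 𝕂 e (Δl ∩ Δr) R) S := by
  obtain ⟨t, ht, -⟩ := H.trace₂ Δl hl hl'
  obtain ⟨t', ht', -⟩ := H.trace₂ Δr hr hr'
  exact exists_hasSum_wTerm₂ H.pair e H.real hl.1 hr.1 ht.summable ht'.summable R

theorem hasStrongSum₂_wTerm₁ (H : IsAdmissible X₁ X₂ 𝕂 e) {Δ : Set X} (hΔ : IsBoundedBorel Δ)
    (h : Δ ⊆ X₁) (R : FockOp (L2Double σ)) :
    HasStrongSum₂ (wTerm₁ X₁ X₂ 𝕂 e Δ R) (wickInsert X₁ X₂ 𝕂 e Δ R) := by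
  obtain ⟨S, -, hS⟩ := H.exists_hasSum₁ hΔ hΔ h h R
  rw [Set.inter_self] at hS
  have h2 : Δ ∩ X₂ = ∅ := (H.compl.disjoint.mono_left h).inter_eq
  rwa [wickInsert, h2, strongSum₂_wTerm₂_empty, add_zero, Set.inter_eq_self_of_subset_left h,
    hS.strongSum₂_eq]

theorem hasStrongSum₂_wTerm₂ (H : IsAdmissible X₁ X₂ 𝕂 e) {Δ : Set X} (hΔ : IsBoundedBorel Δ)
    (h : Δ ⊆ X₂) (R : FockOp (L2Double σ)) :
    HasStrongSum₂ (wTerm₂ X₁ X₂ 𝕂 e Δ R) (wickInsert X₁ X₂ 𝕂 e Δ R) := by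
  obtain ⟨S, -, hS⟩ := H.exists_hasSum₂ hΔ hΔ h h R
  rw [Set.inter_self] at hS
  have h2 : Δ ∩ X₁ = ∅ := (H.compl.disjoint.symm.mono_left h).inter_eq
  rwa [wickInsert, h2, strongSum₂_wTerm₁_empty, zero_add, Set.inter_eq_self_of_subset_left h,
    hS.strongSum₂_eq]

theorem hasSum_insertTerm (H : IsAdmissible X₁ X₂ 𝕂 e) {Δl Δr : Set X} (hl : IsBoundedBorel Δl)
    (hr : IsBoundedBorel Δr) (R : FockOp (L2Double σ)) (f : FockFin (L2Double σ)) :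
    HasSum (fun k => insertTerm X₁ X₂ 𝕂 e Δl Δr R k f)
      (wickInsert X₁ X₂ 𝕂 e (Δl ∩ Δr) R f) := by
  obtain ⟨S, hS, hS'⟩ := H.exists_hasSum₁ (hl.inter H.meas) (hr.inter H.meas)
    Set.inter_subset_right Set.inter_subset_right R
  obtain ⟨T, hT, hT'⟩ := H.exists_hasSum₂ (hl.inter H.meas₂) (hr.inter H.meas₂)
    Set.inter_subset_right Set.inter_subset_right R
  rw [← Set.inter_inter_distrib_right] at hS' hT'
  rw [wickInsert, hS'.strongSum₂_eq, hT'.strongSum₂_eq]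
  exact (hS f).add (hT f)

theorem wickInsert_add (H : IsAdmissible X₁ X₂ 𝕂 e) {Δ : Set X} (hΔ : IsBoundedBorel Δ)
    (R R' : FockOp (L2Double σ)) :
    wickInsert X₁ X₂ 𝕂 e Δ (R + R') = wickInsert X₁ X₂ 𝕂 e Δ R + wickInsert X₁ X₂ 𝕂 e Δ R' := by
  refine ContinuousLinearMap.ext fun f => ?_
  have h := H.hasSum_insertTerm hΔ hΔ (R + R') f
  have h' := (H.hasSum_insertTerm hΔ hΔ R f).add (H.hasSum_insertTerm hΔ hΔ R' f)
  rw [Set.inter_self] at h h'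
  refine h.unique (h'.congr_fun fun k => ?_)
  rw [← add_apply]
  congr 1
  simp only [insertTerm, mul_add, add_mul]
  abel

/-- The operator `K₂ J K₁` in the definition of `ρ(Δ)` has an integral kernel, which is a difference
of two series over the basis, and the traces in `ρ(Δ)` are squares of Hilbert--Schmidt norms. -/
theorem exists_particleDensity_eq (H : IsAdmissible X₁ X₂ 𝕂 e) {Δ : Set X}
    (hΔ : IsBoundedBorel Δ) :
    ∃ (k₁ k₂ : HilbertTensor (L2 σ) (L2 σ)) (t₁ t₂ : ℝ),
      HasSum (fun k => (((sqrtK₂ X₁ X₂ 𝕂 (restrictProj σ (Δ ∩ X₁) (e k))) ⊗ₜ[ℂ]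
        star (sqrtK₁ X₁ X₂ 𝕂 (restrictProj σ (Δ ∩ X₁) (e k))) : L2 σ ⊗[ℂ] L2 σ) :
          HilbertTensor (L2 σ) (L2 σ))) k₁ ∧
      HasSum (fun k => (((sqrtK₂ X₁ X₂ 𝕂 (restrictProj σ (Δ ∩ X₂) (e k))) ⊗ₜ[ℂ]
        star (sqrtK₁ X₁ X₂ 𝕂 (restrictProj σ (Δ ∩ X₂) (e k))) : L2 σ ⊗[ℂ] L2 σ) :
          HilbertTensor (L2 σ) (L2 σ))) k₂ ∧
      HasSum (fun k => ‖sqrtK₁ X₁ X₂ 𝕂 (restrictProj σ (Δ ∩ X₁) (e k))‖ ^ 2) t₁ ∧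
      HasSum (fun k => ‖sqrtK₂ X₁ X₂ 𝕂 (restrictProj σ (Δ ∩ X₂) (e k))‖ ^ 2) t₂ ∧
      IsKernel (sqrtK₂ X₁ X₂ 𝕂 ∘L (restrictProj σ (Δ ∩ X₁) - restrictProj σ (Δ ∩ X₂)) ∘L
        sqrtK₁ X₁ X₂ 𝕂) (k₁ - k₂) ∧
      particleDensity X₁ X₂ 𝕂 Δ = densityOp (sqrtK₁ X₁ X₂ 𝕂) (sqrtK₂ X₁ X₂ 𝕂)
        (restrictProj σ (Δ ∩ X₁) - restrictProj σ (Δ ∩ X₂)) (k₁ - k₂) (t₁ + t₂) := by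
  have hΔ₁ := hΔ.inter H.meas
  have hΔ₂ := hΔ.inter H.meas₂
  obtain ⟨t₁, ht₁, htr₁⟩ := H.trace₁ _ hΔ₁ Set.inter_subset_right
  obtain ⟨t₂, ht₂, htr₂⟩ := H.trace₂ _ hΔ₂ Set.inter_subset_right
  set K₁ := sqrtK₁ X₁ X₂ 𝕂 with hK₁
  set K₂ := sqrtK₂ X₁ X₂ 𝕂 with hK₂
  have hop {Δ' : Set X} (h : MeasurableSet Δ') :
      (K₂ ∘L restrictProj σ Δ') ∘L (K₁ ∘L restrictProj σ Δ').adjoint =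
        K₂ ∘L restrictProj σ Δ' ∘L K₁ := by
    have hadj : (K₁ ∘L restrictProj σ Δ').adjoint = restrictProj σ Δ' ∘L K₁ := by
      refine ((ContinuousLinearMap.eq_adjoint_iff _ _).2 fun x y => ?_).symm
      simp only [ContinuousLinearMap.comp_apply]
      rw [inner_restrictProj h, H.pair.symm₁]
    rw [hadj]
    ext1 x
    simp only [ContinuousLinearMap.comp_apply]
    rw [restrictProj_idem h]
  obtain ⟨k₁, hk₁, hker₁⟩ := exists_hasSum_isKernel e H.real (K₂ ∘L restrictProj σ (Δ ∩ X₁))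
    (K₁ ∘L restrictProj σ (Δ ∩ X₁)) (Or.inr ht₁.summable)
  obtain ⟨k₂, hk₂, hker₂⟩ := exists_hasSum_isKernel e H.real (K₂ ∘L restrictProj σ (Δ ∩ X₂))
    (K₁ ∘L restrictProj σ (Δ ∩ X₂)) (Or.inl ht₂.summable)
  rw [hop hΔ₁.1] at hker₁
  rw [hop hΔ₂.1] at hker₂
  have hker : IsKernel (K₂ ∘L (restrictProj σ (Δ ∩ X₁) - restrictProj σ (Δ ∩ X₂)) ∘L K₁)
      (k₁ - k₂) := by
    have h := hker₁.sub hker₂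
    rwa [← ContinuousLinearMap.comp_sub, ← ContinuousLinearMap.sub_comp] at h
  refine ⟨k₁, k₂, t₁, t₂, hk₁, hk₂, ht₁, ht₂, hker, ?_⟩
  rw [hker.unique hker.isKernel_integralKernel, ← htr₁, ← htr₂]
  rfl

theorem symm_restrictProj_sub (H : IsAdmissible X₁ X₂ 𝕂 e) {Δ : Set X} (hΔ : MeasurableSet Δ)
    (x y : L2 σ) : ⟪(restrictProj σ (Δ ∩ X₁) - restrictProj σ (Δ ∩ X₂)) x, y⟫ =
      ⟪x, (restrictProj σ (Δ ∩ X₁) - restrictProj σ (Δ ∩ X₂)) y⟫ := by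
  rw [sub_apply, sub_apply, inner_sub_left, inner_sub_right, inner_restrictProj (hΔ.inter H.meas),
    inner_restrictProj (hΔ.inter H.meas₂)]

theorem restrictProj_sub_fst (H : IsAdmissible X₁ X₂ 𝕂 e) {Δ Δ' : Set X} (hΔ : MeasurableSet Δ)
    (hΔ' : MeasurableSet Δ') (x : L2 σ) :
    (restrictProj σ (Δ ∩ X₁) - restrictProj σ (Δ ∩ X₂)) (restrictProj σ (Δ' ∩ X₁) x) =
      restrictProj σ (Δ ∩ Δ' ∩ X₁) x := by
  have h2 : Δ ∩ X₂ ∩ (Δ' ∩ X₁) = ∅ := by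
    rw [Set.inter_inter_inter_comm, H.compl.disjoint.symm.inter_eq, Set.inter_empty]
  rw [sub_apply, restrictProj_comp (hΔ.inter H.meas) (hΔ'.inter H.meas),
    restrictProj_comp (hΔ.inter H.meas₂) (hΔ'.inter H.meas), h2, restrictProj_empty, sub_zero,
    ← Set.inter_inter_distrib_right]

theorem restrictProj_sub_snd (H : IsAdmissible X₁ X₂ 𝕂 e) {Δ Δ' : Set X} (hΔ : MeasurableSet Δ)
    (hΔ' : MeasurableSet Δ') (x : L2 σ) :
    (restrictProj σ (Δ ∩ X₁) - restrictProj σ (Δ ∩ X₂)) (restrictProj σ (Δ' ∩ X₂) x) =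
      -restrictProj σ (Δ ∩ Δ' ∩ X₂) x := by
  have h2 : Δ ∩ X₁ ∩ (Δ' ∩ X₂) = ∅ := by
    rw [Set.inter_inter_inter_comm, H.compl.disjoint.inter_eq, Set.inter_empty]
  rw [sub_apply, restrictProj_comp (hΔ.inter H.meas) (hΔ'.inter H.meas₂),
    restrictProj_comp (hΔ.inter H.meas₂) (hΔ'.inter H.meas₂), h2, restrictProj_empty, zero_sub,
    ← Set.inter_inter_distrib_right]

theorem particleDensity_mul_insertTerm (H : IsAdmissible X₁ X₂ 𝕂 e) {Δ₁ Δ₂ : Set X}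
    (h₁ : IsBoundedBorel Δ₁) (h₂ : MeasurableSet Δ₂) (Δr : Set X) (R : FockOp (L2Double σ))
    (k : ι) :
    particleDensity X₁ X₂ 𝕂 Δ₁ * insertTerm X₁ X₂ 𝕂 e Δ₂ Δr R k =
      insertTerm X₁ X₂ 𝕂 e Δ₂ Δr (particleDensity X₁ X₂ 𝕂 Δ₁ * R) k
        + insertTerm X₁ X₂ 𝕂 e (Δ₁ ∩ Δ₂) Δr R k := by
  obtain ⟨k₁, k₂, t₁, t₂, -, -, -, -, hk, hρ⟩ := H.exists_particleDensity_eq h₁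
  rw [hρ]
  simp only [insertTerm, mul_add, ← mul_assoc,
    densityOp_mul_fieldOp H.pair (H.symm_restrictProj_sub h₁.1) hk,
    densityOp_mul_fieldAdj H.pair (H.symm_restrictProj_sub h₁.1) hk,
    H.restrictProj_sub_fst h₁.1 h₂, H.restrictProj_sub_snd h₁.1 h₂, fieldAdj_neg, add_mul,
    sub_neg_eq_add]
  abel

theorem insertTerm_mul_particleDensity (H : IsAdmissible X₁ X₂ 𝕂 e) {Δ₁ Δ₂ : Set X}
    (h₁ : IsBoundedBorel Δ₁) (h₂ : MeasurableSet Δ₂) (Δl : Set X) (R : FockOp (L2Double σ))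
    (k : ι) :
    insertTerm X₁ X₂ 𝕂 e Δl Δ₂ R k * particleDensity X₁ X₂ 𝕂 Δ₁ =
      insertTerm X₁ X₂ 𝕂 e Δl Δ₂ (R * particleDensity X₁ X₂ 𝕂 Δ₁) k
        + insertTerm X₁ X₂ 𝕂 e Δl (Δ₁ ∩ Δ₂) R k := by
  obtain ⟨k₁, k₂, t₁, t₂, -, -, -, -, hk, hρ⟩ := H.exists_particleDensity_eq h₁
  rw [hρ]
  have h3 (u : L2 σ) := eq_sub_of_add_eq
    (densityOp_mul_fieldOp H.pair (H.symm_restrictProj_sub h₁.1) hk (t₁ + t₂) u).symm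
  have h4 (u : L2 σ) := eq_add_of_sub_eq
    (densityOp_mul_fieldAdj H.pair (H.symm_restrictProj_sub h₁.1) hk (t₁ + t₂) u).symm
  simp only [insertTerm, add_mul, mul_assoc, h3, h4,
    H.restrictProj_sub_fst h₁.1 h₂, H.restrictProj_sub_snd h₁.1 h₂, fieldOp_neg, mul_add,
    sub_neg_eq_add]
  abel

theorem particleDensity_mul_wickInsert (H : IsAdmissible X₁ X₂ 𝕂 e) {Δ₁ Δ₂ : Set X}
    (h₁ : IsBoundedBorel Δ₁) (h₂ : IsBoundedBorel Δ₂) (R : FockOp (L2Double σ)) :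
    particleDensity X₁ X₂ 𝕂 Δ₁ * wickInsert X₁ X₂ 𝕂 e Δ₂ R =
      wickInsert X₁ X₂ 𝕂 e Δ₂ (particleDensity X₁ X₂ 𝕂 Δ₁ * R)
        + wickInsert X₁ X₂ 𝕂 e (Δ₁ ∩ Δ₂) R := by
  refine ContinuousLinearMap.ext fun f => ?_
  have h := (H.hasSum_insertTerm h₂ h₂ R f).mapL (particleDensity X₁ X₂ 𝕂 Δ₁)
  have h' := (H.hasSum_insertTerm h₂ h₂ (particleDensity X₁ X₂ 𝕂 Δ₁ * R) f).add
    (H.hasSum_insertTerm (h₁.inter h₂.1) h₂ R f)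
  rw [Set.inter_self] at h h'
  rw [Set.inter_assoc, Set.inter_self] at h'
  refine h.unique (h'.congr_fun fun k => ?_)
  rw [← add_apply, ← H.particleDensity_mul_insertTerm h₁ h₂.1]
  rfl

theorem wickInsert_mul_particleDensity (H : IsAdmissible X₁ X₂ 𝕂 e) {Δ₁ Δ₂ : Set X}
    (h₁ : IsBoundedBorel Δ₁) (h₂ : IsBoundedBorel Δ₂) (R : FockOp (L2Double σ)) :
    wickInsert X₁ X₂ 𝕂 e Δ₂ R * particleDensity X₁ X₂ 𝕂 Δ₁ =
      wickInsert X₁ X₂ 𝕂 e Δ₂ (R * particleDensity X₁ X₂ 𝕂 Δ₁)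
        + wickInsert X₁ X₂ 𝕂 e (Δ₁ ∩ Δ₂) R := by
  refine ContinuousLinearMap.ext fun f => ?_
  have h := H.hasSum_insertTerm h₂ h₂ R (particleDensity X₁ X₂ 𝕂 Δ₁ f)
  have h' := (H.hasSum_insertTerm h₂ h₂ (R * particleDensity X₁ X₂ 𝕂 Δ₁) f).add
    (H.hasSum_insertTerm h₂ (h₁.inter h₂.1) R f)
  rw [Set.inter_self] at h h'
  rw [Set.inter_left_comm, Set.inter_self] at h'
  refine h.unique (h'.congr_fun fun k => ?_)
  rw [← add_apply, ← H.insertTerm_mul_particleDensity h₁ h₂.1]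
  rfl

/-- The density is `∫_Δ A⁺(x) A⁻(x) σ(dx)`: both sides have the same commutators with creation
operators and the same value on the vacuum. -/
theorem wickInsert_one (H : IsAdmissible X₁ X₂ 𝕂 e) {Δ : Set X} (hΔ : IsBoundedBorel Δ) :
    wickInsert X₁ X₂ 𝕂 e Δ 1 = particleDensity X₁ X₂ 𝕂 Δ := by
  obtain ⟨k₁, k₂, t₁, t₂, hk₁, hk₂, ht₁, ht₂, hk, hρ⟩ := H.exists_particleDensity_eq hΔ
  have hm₁ := hΔ.1.inter H.meas
  have hm₂ := hΔ.1.inter H.meas₂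
  set K₁ := sqrtK₁ X₁ X₂ 𝕂 with hK₁
  set K₂ := sqrtK₂ X₁ X₂ 𝕂 with hK₂
  have hW (f : FockFin (L2Double σ)) := H.hasSum_insertTerm hΔ hΔ 1 f
  rw [Set.inter_self] at hW
  refine FockOp.eq_of_commute_create (fun φ f => ?_) fun v => ?_
  · have h1 := (hW (create φ f)).sub ((hW f).mapL (create φ))
    have h2 := ((hasSum_inner_smul_fieldOp e K₁ K₂ hm₁ (K₂ φ.snd) f).sub
      (hasSum_inner_smul_fieldAdj e K₁ K₂ hm₁ (K₁ (star φ.fst)) f)).sub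
      ((hasSum_inner_smul_fieldOp e K₁ K₂ hm₂ (K₂ φ.snd) f).sub
      (hasSum_inner_smul_fieldAdj e K₁ K₂ hm₂ (K₁ (star φ.fst)) f))
    have h3 := congrArg (fun T : FockOp (L2Double σ) => T f) (densityOp_mul_create_eq_field
      (K₁ := K₁) (K₂ := K₂) H.pair (H.symm_restrictProj_sub hΔ.1) hk (t₁ + t₂) φ)
    rw [hρ]
    refine Eq.trans ?_ h3.symm
    refine (h1.unique (h2.congr_fun fun k => ?_)).trans ?_
    · rw [← H.pair.symm₂, ← H.pair.symm₂, H.pair.symm₁, H.pair.symm₁]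
      have h4 (u : L2 σ) : fieldOp K₁ K₂ u * 1 * fieldAdj K₁ K₂ u * create φ
          - create φ * (fieldOp K₁ K₂ u * 1 * fieldAdj K₁ K₂ u) =
          ⟪K₂ u, φ.snd⟫ • fieldOp K₁ K₂ u - ⟪star φ.fst, K₁ u⟫ • fieldAdj K₁ K₂ u := by
        rw [mul_one, mul_assoc, fieldAdj_mul_create, mul_sub, ← mul_assoc, ← mul_assoc (create φ),
          fieldOp_mul_create, sub_mul, mul_smul_comm, smul_mul_assoc, mul_one, one_mul]
        abel
      have h5 (u : L2 σ) : fieldAdj K₁ K₂ u * 1 * fieldOp K₁ K₂ u * create φ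
          - create φ * (fieldAdj K₁ K₂ u * 1 * fieldOp K₁ K₂ u) =
          -(⟪K₂ u, φ.snd⟫ • fieldOp K₁ K₂ u - ⟪star φ.fst, K₁ u⟫ • fieldAdj K₁ K₂ u) := by
        rw [mul_one, mul_assoc, fieldOp_mul_create, mul_sub, ← mul_assoc, ← mul_assoc (create φ),
          fieldAdj_mul_create, sub_mul, mul_smul_comm, smul_mul_assoc, mul_one, one_mul]
        abel
      have h6 : insertTerm X₁ X₂ 𝕂 e Δ Δ 1 k * create φ
          - create φ * insertTerm X₁ X₂ 𝕂 e Δ Δ 1 k = _ :=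
        (by rw [insertTerm, add_mul, mul_add, add_sub_add_comm] :
          _ = _ + _).trans (congrArg₂ (· + ·) (h4 _) (h5 _))
      rw [← sub_eq_add_neg] at h6
      exact congrArg (fun T : FockOp (L2Double σ) => T f) h6
    · simp only [sub_apply, fieldOp_sub, fieldAdj_sub]
      abel
  · have hpair (κ : ι → HilbertTensor (L2 σ) (L2 σ)) (κ' : HilbertTensor (L2 σ) (L2 σ))
        (h : HasSum κ κ') : HasSum (fun k => createPair (pairTwoOne (κ k)) (fockWedge 0 v))
          (createPair (pairTwoOne κ') (fockWedge 0 v)) :=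
      h.map (AddMonoidHom.mk' (fun κ => createPair (pairTwoOne κ) (fockWedge 0 v)) fun a b => by
        rw [map_add, createPair_add, add_apply])
        ((continuous_createPair _).comp (pairTwoOne (σ := σ)).continuous)
    have h1 := ((hpair _ _ hk₁).add ((Complex.hasSum_ofReal.2 ht₁).smul_const (fockWedge 0 v))).add
      (((Complex.hasSum_ofReal.2 ht₂).smul_const (fockWedge 0 v)).sub (hpair _ _ hk₂))
    refine ((hW (fockWedge 0 v)).unique (h1.congr_fun fun k => ?_)).trans ?_
    · rw [← fieldOp_fieldAdj_vacuum, ← fieldAdj_fieldOp_vacuum]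
      rfl
    · rw [hρ, densityOp, add_apply, add_apply, add_apply, annihilatePair_fockWedge_zero,
        secondQuant_fockWedge_zero, smul_apply, one_apply_eq_self, map_sub, sub_eq_add_neg (pairTwoOne k₁),
        createPair_add, createPair_neg, add_apply, neg_apply, add_smul]
      abel

/-- Comparing the left and the right multiplication of `W(Δ₂, 1) = ρ(Δ₂)` by `ρ(Δ₁)`. -/
theorem particleDensity_comm (H : IsAdmissible X₁ X₂ 𝕂 e) {Δ₁ Δ₂ : Set X}
    (h₁ : IsBoundedBorel Δ₁) (h₂ : IsBoundedBorel Δ₂) :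
    particleDensity X₁ X₂ 𝕂 Δ₁ * particleDensity X₁ X₂ 𝕂 Δ₂ =
      particleDensity X₁ X₂ 𝕂 Δ₂ * particleDensity X₁ X₂ 𝕂 Δ₁ := by
  have h := H.particleDensity_mul_wickInsert h₁ h₂ 1
  have h' := H.wickInsert_mul_particleDensity h₁ h₂ 1
  rw [mul_one] at h
  rw [one_mul] at h'
  rw [← H.wickInsert_one h₂, h, h']

/-- The recurrence for Wick polynomials expresses
`:ρ(Δ 0) ⋯ ρ(Δ n) ρ(B) ρ(C):` through Wick polynomials ending in `ρ(B)`, hence, by induction and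
`particleDensity_mul_wickInsert`, as `W(B, :ρ(Δ 0) ⋯ ρ(Δ n) ρ(C):)`; by symmetry in the last two
sets, `B` and `C` can be exchanged. -/
theorem wickPoly_eq_wickInsert (H : IsAdmissible X₁ X₂ 𝕂 e) (n : ℕ) (Δ : Fin (n + 1) → Set X)
    (hΔ : ∀ i, IsBoundedBorel (Δ i)) (B : Set X) (hB : IsBoundedBorel B) :
    wickPoly (particleDensity X₁ X₂ 𝕂) (n + 1) (Fin.snoc (α := fun _ => Set X) Δ B) =
      wickInsert X₁ X₂ 𝕂 e B (wickPoly (particleDensity X₁ X₂ 𝕂) n Δ) := by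
  induction n generalizing B with
  | zero =>
    have h := H.wickInsert_mul_particleDensity (hΔ 0) hB 1
    rw [one_mul, H.wickInsert_one hB, H.wickInsert_one ((hΔ 0).inter hB.1)] at h
    rw [wickPoly_snoc, Fin.sum_univ_one]
    simp only [wickPoly, Function.update_self]
    rw [h, add_sub_cancel_right]
  | succ n ih =>
    obtain ⟨Δ, C, rfl⟩ : ∃ (Δ' : Fin (n + 1) → Set X) (C : Set X),
        Δ = Fin.snoc (α := fun _ => Set X) Δ' C := ⟨Fin.init Δ, Δ (Fin.last _),
          (Fin.snoc_init_self Δ).symm⟩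
    have hΔ' (i : Fin (n + 1)) : IsBoundedBorel (Δ i) := by
      have := hΔ i.castSucc
      rwa [Fin.snoc_castSucc] at this
    have hC : IsBoundedBorel C := by
      have := hΔ (Fin.last _)
      rwa [Fin.snoc_last] at this
    have hup (i : Fin (n + 1)) (j : Fin (n + 1)) :
        IsBoundedBorel (Function.update Δ i (Δ i ∩ C) j) := by
      rcases eq_or_ne j i with rfl | hij
      · rw [Function.update_self]
        exact (hΔ' j).inter hC.1
      · rw [Function.update_of_ne hij]
        exact hΔ' j
    let w : FockOp (L2Double σ) →+ FockOp (L2Double σ) :=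
      AddMonoidHom.mk' (fun R => wickInsert X₁ X₂ 𝕂 e B R) (H.wickInsert_add hB)
    -- exchange `C` and `B`, expand along `C`, and apply the induction hypothesis, where `B` is last
    rw [wickPoly_snoc_snoc_comm _ n Δ C B (H.particleDensity_comm hC hB), wickPoly_snoc_snoc,
      ih Δ hΔ' B hB, ih Δ hΔ' _ (hB.inter hC.1), H.particleDensity_mul_wickInsert hC hB,
      Set.inter_comm C B, wickPoly_snoc]
    simp only [ih _ (hup _) B hB]
    refine Eq.trans ?_ (map_sub w _ _).symm
    rw [map_sum]
    change w _ + _ - _ - _ = _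
    rw [add_sub_right_comm, add_sub_cancel_right]
    rfl

end IsAdmissible

end Insertion

theorem mainTheorem3 {X : Type u} [TopologicalSpace X] [PolishSpace X] [LocallyCompactSpace X]
    [MeasurableSpace X] [BorelSpace X] (σ : Measure X) [IsLocallyFiniteMeasure σ]
    (X₁ X₂ : Set X) (hX₁ : MeasurableSet X₁) (hX : IsCompl X₁ X₂)
    (𝕂 : L2 σ →L[ℂ] L2 σ) (hJ : IsJSelfAdjoint σ X₁ X₂ 𝕂)
    (h₁ : IsLocallyTraceClassOn σ X₁ 𝕂) (h₂ : IsLocallyTraceClassOn σ X₂ 𝕂)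
    (hK₀ : 0 ≤ hatOp σ X₁ X₂ 𝕂) (hK₁ : hatOp σ X₁ X₂ 𝕂 ≤ 1)
    {ι : Type*} (e : HilbertBasis ι ℂ (L2 σ)) (he : ∀ i, star (e i) = e i) :
    (∀ Δ, IsBoundedBorel Δ → Δ ⊆ X₁ → ∀ R,
      HasStrongSum₂ (wTerm₁ X₁ X₂ 𝕂 e Δ R) (wickInsert X₁ X₂ 𝕂 e Δ R)) ∧
    (∀ Δ, IsBoundedBorel Δ → Δ ⊆ X₂ → ∀ R,
      HasStrongSum₂ (wTerm₂ X₁ X₂ 𝕂 e Δ R) (wickInsert X₁ X₂ 𝕂 e Δ R)) ∧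
    (∀ Δ, IsBoundedBorel Δ → ∀ R,
      wickInsert X₁ X₂ 𝕂 e Δ R =
        wickInsert X₁ X₂ 𝕂 e (Δ ∩ X₁) R + wickInsert X₁ X₂ 𝕂 e (Δ ∩ X₂) R) ∧
    (∀ Δ₁ Δ₂, IsBoundedBorel Δ₁ → IsBoundedBorel Δ₂ → ∀ R,
      particleDensity X₁ X₂ 𝕂 Δ₁ * wickInsert X₁ X₂ 𝕂 e Δ₂ R =
        wickInsert X₁ X₂ 𝕂 e Δ₂ (particleDensity X₁ X₂ 𝕂 Δ₁ * R)
          + wickInsert X₁ X₂ 𝕂 e (Δ₁ ∩ Δ₂) R) ∧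
    (∀ (n : ℕ) (Δ : Fin (n + 2) → Set X), (∀ i, IsBoundedBorel (Δ i)) →
      wickPoly (particleDensity X₁ X₂ 𝕂) (n + 1) Δ =
        wickInsert X₁ X₂ 𝕂 e (Δ (Fin.last (n + 1)))
          (wickPoly (particleDensity X₁ X₂ 𝕂) n (Fin.init Δ))) := by
  have H := isAdmissible e hX₁ hX h₁ h₂ hK₀ hK₁ he
  refine ⟨fun Δ hΔ h R => H.hasStrongSum₂_wTerm₁ hΔ h R,
    fun Δ hΔ h R => H.hasStrongSum₂_wTerm₂ hΔ h R, fun Δ hΔ R => ?_,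
    fun Δ₁ Δ₂ hΔ₁ hΔ₂ R => H.particleDensity_mul_wickInsert hΔ₁ hΔ₂ R, fun n Δ hΔ => ?_⟩
  · have h12 : Δ ∩ X₁ ∩ X₂ = ∅ := by rw [Set.inter_assoc, hX.disjoint.inter_eq, Set.inter_empty]
    have h21 : Δ ∩ X₂ ∩ X₁ = ∅ := by rw [Set.inter_right_comm, h12]
    simp only [wickInsert]
    rw [h12, h21, strongSum₂_wTerm₁_empty, strongSum₂_wTerm₂_empty, add_zero, zero_add,
      Set.inter_assoc, Set.inter_self, Set.inter_assoc, Set.inter_self]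
  · have h := H.wickPoly_eq_wickInsert n (Fin.init Δ) (fun i => hΔ _) (Δ (Fin.last (n + 1)))
      (hΔ _)
    rwa [Fin.snoc_init_self] at h
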